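/- Write $\mathbb{T}^d=\mathbb{R}^d/\mathbb{Z}^d$ with $d\ge 1$, and use the supremum norm on $\mathbb{R}^d$. Let $\Omega\in\mathbb{R}^d$ be irrational ($\Omega\cdot k\neq 0$ for $k\in\mathbb{Z}^d\setminus\{0\}$), let $I\subseteq\mathbb{R}$ be a nondegenerate interval containing $0$, and for $\alpha\in\mathbb{R}$, $\varepsilon\in I$ consider $$F_{\alpha,\varepsilon}(x)=x+\alpha\Omega+\varepsilon f_\varepsilon(x)\Omega,\qquad x\in\mathbb{T}^d .$$ Let $\alpha_0\ne 0$ be such that $\alpha_0\Omega$ is resonant ($\alpha_0\Omega\cdot k\in\mathbb{Z}$ for some $k\in\mathbb{Z}^d\setminus\{0\}$) with intrinsic frequency $\omega\in\mathbb{R}^{d-1}$, i.e. there are $\mathfrak{A}\in \mathrm{SL}(d,\mathbb{Z})$ and $L=(L_1,L_2)\in\mathbb{Z}^{d-1}\times\mathbb{Z}$ with $\mathfrak{A}\alpha_0\Omega=(\omega,0)+L$ and $\omega\cdot k\ne0$ for $k\in\mathbb{Z}^{d-1}\setminus\{0\}$. Fix such $\mathfrak{A},L$. Assume $\omega$ is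 Diophantine: for some $\nu>0$ and $\tau\in\mathbb{R}$, $|k\cdot\omega-l|\ge\nu|k|^{-\tau}$ for all $k\in\mathbb{Z}^{d-1}\setminus\{0\}$, $l\in\mathbb{Z}$. Averaging data. For a function $P$ on $\mathbb{T}^d$ let $\widehat{P}(k)$ denote the Fourier coefficients of $P\circ\mathfrak{A}^{-1}$, and put $$\langle P\rangle(x_2)=\sum_{l\in\mathbb{Z}}\widehat P((0,l))e^{2\pi i l x_2},\qquad S P(x)=\sum_{k=(k',l)\in\mathbb{Z}^{d-1}\times\mathbb{Z},\ k'\neq0}\frac{\widehat P(k)}{e^{2\pi i k'\cdot\omega}-1}\,e^{2\pi i k\cdot\mathfrak{A}x}.$$ Define recursively, for $j=0,1,\dots$, functions $p^j$ and $h^j=S p^j$ on $\mathbb{T}^d$: with $H=\mathrm{Id}+\sum_{i<j}\varepsilon^{i+1}h^i\Omega$, the function $p^j$ is the coefficient, in the direction $\Omega$, of $\varepsilon^{j+1}$ in the expansion of $H^{-1}\circ F_{\alpha_0,\varepsilon}\circ H$ in powers of $\varepsilon$ (the terms of lower order being $x+\alpha_0\Omega+\sum_{i<j}\varepsilon^{i+1}\langle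 p^i\rangle((\mathfrak{A}x)_d)\,\Omega$). Let $a_s=\langle p^{s-1}\rangle$ for $s\ge1$, let $n=\min\{s\ge1: a_s\not\equiv0\}$ (assumed to exist), let $m\ge1$, $N=n+m-1$, and $$H_\varepsilon=\mathrm{Id}+\sum_{j=0}^{N-1}\varepsilon^{j+1}h^j\Omega,\qquad \begin{pmatrix}\beta(x_2,\varepsilon)\\ \eta(x_2,\varepsilon)\end{pmatrix}=\alpha_0^{-1}\begin{pmatrix}\omega+L_1\\L_2\end{pmatrix}\sum_{j=n}^{n+m-1}\varepsilon^{j-n}a_j(x_2),$$ $$\widetilde\Delta^{0}(\alpha)=H_\varepsilon^{-1}\circ F_{\alpha,\varepsilon}\circ H_\varepsilon-H_\varepsilon^{-1}\circ F_{\alpha_0,\varepsilon}\circ H_\varepsilon,\qquad \widetilde\Delta(\alpha)=(\widetilde\Delta_1(\alpha),\widetilde\Delta_2(\alpha))=\mathfrak{A}\circ\widetilde\Delta^{0}(\alpha)\circ\mathfrak{A}^{-1}.$$ Theorem. Suppose that either (a) $F_{\alpha,\varepsilon}$ is real analytic in $x$ and $\mathscr{C}^{n+m}$ in $\varepsilon\in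 I$ (that is, $\varepsilon f_\varepsilon$ and its $\varepsilon$-derivatives up to order $n+m$ extend holomorphically in $x$ to a common complex strip around $\mathbb{T}^d$, continuously in $(\varepsilon,x)$); or (b) $F_{\alpha,\varepsilon}$ is $\mathscr{C}^p$ in $x$ and $\mathscr{C}^{n+m}$ in $\varepsilon$ (that is, $\varepsilon\mapsto\varepsilon f_\varepsilon\in\mathscr{C}^p(\mathbb{T}^d)$ is $\mathscr{C}^{n+m}$ on $I$), where $p,q\in\mathbb{N}$ and $p>q\ge(n+m-1)(d+\tau)$. Then there are $\varepsilon_1>0$ and $C$ such that the functions $h^0,\dots,h^{N-1}$ are real analytic in case (a), respectively $\mathscr{C}^{p-q}$ in case (b), and for all $\varepsilon\in I$ with $|\varepsilon|<\varepsilon_1$ the following holds. The map $H_\varepsilon$ is invertible, $H_\varepsilon$ and $H_\varepsilon^{-1}$ are real analytic (respectively $\mathscr{C}^{p-q}$), and for every $\alpha\in\mathbb{R}$ the map $\mathfrak{A}\circ H_\varepsilon^{-1}\circ F_{\alpha,\varepsilon}\circ H_\varepsilon\circ\mathfrak{A}^{-1}$ of $\mathbb{T}^{d-1}\times\mathbb{T}$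 is $$\begin{pmatrix}x_1\\x_2\end{pmatrix}\mapsto\begin{pmatrix}x_1+\omega+\varepsilon^n\beta(x_2,\varepsilon)+\varepsilon^{n+m}r_1(x_1,x_2;\varepsilon)+\widetilde\Delta_1(\alpha)\\ x_2+\varepsilon^n\eta(x_2,\varepsilon)+\varepsilon^{n+m}r_2(x_1,x_2;\varepsilon)+\widetilde\Delta_2(\alpha)\end{pmatrix}.$$ Here $r_1,r_2$ are real analytic (respectively $\mathscr{C}^{p-q}$) functions on $\mathbb{T}^d$ and $\beta,\eta$ are real analytic (respectively $\mathscr{C}^{p-q}$) functions of $x_2\in\mathbb{T}$. In case (a) the functions $h^j$, $H_\varepsilon-\mathrm{Id}$, $H_\varepsilon^{-1}-\mathrm{Id}$, $r_i$, $\beta$, $\eta$ extend holomorphically to complex strips of a common width $\rho>0$ independent of $\varepsilon$ and are bounded there by $C$; in case (b) their $\mathscr{C}^{p-q}$ norms are bounded by $C$. Moreover, for all $\alpha$, $$\|\widetilde\Delta^{0}(\alpha)\|_{\mathscr{C}^0}\le\|D(H_\varepsilon^{-1})\|_{\mathscr{C}^0}\,|\Omega|\,|\alpha-\alpha_0|,\qquad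 \|\widetilde\Delta(\alpha)\|_{\mathscr{C}^0}\le C|\alpha-\alpha_0| .$$ -/

import Mathlib

open Filter Topology MeasureTheory
open scoped Matrix

namespace FPTM

/-! Functions on the torus `ℝ^d / ℤ^d` are `ℤ^d`-periodic functions on `ℝ^d`; maps of the torus are
given by their lifts to `ℝ^d`. The spaces `ℝ^d` and `ℂ^d` (`Fin d → ℝ`, `Fin d → ℂ`) carry the
supremum norm. -/

/-- The integer vector `k` as a real vector. -/
def intVec {d : ℕ} (k : Fin d → ℤ) : Fin d → ℝ := fun i => (k i : ℝ)

/-- `Ω · k ≠ 0` for all nonzero integer vectors `k`. -/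
def IsIrrational {d : ℕ} (Ω : Fin d → ℝ) : Prop :=
  ∀ k : Fin d → ℤ, k ≠ 0 → Ω ⬝ᵥ intVec k ≠ 0

/-- `Ω · k` is an integer for some nonzero integer vector `k`. -/
def IsResonant {d : ℕ} (Ω : Fin d → ℝ) : Prop :=
  ∃ k : Fin d → ℤ, k ≠ 0 ∧ ∃ l : ℤ, Ω ⬝ᵥ intVec k - (l : ℝ) = 0

/-- `|k · ω - l| ≥ ν |k|^{-τ}` for all nonzero integer vectors `k` and all integers `l`. -/
def IsDiophantine {s : ℕ} (ν τ : ℝ) (ω : Fin s → ℝ) : Prop :=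
  ∀ k : Fin s → ℤ, k ≠ 0 → ∀ l : ℤ, ν * ‖k‖ ^ (-τ) ≤ |intVec k ⬝ᵥ ω - (l : ℝ)|

/-- The linear action of an integer matrix of determinant one on `ℝ^d`. -/
def act {d : ℕ} (A : Matrix.SpecialLinearGroup (Fin d) ℤ) (x : Fin d → ℝ) : Fin d → ℝ :=
  ((A : Matrix (Fin d) (Fin d) ℤ).map (fun t : ℤ => (t : ℝ))) *ᵥ x

/-- `ω` is the intrinsic frequency of the frequency `θ`, realised by the matrix `A` and the
integer vector `L`: `A θ = (ω, 0) + L`, and `ω · k ≠ 0` for every nonzero integer vector `k`. -/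
def IsIntrinsicFrequency {e : ℕ} (θ : Fin (e + 1) → ℝ)
    (A : Matrix.SpecialLinearGroup (Fin (e + 1)) ℤ) (ω : Fin e → ℝ) (L : Fin (e + 1) → ℤ) : Prop :=
  act A θ = (Fin.snoc ω 0 : Fin (e + 1) → ℝ) + intVec L ∧
    ∀ k : Fin e → ℤ, k ≠ 0 → ω ⬝ᵥ intVec k ≠ 0

/-! ### Function classes on the torus -/

def IsPeriodic {d : ℕ} (g : (Fin d → ℝ) → ℝ) : Prop :=
  ∀ (x : Fin d → ℝ) (k : Fin d → ℤ), g (x + intVec k) = g x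

/-- The complex strip `|Im z| < ρ`. -/
def strip (d : ℕ) (ρ : ℝ) : Set (Fin d → ℂ) := {z | ∀ i, |(z i).im| < ρ}

def complexify {d : ℕ} (x : Fin d → ℝ) : Fin d → ℂ := fun i => (x i : ℂ)

/-- A class of functions on tori of arbitrary dimension, with a bound on the norm:
`K d C g` says that `g` is in the class and has norm at most `C` there. -/
abbrev FunctionClass : Type := (d : ℕ) → ℝ → ((Fin d → ℝ) → ℝ) → Prop

/-- `g` is a `C^k` function on the torus, with `C^k` norm at most `C`. -/
def ckClass (k : ℕ) : FunctionClass := fun _ C g =>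
  IsPeriodic g ∧ ContDiff ℝ k g ∧ ∀ i : ℕ, i ≤ k → ∀ x, ‖iteratedFDeriv ℝ i g x‖ ≤ C

/-- `g` is a real analytic function on the torus that extends holomorphically to the complex strip
of width `ρ`, with supremum norm at most `C` on that strip. -/
def analyticClass (ρ : ℝ) : FunctionClass := fun d C g =>
  IsPeriodic g ∧ ∃ G : (Fin d → ℂ) → ℂ, DifferentiableOn ℂ G (strip d ρ) ∧
    (∀ x : Fin d → ℝ, G (complexify x) = (g x : ℂ)) ∧ ∀ z ∈ strip d ρ, ‖G z‖ ≤ C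

/-- The family `g ε`, `ε ∈ I`, of functions on the torus is `C^p` in `x` and `C^k` in `ε`, that is,
`ε ↦ g ε` is a `C^k` map from the interval `I` to the space of `C^p` functions on the torus.
`G j` is the `j`-th derivative in `ε`. -/
def IsCkFamily {d : ℕ} (p k : ℕ) (I : Set ℝ) (g : ℝ → (Fin d → ℝ) → ℝ) : Prop :=
  (∀ ε ∈ I, IsPeriodic (g ε)) ∧
  ∃ G : ℕ → ℝ → (Fin d → ℝ) → ℝ,
    (∀ ε ∈ I, G 0 ε = g ε) ∧
    (∀ j ≤ k, ∀ ε ∈ I, ContDiff ℝ p (G j ε)) ∧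
    (∀ j ≤ k, ∀ i ≤ p, ContinuousOn
      (fun z : ℝ × (Fin d → ℝ) => iteratedFDeriv ℝ i (G j z.1) z.2) (I ×ˢ Set.univ)) ∧
    ∀ j < k, ∀ ε ∈ I, ∀ x, HasDerivWithinAt (fun s => G j s x) (G (j + 1) ε x) I ε

/-- The family `g ε`, `ε ∈ I`, of functions on the torus is real analytic in `x` and `C^k` in `ε`:
it extends to a family of holomorphic functions on a common complex strip that is `C^k` in `ε`,
locally uniformly on the strip. `G j` is the `j`-th derivative in `ε`. -/
def IsAnalyticFamily {d : ℕ} (k : ℕ) (I : Set ℝ) (g : ℝ → (Fin d → ℝ) → ℝ) : Prop :=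
  (∀ ε ∈ I, IsPeriodic (g ε)) ∧
  ∃ ρ : ℝ, 0 < ρ ∧ ∃ G : ℕ → ℝ → (Fin d → ℂ) → ℂ,
    (∀ ε ∈ I, ∀ x, G 0 ε (complexify x) = (g ε x : ℂ)) ∧
    (∀ j ≤ k, ∀ ε ∈ I, DifferentiableOn ℂ (G j ε) (strip d ρ)) ∧
    (∀ j ≤ k, ContinuousOn (fun z : ℝ × (Fin d → ℂ) => G j z.1 z.2) (I ×ˢ strip d ρ)) ∧
    ∀ j < k, ∀ ε ∈ I, ∀ z ∈ strip d ρ,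
      HasDerivWithinAt (fun s => G j s z) (G (j + 1) ε z) I ε

/-! ### Foliation preserving maps -/

/-- The map `Id + φ Ω`. -/
def leafMap {d : ℕ} (Ω : Fin d → ℝ) (φ : (Fin d → ℝ) → ℝ) (x : Fin d → ℝ) : Fin d → ℝ :=
  x + φ x • Ω

/-- `F_{α,ε}(x) = x + α Ω + ε f_ε(x) Ω`. -/
def fptm {d : ℕ} (Ω : Fin d → ℝ) (f : ℝ → (Fin d → ℝ) → ℝ) (α ε : ℝ)
    (x : Fin d → ℝ) : Fin d → ℝ :=
  x + α • Ω + (ε * f ε x) • Ω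

/-- The number `c` with `v = c Ω`, for `v` in the line spanned by `Ω ≠ 0`. -/
noncomputable def along {d : ℕ} (Ω v : Fin d → ℝ) : ℝ := (Ω ⬝ᵥ v) / (Ω ⬝ᵥ Ω)

/-! ### Averaging -/

/-- The character `exp (2 π i t)`. -/
noncomputable def expi (t : ℝ) : ℂ := Complex.exp (2 * Real.pi * Complex.I * (t : ℂ))

/-- The `k`-th Fourier coefficient of a function on the torus. -/
noncomputable def fourierCoef {d : ℕ} (g : (Fin d → ℝ) → ℝ) (k : Fin d → ℤ) : ℂ :=
  ∫ x in Set.Icc (0 : Fin d → ℝ) 1, (g x : ℂ) * expi (-(intVec k ⬝ᵥ x))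

section Averaging

variable {e : ℕ} (A : Matrix.SpecialLinearGroup (Fin (e + 1)) ℤ) (ω : Fin e → ℝ)

/-- The resonant part of `P`, a function on the circle:
the sum over `l ∈ ℤ` of `c (0, l) e^{2 π i l y}`, where `c` are the Fourier coefficients
of `P ∘ A⁻¹`. -/
noncomputable def resonantPart (P : (Fin (e + 1) → ℝ) → ℝ) (y : ℝ) : ℝ :=
  (∑' l : ℤ, fourierCoef (fun x => P (act A⁻¹ x)) (Fin.snoc (0 : Fin e → ℤ) l : Fin (e + 1) → ℤ) *
    expi (l * y)).re

/-- The solution `h` of the cohomology equation `h ∘ T - h = P` up to the resonant part of `P`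
(with `T` the translation by `α₀ Ω`): the sum over `k = (m, l) ∈ ℤ^{d-1} × ℤ` with `m ≠ 0` of
`c k / (e^{2 π i m · ω} - 1) * e^{2 π i k · A x}`, where `c` are the Fourier coefficients
of `P ∘ A⁻¹`. -/
noncomputable def cohomologySolution (P : (Fin (e + 1) → ℝ) → ℝ) (x : Fin (e + 1) → ℝ) : ℝ :=
  (∑' k : Fin (e + 1) → ℤ, if (Fin.init k : Fin e → ℤ) = 0 then 0 else
    fourierCoef (fun x => P (act A⁻¹ x)) k / (expi (intVec (Fin.init k : Fin e → ℤ) ⬝ᵥ ω) - 1) *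
      expi (intVec k ⬝ᵥ act A x)).re

variable (I : Set ℝ) (Ω : Fin (e + 1) → ℝ) (f : ℝ → (Fin (e + 1) → ℝ) → ℝ) (α₀ : ℝ)

/-- The function `p^j` of the averaging procedure: with `h^i` and `p^i` known for `i < j` and
`H = Id + (ε h^0 + ... + ε^j h^{j-1}) Ω`, it is the coefficient of `ε^{j+1}`, in direction `Ω`, in
the expansion of `H⁻¹ ∘ F_{α₀,ε} ∘ H` in powers of `ε`, whose terms of lower order are
`Id + α₀ Ω` and the resonant parts of `ε p^0, ..., ε^j p^{j-1}`. -/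
noncomputable def averagedTerm (j : ℕ) : (Fin (e + 1) → ℝ) → ℝ := fun x =>
  limUnder (𝓝[I \ {0}] (0 : ℝ)) fun ε : ℝ =>
    (ε ^ (j + 1))⁻¹ * along Ω
      (Function.invFun
          (leafMap Ω fun y => ∑ i : Fin j,
            ε ^ (i.1 + 1) * cohomologySolution A ω (averagedTerm i.1) y)
          (fptm Ω f α₀ ε
            (leafMap Ω (fun y => ∑ i : Fin j,
              ε ^ (i.1 + 1) * cohomologySolution A ω (averagedTerm i.1) y) x))
        - (x + α₀ • Ω + (∑ i : Fin j,
            ε ^ (i.1 + 1) * resonantPart A (averagedTerm i.1) (act A x (Fin.last e))) • Ω))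
termination_by j
decreasing_by all_goals exact i.2

/-- The function `h^j` of the averaging procedure. -/
noncomputable def averagingH (j : ℕ) : (Fin (e + 1) → ℝ) → ℝ :=
  cohomologySolution A ω (averagedTerm A ω I Ω f α₀ j)

/-- The near-identity change of variables `Id + (ε h^0 + ... + ε^N h^{N-1}) Ω`. -/
noncomputable def changeOfVariables (N : ℕ) (ε : ℝ) : (Fin (e + 1) → ℝ) → (Fin (e + 1) → ℝ) :=
  leafMap Ω fun y => ∑ j ∈ Finset.range N, ε ^ (j + 1) * averagingH A ω I Ω f α₀ j y

/-- The resonant term of order `ε^s` in the normal form, for `s ≥ 1`. -/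
noncomputable def resonantTerm (s : ℕ) : ℝ → ℝ :=
  resonantPart A (averagedTerm A ω I Ω f α₀ (s - 1))

/-- `n` is the order of the first resonant term, among those of order `s ≥ 1`, that does not vanish
identically. -/
def IsResonanceOrder (n : ℕ) : Prop :=
  IsLeast {s : ℕ | 1 ≤ s ∧ ∃ y, resonantTerm A ω I Ω f α₀ s y ≠ 0} n

/-- `∑_{n ≤ j ≤ n+m-1} ε^{j-n} a_j(y)`, with `a_j` the resonant term of order `ε^j`. -/
noncomputable def resonantSum (n m : ℕ) (y ε : ℝ) : ℝ :=
  ∑ j ∈ Finset.Icc n (n + m - 1), ε ^ (j - n) * resonantTerm A ω I Ω f α₀ j y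

variable (L : Fin (e + 1) → ℤ)

/-- `β = α₀⁻¹ (ω + L₁) ∑_{n ≤ j ≤ n+m-1} ε^{j-n} a_j`. -/
noncomputable def normalBeta (n m : ℕ) (y ε : ℝ) : Fin e → ℝ :=
  (α₀⁻¹ * resonantSum A ω I Ω f α₀ n m y ε) • (ω + intVec (Fin.init L : Fin e → ℤ))

/-- `η = α₀⁻¹ L₂ ∑_{n ≤ j ≤ n+m-1} ε^{j-n} a_j`. -/
noncomputable def normalEta (n m : ℕ) (y ε : ℝ) : ℝ :=
  (α₀⁻¹ * resonantSum A ω I Ω f α₀ n m y ε) * (L (Fin.last e) : ℝ)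

/-- `H⁻¹ ∘ F_{α,ε} ∘ H`, with `H` the change of variables of order `N`. -/
noncomputable def conjugated (N : ℕ) (α ε : ℝ) (x : Fin (e + 1) → ℝ) : Fin (e + 1) → ℝ :=
  Function.invFun (changeOfVariables A ω I Ω f α₀ N ε)
    (fptm Ω f α ε (changeOfVariables A ω I Ω f α₀ N ε x))

/-- `H⁻¹ ∘ F_{α,ε} ∘ H - H⁻¹ ∘ F_{α₀,ε} ∘ H`. -/
noncomputable def deltaMap (N : ℕ) (α ε : ℝ) (x : Fin (e + 1) → ℝ) : Fin (e + 1) → ℝ :=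
  conjugated A ω I Ω f α₀ N α ε x - conjugated A ω I Ω f α₀ N α₀ ε x

/-- The previous map in the coordinates given by `A`. -/
noncomputable def deltaMapA (N : ℕ) (α ε : ℝ) (x : Fin (e + 1) → ℝ) : Fin (e + 1) → ℝ :=
  act A (deltaMap A ω I Ω f α₀ N α ε (act A⁻¹ x))

/-- The resonant normal form with remainder `r` on `ℝ^{d-1} × ℝ`, as a lift of a map of the torus;
`x₁` is `Fin.init x` and `x₂` is `x (Fin.last e)`. -/
noncomputable def normalForm (n m : ℕ) (r : (Fin (e + 1) → ℝ) → (Fin (e + 1) → ℝ)) (α ε : ℝ)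
    (x : Fin (e + 1) → ℝ) : Fin (e + 1) → ℝ :=
  Fin.snoc
    (Fin.init x + ω + ε ^ n • normalBeta A ω I Ω f α₀ L n m (x (Fin.last e)) ε
      + ε ^ (n + m) • Fin.init (r x)
      + Fin.init (deltaMapA A ω I Ω f α₀ (n + m - 1) α ε x) : Fin e → ℝ)
    (x (Fin.last e) + ε ^ n * normalEta A ω I Ω f α₀ L n m (x (Fin.last e)) ε
      + ε ^ (n + m) * r x (Fin.last e)
      + deltaMapA A ω I Ω f α₀ (n + m - 1) α ε x (Fin.last e))

/-- For all small `ε ∈ I` and all `α`, the map `F_{α,ε}` is conjugated by `A` and the change of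
variables `H` of order `n + m - 1` to the resonant normal form, and all functions involved are in
the class `K`, with bounds that are uniform in `ε`. The identity is one between lifts: the constant
`L ∈ ℤ^d` is zero on the torus. -/
def HasResonantNormalForm (K : FunctionClass) (n m : ℕ) : Prop :=
  ∃ ε₁ : ℝ, 0 < ε₁ ∧ ∃ C : ℝ, ∃ r : ℝ → (Fin (e + 1) → ℝ) → (Fin (e + 1) → ℝ),
    (∀ j < n + m - 1, K (e + 1) C (averagingH A ω I Ω f α₀ j)) ∧
    ∀ ε ∈ I, |ε| < ε₁ →
      -- `H` and `H⁻¹` are maps of the torus in the class `K`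
      Function.Bijective (changeOfVariables A ω I Ω f α₀ (n + m - 1) ε) ∧
      (∀ i, K (e + 1) C fun x => changeOfVariables A ω I Ω f α₀ (n + m - 1) ε x i - x i) ∧
      (∀ i, K (e + 1) C fun x =>
        Function.invFun (changeOfVariables A ω I Ω f α₀ (n + m - 1) ε) x i - x i) ∧
      -- the normal form
      (∀ (α : ℝ) (x : Fin (e + 1) → ℝ),
        act A (conjugated A ω I Ω f α₀ (n + m - 1) α ε (act A⁻¹ x)) =
          normalForm A ω I Ω f α₀ L n m (r ε) α ε x + intVec L) ∧
      -- regularity of the remainder, of `β` and of `η`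
      (∀ i, K (e + 1) C fun x => r ε x i) ∧
      (∀ i, K 1 C fun y => normalBeta A ω I Ω f α₀ L n m (y 0) ε i) ∧
      (K 1 C fun y => normalEta A ω I Ω f α₀ L n m (y 0) ε) ∧
      -- dependence on `α`
      BddAbove (Set.range fun y =>
        ‖fderiv ℝ (Function.invFun (changeOfVariables A ω I Ω f α₀ (n + m - 1) ε)) y‖) ∧
      (∀ (α : ℝ) (x : Fin (e + 1) → ℝ), ‖deltaMap A ω I Ω f α₀ (n + m - 1) α ε x‖ ≤
        (⨆ y, ‖fderiv ℝ (Function.invFun (changeOfVariables A ω I Ω f α₀ (n + m - 1) ε)) y‖)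
          * ‖Ω‖ * |α - α₀|) ∧
      ∀ (α : ℝ) (x : Fin (e + 1) → ℝ),
        ‖deltaMapA A ω I Ω f α₀ (n + m - 1) α ε x‖ ≤ C * |α - α₀|

end Averaging

end FPTM

/-!
# Averaging to a resonant normal form

Every map in sight moves points along the line spanned by `Ω`, so it is given by one scalar function.
Write `v` for the displacement of the change of variables divided by `ε`, and `γ` for `f` (at
`ε = 0`, for its limit). Then `H⁻¹ ∘ F ∘ H = Id + α₀ Ω + ε w Ω`, where `w` solves the implicit equation
`w = v + γ (x + ε v Ω) - v (x + α₀ Ω + ε w Ω)` (`invFun_leafMap_fptm`). If `v` and `γ` have finite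
expansions in powers of `ε`, so does `w`: substituting an expansion of order `M` into the right-hand
side gives one of order `M + 1`. Adding `ε^j h` to `v` changes `w` by `ε^j (h - h ∘ T)` up to terms of
order `ε^{j+1}`, with `T` the translation by `α₀ Ω` (`RegularityScale.sub_isBigO`), and `h^j` is chosen
such that this turns the coefficient `p^j` into its resonant part. After `N = n + m - 1` steps the
terms of `w` of order less than `N` are resonant, and those of order less than `n - 1` vanish by the
choice of `n`; `A Ω = α₀⁻¹ (ω + L₁, L₂)` then gives the normal form.

The bookkeeping of regularity is separated from this argument. A `RegularityScale` is a family of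
function spaces with increasing index in which composition with a displacement along `Ω`, Taylor's
formula along `Ω`, the implicit function theorem along `Ω` and the cohomology equation hold, each with
a fixed loss of index, and `RegularityScale.hasResonantNormalForm` is the theorem for such a scale.
There are two instances: spaces of `C^k` functions (`regularityScale_ck`), and spaces of analytic
functions on strips of decreasing width (`regularityScale_analytic`). The spaces are defined in the
coordinates given by `A`, in which the translation by `α₀ Ω` is by `(ω, 0)` modulo integer vectors.

For the cohomology equation the Fourier series is summed over the slow wave number first. The
resulting modes `fastMode g k` are functions on the torus that depend on the fast variables through
`e^{2πi k·x₁}` only, so they decay like `‖k‖^{-c}` if `g` has `c` more derivatives. The sum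
`∑ ‖k‖^{-c} / |e^{2πi k·ω} - 1|` converges for all `c > τ` (`IsDiophantine.summable_inv`), because
different small divisors are also far from each other. Hence a loss of `⌊τ⌋ + 1` derivatives is enough,
which is what makes the hypothesis `q ≥ (n + m - 1) (d + τ)` suffice.

In the analytic case, derivatives and Taylor remainders along `Ω` are Cauchy integrals in the complex
direction `Ω`, the implicit function is a limit of holomorphic iterates, and the modes extend
holomorphically. Their decay on a smaller strip follows from the case of `C^k` functions, applied to
the restrictions of the extended function to translates of the real subspace.
-/

namespace FPTM

/-! ### Scales of regularity and expansions in the small parameter -/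

/-- A function that is allowed to be displaced along `Ω` by an unknown amount. For `d ≥ 2` every
function is; for `d = 1` (where the cohomology equation is void) only the zero function is, so that
no derivative is ever lost. -/
def IsDisplaceable {e : ℕ} (f : (Fin (e + 1) → ℝ) → ℝ) : Prop := e = 0 → f = 0

/-- What the averaging procedure needs to know about a scale of function spaces on the torus:
`X t C f` says that `f` is in the space with index `t` (larger `t` means more regular), with norm at
most `C`. A derivative along `Ω` costs one index, the solution of the cohomology equation costs `c`
indices. The spaces with index `0` embed in the class `K`. -/
structure RegularityScale {e : ℕ} (A : Matrix.SpecialLinearGroup (Fin (e + 1)) ℤ) (ω : Fin e → ℝ)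
    (Ω : Fin (e + 1) → ℝ) (α₀ : ℝ) (c : ℕ) (K : FunctionClass)
    (X : ℕ → ℝ → ((Fin (e + 1) → ℝ) → ℝ) → Prop) : Prop where
  mono : ∀ {t t' C C' f}, X t C f → t' ≤ t → C ≤ C' → X t' C' f
  const : ∀ t a, X t |a| (fun _ => a)
  add : ∀ {t C C' f g}, X t C f → X t C' g → X t (C + C') (fun x => f x + g x)
  mul : ∀ t, ∃ B : ℝ, ∀ {C C' f g}, X t C f → X t C' g → X t (B * C * C') (fun x => f x * g x)
  translate : ∀ {t C f} (a : Fin (e + 1) → ℝ), X t C f → X t C (fun x => f (x + a))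
  fderiv_le : ∃ B : ℝ, ∀ {C f}, X 0 C f → Differentiable ℝ f ∧ ∀ x, ‖fderiv ℝ f x‖ ≤ B * C
  bound : ∀ {C f}, X 0 C f → ∀ x, |f x| ≤ C
  /-- Displacement along `Ω`. -/
  comp : ∀ C C', ∃ C'', ∀ᶠ ε in 𝓝 (0 : ℝ), ∀ f v, X 1 C f → X 0 C' v →
    (IsDisplaceable f ∨ IsDisplaceable v) → X 0 C'' (fun x => f (x + (ε * v x) • Ω))
  /-- Taylor expansion of a displacement along `Ω`. -/
  taylor : ∀ {r L C f}, X r C f → 1 ≤ L → L ≤ r → ∃ d : ℕ → (Fin (e + 1) → ℝ) → ℝ, d 0 = f ∧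
    (∀ l < L, ∃ C', X (r - l) C' (d l)) ∧
    ∀ C₂, ∃ C₃, ∀ᶠ ε in 𝓝 (0 : ℝ), ∀ v, X 0 C₂ v → (IsDisplaceable f ∨ IsDisplaceable v) →
      ∃ w, X 0 C₃ w ∧ ∀ x, f (x + (ε * v x) • Ω) =
        ∑ l ∈ Finset.range L, (ε * v x) ^ l * d l x + (ε * v x) ^ L * w x
  /-- Implicit function theorem along `Ω`. -/
  implicit : ∀ C C', ∃ C'', ∀ᶠ ε in 𝓝 (0 : ℝ), ∀ a b, X 0 C a → X 1 C' b → IsDisplaceable b →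
    ∃ w, X 0 C'' w ∧ ∀ x, w x = a x + b (x + (ε * w x) • Ω)
  cohomology : ∀ {t C P}, X (t + 1 + c) C P → ∃ C', X (t + 1) C' (cohomologySolution A ω P)
  cohomology_eq : ∀ {C P}, X (1 + c) C P → ∀ x,
    cohomologySolution A ω P (x + α₀ • Ω) - cohomologySolution A ω P x =
      P x - resonantPart A P (act A x (Fin.last e))
  resonant : ∀ {t C P}, X t C P →
    ∃ C', X t C' (fun x => resonantPart A P (act A x (Fin.last e)))
  class_mono : ∀ {d C C' f}, K d C f → C ≤ C' → K d C' f
  toClass : ∃ B : ℝ, ∀ {C f}, X 0 C f → K (e + 1) (B * C) f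
  toClass_act : ∃ B : ℝ, ∀ {C f}, X 0 C f → K (e + 1) (B * C) (fun x => f (act A⁻¹ x))
  toClass_circle : ∃ B : ℝ, ∀ {C f}, X 0 C f →
    K 1 (B * C) (fun y => f (act A⁻¹ (Fin.snoc (0 : Fin e → ℝ) (y 0))))

/-- The family `w ε` has an expansion `∑_{i < M} ε^i w_i + ε^M R_ε` near `ε = 0`, `ε ∈ I`, with
`w_i` in the space of index `(M - i) * κ`, and with remainders `R_ε` bounded in the space of
index `0`. -/
def Expands {E : Type*} (X : ℕ → ℝ → (E → ℝ) → Prop) (κ : ℕ) (I : Set ℝ) :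
    ℕ → (ℝ → E → ℝ) → Prop
  | 0, w => ∃ C, ∀ᶠ ε in 𝓝[I] (0 : ℝ), X 0 C (w ε)
  | M + 1, w => ∃ C w₀ ψ, X ((M + 1) * κ) C w₀ ∧ Expands X κ I M ψ ∧
      ∀ᶠ ε in 𝓝[I] (0 : ℝ), ∀ x, w ε x = w₀ x + ε * ψ ε x

namespace Expands

section

variable {e : ℕ} {A : Matrix.SpecialLinearGroup (Fin (e + 1)) ℤ} {ω : Fin e → ℝ}
  {Ω : Fin (e + 1) → ℝ} {α₀ : ℝ} {c : ℕ} {K : FunctionClass}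
  {X : ℕ → ℝ → ((Fin (e + 1) → ℝ) → ℝ) → Prop} {κ : ℕ} {I : Set ℝ}

theorem congr {M : ℕ} {w w' : ℝ → (Fin (e + 1) → ℝ) → ℝ} (h : Expands X κ I M w)
    (hw : ∀ᶠ ε in 𝓝[I] (0 : ℝ), ∀ x, w' ε x = w ε x) : Expands X κ I M w' := by
  cases M with
  | zero =>
    obtain ⟨C, hC⟩ := h
    refine ⟨C, ?_⟩
    filter_upwards [hC, hw] with ε h1 h2
    rwa [funext h2]
  | succ M =>
    obtain ⟨C, w₀, ψ, h1, h2, h3⟩ := h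
    refine ⟨C, w₀, ψ, h1, h2, ?_⟩
    filter_upwards [h3, hw] with ε h4 h5 x
    rw [h5, h4]

theorem mul_eps {M : ℕ} {w : ℝ → (Fin (e + 1) → ℝ) → ℝ} (hX : RegularityScale A ω Ω α₀ c K X)
    (h : Expands X κ I M w) : Expands X κ I (M + 1) (fun ε x => ε * w ε x) :=
  ⟨_, fun _ => 0, w, hX.const _ 0, h, Eventually.of_forall fun ε x => by simp⟩

theorem zero (hX : RegularityScale A ω Ω α₀ c K X) (M : ℕ) :
    Expands X κ I M (fun _ _ => 0) := by
  induction M with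
  | zero => exact ⟨_, Eventually.of_forall fun ε => hX.const 0 0⟩
  | succ M ih => simpa using ih.mul_eps hX

theorem const {M : ℕ} (hX : RegularityScale A ω Ω α₀ c K X) {C : ℝ} {f : (Fin (e + 1) → ℝ) → ℝ}
    (h : X (M * κ) C f) : Expands X κ I M (fun _ => f) := by
  cases M with
  | zero => exact ⟨C, Eventually.of_forall fun ε => by simpa using h⟩
  | succ M => exact ⟨C, f, _, h, zero hX M, Eventually.of_forall fun ε x => by simp⟩

theorem add {M : ℕ} (hX : RegularityScale A ω Ω α₀ c K X) {w w' : ℝ → (Fin (e + 1) → ℝ) → ℝ}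
    (h : Expands X κ I M w) (h' : Expands X κ I M w') :
    Expands X κ I M (fun ε x => w ε x + w' ε x) := by
  induction M generalizing w w' with
  | zero =>
    obtain ⟨C, hC⟩ := h
    obtain ⟨C', hC'⟩ := h'
    exact ⟨C + C', by filter_upwards [hC, hC'] with ε h1 h2 using hX.add h1 h2⟩
  | succ M ih =>
    obtain ⟨C, w₀, ψ, h1, h2, h3⟩ := h
    obtain ⟨C', w₀', ψ', h1', h2', h3'⟩ := h'
    refine ⟨_, _, _, hX.add h1 h1', ih h2 h2', ?_⟩
    filter_upwards [h3, h3'] with ε h4 h5 x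
    rw [h4, h5]; ring

theorem of_succ {M : ℕ} (hX : RegularityScale A ω Ω α₀ c K X) {w : ℝ → (Fin (e + 1) → ℝ) → ℝ}
    (h : Expands X κ I (M + 1) w) : Expands X κ I M w := by
  induction M generalizing w with
  | zero =>
    obtain ⟨C, w₀, ψ, h1, ⟨C', h2⟩, h3⟩ := h
    obtain ⟨B, hB⟩ := hX.mul 0
    refine ⟨C + |B * 1 * C'|, ?_⟩
    have hε : ∀ᶠ ε in 𝓝[I] (0 : ℝ), |ε| ≤ 1 := by
      refine nhdsWithin_le_nhds ?_
      filter_upwards [Metric.ball_mem_nhds (0 : ℝ) one_pos] with ε hε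
      simpa using (mem_ball_zero_iff.1 hε).le
    filter_upwards [h2, h3, hε] with ε h4 h5 h6
    rw [funext h5]
    exact hX.add (hX.mono h1 (Nat.zero_le _) le_rfl)
      (hX.mono (hB (hX.mono (hX.const 0 ε) le_rfl h6) h4) le_rfl (le_abs_self _))
  | succ M ih =>
    obtain ⟨C, w₀, ψ, h1, h2, h3⟩ := h
    exact ⟨C, w₀, ψ, hX.mono h1 (Nat.mul_le_mul_right _ (by omega)) le_rfl, ih h2, h3⟩

theorem mono {M M' : ℕ} (hX : RegularityScale A ω Ω α₀ c K X) {w : ℝ → (Fin (e + 1) → ℝ) → ℝ}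
    (h : Expands X κ I M w) (hM : M' ≤ M) : Expands X κ I M' w := by
  induction hM with
  | refl => exact h
  | step _ ih => exact ih (h.of_succ hX)

theorem bounded {M : ℕ} (hX : RegularityScale A ω Ω α₀ c K X) {w : ℝ → (Fin (e + 1) → ℝ) → ℝ}
    (h : Expands X κ I M w) : ∃ C, ∀ᶠ ε in 𝓝[I] (0 : ℝ), X 0 C (w ε) :=
  h.mono hX (Nat.zero_le M)

theorem mul {M : ℕ} (hX : RegularityScale A ω Ω α₀ c K X) {w w' : ℝ → (Fin (e + 1) → ℝ) → ℝ}
    (h : Expands X κ I M w) (h' : Expands X κ I M w') :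
    Expands X κ I M (fun ε x => w ε x * w' ε x) := by
  induction M generalizing w w' with
  | zero =>
    obtain ⟨C, hC⟩ := h
    obtain ⟨C', hC'⟩ := h'
    obtain ⟨B, hB⟩ := hX.mul 0
    exact ⟨_, by filter_upwards [hC, hC'] with ε h1 h2 using hB h1 h2⟩
  | succ M ih =>
    obtain ⟨C, w₀, ψ, h1, h2, h3⟩ := h
    obtain ⟨C', w₀', ψ', h1', h2', h3'⟩ := h'
    obtain ⟨B, hB⟩ := hX.mul ((M + 1) * κ)
    have hw₀ : Expands X κ I M (fun _ => w₀) := (const hX h1).of_succ hX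
    have hw₀' : Expands X κ I M (fun _ => w₀') := (const hX h1').of_succ hX
    have key := ((ih hw₀ h2').add hX (ih h2 hw₀')).add hX (((ih h2 h2').mul_eps hX).of_succ hX)
    refine ⟨_, _, _, hB h1 h1', key, ?_⟩
    filter_upwards [h3, h3'] with ε h4 h5 x
    rw [h4, h5]; ring

theorem pow_succ {M : ℕ} (hX : RegularityScale A ω Ω α₀ c K X) {w : ℝ → (Fin (e + 1) → ℝ) → ℝ}
    (h : Expands X κ I M w) (l : ℕ) : Expands X κ I M (fun ε x => w ε x ^ l) := by
  induction l with
  | zero => simpa using const (I := I) hX (hX.const (M * κ) 1)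
  | succ l ih => simpa only [_root_.pow_succ] using ih.mul hX h

theorem mul_eps_pow {M : ℕ} (hX : RegularityScale A ω Ω α₀ c K X)
    {w : ℝ → (Fin (e + 1) → ℝ) → ℝ} (h : Expands X κ I M w) (l : ℕ) :
    Expands X κ I (M + l) (fun ε x => ε ^ l * w ε x) := by
  induction l with
  | zero => simpa using h
  | succ l ih =>
    refine (ih.mul_eps hX).congr (Eventually.of_forall fun ε x => ?_)
    rw [_root_.pow_succ]; ring

theorem sum {M : ℕ} (hX : RegularityScale A ω Ω α₀ c K X) {ι : Type*} (s : Finset ι)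
    {w : ι → ℝ → (Fin (e + 1) → ℝ) → ℝ} (h : ∀ i ∈ s, Expands X κ I M (w i)) :
    Expands X κ I M (fun ε x => ∑ i ∈ s, w i ε x) := by
  classical
  induction s using Finset.induction_on with
  | empty => simpa using zero hX M
  | insert a s ha ih =>
    simp only [Finset.sum_insert ha]
    exact (h a (by simp)).add hX (ih fun i hi => h i (by simp [hi]))

/-- The coefficients of an expansion. -/
theorem exists_coeff {M : ℕ} {w : ℝ → (Fin (e + 1) → ℝ) → ℝ} (h : Expands X κ I M w) :
    ∃ (a : ℕ → (Fin (e + 1) → ℝ) → ℝ) (R : ℝ → (Fin (e + 1) → ℝ) → ℝ),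
      (∀ i < M, ∃ C, X ((M - i) * κ) C (a i)) ∧
      ∃ C, ∀ᶠ ε in 𝓝[I] (0 : ℝ), X 0 C (R ε) ∧
        ∀ x, w ε x = ∑ i ∈ Finset.range M, ε ^ i * a i x + ε ^ M * R ε x := by
  induction M generalizing w with
  | zero =>
    obtain ⟨C, hC⟩ := h
    exact ⟨fun _ _ => 0, w, by simp, C, by filter_upwards [hC] with ε hε using ⟨hε, by simp⟩⟩
  | succ M ih =>
    obtain ⟨C, w₀, ψ, h1, h2, h3⟩ := h
    obtain ⟨a, R, ha, C', hR⟩ := ih h2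
    refine ⟨fun i => Nat.casesOn i w₀ a, R, ?_, C', ?_⟩
    · rintro (_ | i) hi
      · exact ⟨C, by simpa using h1⟩
      · obtain ⟨C'', hC''⟩ := ha i (by omega)
        exact ⟨C'', by simpa using hC''⟩
    · filter_upwards [h3, hR] with ε h4 h5
      refine ⟨h5.1, fun x => ?_⟩
      rw [h4, h5.2, Finset.sum_range_succ', mul_add, Finset.mul_sum]
      simp only [_root_.pow_succ, pow_zero, one_mul]
      rw [add_comm, add_right_comm]
      congr 1
      · congr 1
        exact Finset.sum_congr rfl fun i _ => by ring
      · ring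

/-- The increment of a function displaced by `ε w_ε` along `Ω`. -/
theorem displacement (hX : RegularityScale A ω Ω α₀ c K X) (hκ : 1 ≤ κ) {a M : ℕ} {C : ℝ}
    {f : (Fin (e + 1) → ℝ) → ℝ} {w : ℝ → (Fin (e + 1) → ℝ) → ℝ} (hf : X (a * κ + 1) C f)
    (hw : Expands X κ I M w)
    (hfw : IsDisplaceable f ∨ ∀ᶠ ε in 𝓝[I] (0 : ℝ), IsDisplaceable (w ε)) :
    Expands X κ I (min M a + 1) (fun ε x => f (x + (ε * w ε x) • Ω) - f x) := by
  have ha : a + 1 ≤ a * κ + 1 := by nlinarith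
  obtain ⟨d, hd0, hd, hrem⟩ := hX.taylor hf (Nat.le_add_left 1 a) ha
  obtain ⟨Cw, hCw⟩ := hw.bounded hX
  obtain ⟨C₃, hC₃⟩ := hrem Cw
  have hev : ∀ᶠ ε in 𝓝[I] (0 : ℝ), ∃ q, X 0 C₃ q ∧ ∀ x, f (x + (ε * w ε x) • Ω) =
      ∑ l ∈ Finset.range (a + 1), (ε * w ε x) ^ l * d l x + (ε * w ε x) ^ (a + 1) * q x := by
    have hfw' : ∀ᶠ ε in 𝓝[I] (0 : ℝ), IsDisplaceable f ∨ IsDisplaceable (w ε) := by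
      rcases hfw with h | h
      · exact Eventually.of_forall fun _ => Or.inl h
      · exact h.mono fun _ => Or.inr
    filter_upwards [hCw, nhdsWithin_le_nhds hC₃, hfw'] with ε h1 h2 h3 using h2 _ h1 h3
  obtain ⟨q, hq⟩ : ∃ q : ℝ → (Fin (e + 1) → ℝ) → ℝ, ∀ᶠ ε in 𝓝[I] (0 : ℝ), X 0 C₃ (q ε) ∧
      ∀ x, f (x + (ε * w ε x) • Ω) =
        ∑ l ∈ Finset.range (a + 1), (ε * w ε x) ^ l * d l x + (ε * w ε x) ^ (a + 1) * q ε x := by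
    classical
    refine ⟨fun ε => if h : _ then Classical.choose (p := fun q => X 0 C₃ q ∧
      ∀ x, f (x + (ε * w ε x) • Ω) = ∑ l ∈ Finset.range (a + 1), (ε * w ε x) ^ l * d l x +
        (ε * w ε x) ^ (a + 1) * q x) h else 0, ?_⟩
    filter_upwards [hev] with ε h
    rw [dif_pos h]
    exact Classical.choose_spec h
  have hq0 : Expands X κ I 0 q := ⟨C₃, hq.mono fun ε h => h.1⟩
  have h1 : Expands X κ I (min M a + 1)
      (fun ε x => ε ^ (a + 1) * (w ε x ^ (a + 1) * q ε x)) :=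
    ((((hw.pow_succ hX (a + 1)).mono hX (Nat.zero_le _)).mul hX hq0).mul_eps_pow hX (a + 1)).mono
      hX (by omega)
  have h2 : Expands X κ I (min M a + 1)
      (fun ε x => ∑ l ∈ Finset.range a, ε ^ (l + 1) * (w ε x ^ (l + 1) * d (l + 1) x)) := by
    refine sum hX _ fun l hl => ?_
    have hl := Finset.mem_range.1 hl
    obtain ⟨C', hC'⟩ := hd (l + 1) (by omega)
    have hdl : Expands X κ I (a - l) (fun _ => d (l + 1)) := by
      refine const hX (hX.mono hC' ?_ le_rfl)
      obtain ⟨b, rfl⟩ := Nat.exists_eq_add_of_le hl.le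
      have : l ≤ l * κ := by nlinarith
      have : (l + b) * κ = l * κ + b * κ := by ring
      have : l + b - l = b := by omega
      rw [this]
      omega
    have h3 := (((hw.pow_succ hX (l + 1)).mono hX (Nat.min_le_left M (a - l))).mul hX
      (hdl.mono hX (Nat.min_le_right M (a - l)))).mul_eps_pow hX (l + 1)
    exact h3.mono hX (by omega)
  refine (h2.add hX h1).congr ?_
  filter_upwards [hq] with ε hε x
  rw [hε.2, Finset.sum_range_succ', hd0]
  simp only [mul_pow, pow_zero, one_mul, mul_assoc]
  ring

end

end Expands

/-! ### Conjugation by a change of variables along the leaves -/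

section LeafMap

variable {d : ℕ} {Ω : Fin d → ℝ}

/-- A displacement along `Ω` with Lipschitz constant at most `1 / 2` on each leaf is injective; a
solution `k` of `k y = -v (y + ε k(y) Ω)` provides the inverse `y ↦ y + ε k(y) Ω`. -/
theorem leafMap_bijective {ε : ℝ} {v k : (Fin d → ℝ) → ℝ}
    (hv : ∀ x s s', |ε * v (x + s • Ω) - ε * v (x + s' • Ω)| ≤ 1 / 2 * |s - s'|)
    (hk : ∀ y, k y = -v (y + (ε * k y) • Ω)) :
    Function.Bijective (leafMap Ω fun x => ε * v x) ∧
      ∀ y, Function.invFun (leafMap Ω fun x => ε * v x) y = y + (ε * k y) • Ω := by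
  have hinj : Function.Injective (leafMap Ω fun x => ε * v x) := by
    intro x x' h
    simp only [leafMap] at h
    have hx : x = x' + (ε * v x' - ε * v x) • Ω := by
      rw [sub_smul, ← add_sub_assoc, ← h, add_sub_cancel_right]
    set s := ε * v x' - ε * v x with hs
    have h1 := hv x' 0 s
    rw [← hx, zero_smul, add_zero, ← hs, zero_sub, abs_neg] at h1
    have h2 : s = 0 := abs_nonpos_iff.1 (by linarith)
    rw [hx, h2]; simp
  have hright : ∀ y, leafMap Ω (fun x => ε * v x) (y + (ε * k y) • Ω) = y := by
    intro y
    simp only [leafMap]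
    have h1 : v (y + (ε * k y) • Ω) = -k y := by rw [hk y, neg_neg, ← hk y]
    rw [h1, add_assoc, ← add_smul]
    simp
  refine ⟨⟨hinj, fun y => ⟨_, hright y⟩⟩, fun y => hinj ?_⟩
  rw [hright]
  exact Function.invFun_eq ⟨_, hright y⟩

/-- The conjugated map, from the equation for its displacement. -/
theorem invFun_leafMap_fptm {ε α : ℝ} {v k w : (Fin d → ℝ) → ℝ} {f : ℝ → (Fin d → ℝ) → ℝ}
    (hv : ∀ x s s', |ε * v (x + s • Ω) - ε * v (x + s' • Ω)| ≤ 1 / 2 * |s - s'|)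
    (hk : ∀ y, k y = -v (y + (ε * k y) • Ω)) (x : Fin d → ℝ)
    (hw : ε * w x = ε * v x + ε * f ε (x + (ε * v x) • Ω)
      - ε * v (x + α • Ω + (ε * w x) • Ω)) :
    Function.invFun (leafMap Ω fun x => ε * v x) (fptm Ω f α ε (leafMap Ω (fun x => ε * v x) x)) =
      x + α • Ω + (ε * w x) • Ω := by
  obtain ⟨hb, -⟩ := leafMap_bijective hv hk
  have h : fptm Ω f α ε (leafMap Ω (fun x => ε * v x) x) =
      leafMap Ω (fun x => ε * v x) (x + α • Ω + (ε * w x) • Ω) := by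
    simp only [fptm, leafMap]
    have h1 : ε * f ε (x + (ε * v x) • Ω) =
      ε * w x - ε * v x + ε * v (x + α • Ω + (ε * w x) • Ω) := by linarith
    rw [h1]
    module
  rw [h]
  exact Function.leftInverse_invFun hb.1 _

theorem along_smul (hΩ : Ω ≠ 0) (c : ℝ) : along Ω (c • Ω) = c := by
  have : Ω ⬝ᵥ Ω ≠ 0 := fun h => hΩ (dotProduct_self_eq_zero.1 h)
  rw [along, dotProduct_smul, smul_eq_mul, mul_div_cancel_right₀ _ this]

end LeafMap

theorem eventually_abs_mul_le {I : Set ℝ} (B : ℝ) {η : ℝ} (hη : 0 < η) :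
    ∀ᶠ ε in 𝓝[I] (0 : ℝ), |ε| * B ≤ η := by
  refine nhdsWithin_le_nhds ?_
  have h : Tendsto (fun ε : ℝ => |ε| * B) (𝓝 0) (𝓝 (|0| * B)) :=
    (continuous_abs.mul continuous_const).tendsto 0
  rw [abs_zero, zero_mul] at h
  exact h.eventually_le_const hη

/-- Uniqueness of the coefficients of an expansion in powers of `ε`. -/
theorem coeff_eq_zero_of_isBigO {l : Filter ℝ} [l.NeBot] (hl : l ≤ 𝓝[≠] 0) {M : ℕ} {b : ℕ → ℝ}
    (h : (fun ε : ℝ => ∑ i ∈ Finset.range M, ε ^ i * b i) =O[l] fun ε => ε ^ M) :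
    ∀ i < M, b i = 0 := by
  have hl0 : l ≤ 𝓝 0 := hl.trans nhdsWithin_le_nhds
  induction M generalizing b with
  | zero => simp
  | succ M ih =>
    have hε : Tendsto (fun ε : ℝ => ε) l (𝓝 0) := hl0
    have h0 : b 0 = 0 := by
      have h1 : Tendsto (fun ε : ℝ => ∑ i ∈ Finset.range (M + 1), ε ^ i * b i) l (𝓝 (b 0)) := by
        have : Tendsto (fun ε : ℝ => ∑ i ∈ Finset.range (M + 1), ε ^ i * b i) (𝓝 0)
            (𝓝 (∑ i ∈ Finset.range (M + 1), (0 : ℝ) ^ i * b i)) := by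
          refine Continuous.tendsto ?_ 0
          fun_prop
        rw [Finset.sum_range_succ'] at this
        simpa using this.mono_left hl0
      refine tendsto_nhds_unique h1 (h.trans_tendsto ?_)
      simpa using hε.pow (M + 1)
    have hne : ∀ᶠ ε in l, ε ≠ 0 := hl self_mem_nhdsWithin
    have h2 : (fun ε : ℝ => ∑ i ∈ Finset.range M, ε ^ i * b (i + 1)) =O[l] fun ε => ε ^ M := by
      obtain ⟨C, hC⟩ := h.bound
      refine Asymptotics.IsBigO.of_bound C ?_
      filter_upwards [hC, hne] with ε h3 h4
      have h5 : ∑ i ∈ Finset.range (M + 1), ε ^ i * b i =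
          ε * ∑ i ∈ Finset.range M, ε ^ i * b (i + 1) := by
        rw [Finset.sum_range_succ', h0, Finset.mul_sum]
        simp only [mul_zero, add_zero]
        exact Finset.sum_congr rfl fun i _ => by ring
      rw [h5, pow_succ', norm_mul, norm_mul, mul_left_comm] at h3
      exact le_of_mul_le_mul_left h3 (norm_pos_iff.2 h4)
    rintro (_ | i) hi
    · exact h0
    · exact ih h2 i (by omega)

section

variable {e : ℕ} {A : Matrix.SpecialLinearGroup (Fin (e + 1)) ℤ} {ω : Fin e → ℝ}
  {Ω : Fin (e + 1) → ℝ} {α₀ : ℝ} {c : ℕ} {K : FunctionClass}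
  {X : ℕ → ℝ → ((Fin (e + 1) → ℝ) → ℝ) → Prop} {κ : ℕ} {I : Set ℝ}

/-- Functions of the scale are Lipschitz along the leaves, with a constant that depends only on the
bound. -/
theorem RegularityScale.exists_lipschitz (hX : RegularityScale A ω Ω α₀ c K X) (C : ℝ) :
    ∃ B : ℝ, 0 ≤ B ∧ ∀ {f}, X 0 C f → ∀ x s s',
      |f (x + s • Ω) - f (x + s' • Ω)| ≤ B * |s - s'| := by
  obtain ⟨B, hB⟩ := hX.fderiv_le
  refine ⟨|B * C| * ‖Ω‖, by positivity, fun {f} hf x s s' => ?_⟩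
  obtain ⟨h1, h2⟩ := hB hf
  have h3 := Convex.norm_image_sub_le_of_norm_fderiv_le (𝕜 := ℝ) (s := Set.univ) (f := f)
    (x := x + s' • Ω) (y := x + s • Ω) (fun y _ => h1 y)
    (fun y _ => (h2 y).trans (le_abs_self _)) convex_univ (Set.mem_univ _) (Set.mem_univ _)
  rw [Real.norm_eq_abs] at h3
  refine h3.trans (le_of_eq ?_)
  rw [add_sub_add_left_eq_sub, ← sub_smul, norm_smul, Real.norm_eq_abs]
  ring

theorem RegularityScale.zero (hX : RegularityScale A ω Ω α₀ c K X) (t : ℕ) :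
    X t 0 (fun _ => 0) := by simpa using hX.const t 0

theorem RegularityScale.neg (hX : RegularityScale A ω Ω α₀ c K X) {t : ℕ} {C : ℝ}
    {f : (Fin (e + 1) → ℝ) → ℝ} (hf : X t C f) : ∃ C', X t C' (fun x => -f x) := by
  obtain ⟨B, hB⟩ := hX.mul t
  exact ⟨_, by simpa using hB (hX.const t (-1)) hf⟩

theorem RegularityScale.bounded_polynomial (hX : RegularityScale A ω Ω α₀ c K X) {t : ℕ}
    (s : Finset ℕ) {h : ℕ → (Fin (e + 1) → ℝ) → ℝ} (hh : ∀ i ∈ s, ∃ C, X t C (h i)) :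
    ∃ C, ∀ᶠ ε in 𝓝[I] (0 : ℝ), X t C (fun x => ∑ i ∈ s, ε ^ i * h i x) := by
  classical
  induction s using Finset.induction_on with
  | empty => exact ⟨0, Eventually.of_forall fun ε => by simpa using hX.zero t⟩
  | insert a s ha ih =>
    obtain ⟨C, hC⟩ := ih fun i hi => hh i (by simp [hi])
    obtain ⟨C', hC'⟩ := hh a (by simp)
    obtain ⟨B, hB⟩ := hX.mul t
    refine ⟨B * 1 * C' + C, ?_⟩
    filter_upwards [hC, eventually_abs_mul_le (I := I) 1 one_pos] with ε h1 h2
    simp only [Finset.sum_insert ha]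
    refine hX.add (hB (hX.mono (hX.const t (ε ^ a)) le_rfl ?_) hC') h1
    rw [abs_pow]
    exact pow_le_one₀ (abs_nonneg _) (by simpa using h2)

/-- The displacement `ε w_ε` of the conjugated map solves an implicit equation, with `ε v_ε` the
displacement of the change of variables and `ε γ_ε` that of the original map. Its right side gains
one order in `ε` over `w`, so that the expansion of `w` is found order by order. The loss of
regularity in the leading term `v - v ∘ T` is avoided by the cohomology equation, `hcoh`. -/
theorem exists_conjugated_expansion (hX : RegularityScale A ω Ω α₀ c K X) (hκ : 1 ≤ κ) {N : ℕ}
    (hN : 1 ≤ N) {h : ℕ → (Fin (e + 1) → ℝ) → ℝ}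
    (hh : ∀ i < N, ∃ C, X ((N - 1 - i) * κ + 1) C (h i)) (hhd : ∀ i < N, IsDisplaceable (h i))
    (hcoh : ∀ i < N, ∃ C, X ((N - i) * κ) C (fun x => h i x - h i (x + α₀ • Ω)))
    {γ ψ : ℝ → (Fin (e + 1) → ℝ) → ℝ} {γ₀ : ℕ → (Fin (e + 1) → ℝ) → ℝ}
    (hγ₀ : ∀ i < N, ∃ C, X (N * κ) C (γ₀ i))
    (hψ : ∃ C, ∀ᶠ ε in 𝓝[I] (0 : ℝ), X (N * κ) C (ψ ε))
    (hγ : ∀ᶠ ε in 𝓝[I] (0 : ℝ), ∀ x,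
      γ ε x = ∑ i ∈ Finset.range N, ε ^ i * γ₀ i x + ε ^ N * ψ ε x)
    {v : ℝ → (Fin (e + 1) → ℝ) → ℝ} (hv : ∀ ε x, v ε x = ∑ i ∈ Finset.range N, ε ^ i * h i x) :
    ∃ w : ℝ → (Fin (e + 1) → ℝ) → ℝ, Expands X κ I N w ∧ ∀ᶠ ε in 𝓝[I] (0 : ℝ), ∀ x,
      w ε x = v ε x + γ ε (x + (ε * v ε x) • Ω) - v ε (x + α₀ • Ω + (ε * w ε x) • Ω) := by
  obtain rfl : v = fun ε x => ∑ i ∈ Finset.range N, ε ^ i * h i x := by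
    funext ε x; exact hv ε x
  set v : ℝ → (Fin (e + 1) → ℝ) → ℝ := fun ε x => ∑ i ∈ Finset.range N, ε ^ i * h i x with hvdef
  have hNκ : (N - 1) * κ + 1 ≤ N * κ := by
    obtain ⟨b, rfl⟩ := Nat.exists_eq_add_of_le' hN
    simp only [Nat.add_sub_cancel]
    have : (b + 1) * κ = b * κ + κ := by ring
    omega
  have hvE : Expands X κ I (N - 1) v := by
    refine Expands.sum hX _ fun i hi => ?_
    have hi := Finset.mem_range.1 hi
    obtain ⟨C, hC⟩ := hh i hi
    exact ((Expands.const hX (hX.mono hC (Nat.le_succ _) le_rfl)).mul_eps_pow hX i).mono hX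
      (by omega)
  have hvd : ∀ ε, IsDisplaceable (v ε) := by
    intro ε he
    funext x
    exact Finset.sum_eq_zero fun i hi => by simp [hhd i (Finset.mem_range.1 hi) he]
  have hγE : Expands X κ I N (fun ε x => γ ε (x + (ε * v ε x) • Ω)) := by
    have h1 : Expands X κ I N
        (fun ε x => ∑ i ∈ Finset.range N, ε ^ i * γ₀ i (x + (ε * v ε x) • Ω)) := by
      refine Expands.sum hX _ fun i hi => ?_
      obtain ⟨C, hC⟩ := hγ₀ i (Finset.mem_range.1 hi)
      have h2 := Expands.displacement hX hκ (hX.mono hC hNκ le_rfl) hvE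
        (Or.inr (Eventually.of_forall hvd))
      rw [min_self, Nat.sub_add_cancel hN] at h2
      have h3 := h2.add hX (Expands.const hX hC)
      simp only [sub_add_cancel] at h3
      exact (h3.mul_eps_pow hX i).mono hX (Nat.le_add_right _ _)
    have h2 : Expands X κ I N (fun ε x => ε ^ N * ψ ε (x + (ε * v ε x) • Ω)) := by
      obtain ⟨Cψ, hCψ⟩ := hψ
      obtain ⟨Cv, hCv⟩ := hvE.bounded hX
      obtain ⟨C', hC'⟩ := hX.comp Cψ Cv
      have h3 : Expands X κ I 0 (fun ε x => ψ ε (x + (ε * v ε x) • Ω)) := by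
        refine ⟨C', ?_⟩
        filter_upwards [hCψ, hCv, nhdsWithin_le_nhds hC'] with ε h4 h5 h6
        exact h6 _ _ (hX.mono h4 (by omega) le_rfl) h5 (Or.inr (hvd ε))
      simpa using h3.mul_eps_pow hX N
    refine (h1.add hX h2).congr ?_
    filter_upwards [hγ] with ε hε x using hε _
  -- existence of a bounded solution
  obtain ⟨w, hw⟩ : ∃ w : ℝ → (Fin (e + 1) → ℝ) → ℝ, ∃ C, ∀ᶠ ε in 𝓝[I] (0 : ℝ), X 0 C (w ε) ∧
      ∀ x, w ε x = v ε x + γ ε (x + (ε * v ε x) • Ω)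
        - v ε (x + α₀ • Ω + (ε * w ε x) • Ω) := by
    obtain ⟨Cv, hCv⟩ := hvE.bounded hX
    obtain ⟨Cγ, hCγ⟩ := hγE.bounded hX
    obtain ⟨C₁, hC₁⟩ : ∃ C, ∀ᶠ ε in 𝓝[I] (0 : ℝ), X 1 C (v ε) :=
      hX.bounded_polynomial _ fun i hi => by
        obtain ⟨C, hC⟩ := hh i (Finset.mem_range.1 hi)
        exact ⟨C, hX.mono hC (by omega) le_rfl⟩
    obtain ⟨B, hB⟩ := hX.mul 1
    obtain ⟨C₂, hC₂⟩ := hX.implicit (Cv + Cγ) (B * |(-1 : ℝ)| * C₁)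
    have hev : ∀ᶠ ε in 𝓝[I] (0 : ℝ), ∃ q, X 0 C₂ q ∧
      ∀ x, q x = v ε x + γ ε (x + (ε * v ε x) • Ω) - v ε (x + α₀ • Ω + (ε * q x) • Ω) := by
      filter_upwards [hCv, hCγ, hC₁, nhdsWithin_le_nhds hC₂] with ε h1 h2 h3 h4
      obtain ⟨q, hq, hq'⟩ := h4 _ (fun x => -1 * v ε (x + α₀ • Ω)) (hX.add h1 h2)
        (hB (hX.const 1 (-1)) (hX.translate (α₀ • Ω) h3))
        (fun he => by funext x; simp [hvd ε he])
      refine ⟨q, hq, fun x => ?_⟩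
      have h5 := hq' x
      rw [add_right_comm x] at h5
      linarith
    classical
    refine ⟨fun ε => if h : _ then Classical.choose (p := fun q => X 0 C₂ q ∧
      ∀ x, q x = v ε x + γ ε (x + (ε * v ε x) • Ω) - v ε (x + α₀ • Ω + (ε * q x) • Ω)) h else 0,
      C₂, ?_⟩
    filter_upwards [hev] with ε h
    rw [dif_pos h]
    exact Classical.choose_spec h
  obtain ⟨C, hw⟩ := hw
  refine ⟨w, ?_, hw.mono fun ε h => h.2⟩
  suffices H : ∀ M ≤ N, Expands X κ I M w from H N le_rfl
  intro M
  induction M with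
  | zero => exact fun _ => ⟨C, hw.mono fun ε h => h.1⟩
  | succ M ih =>
    intro hM
    have hwM := ih (by omega)
    have h1 : Expands X κ I N
        (fun ε x => ∑ i ∈ Finset.range N, ε ^ i * (h i x - h i (x + α₀ • Ω))) := by
      refine Expands.sum hX _ fun i hi => ?_
      have hi := Finset.mem_range.1 hi
      obtain ⟨C, hC⟩ := hcoh i hi
      exact ((Expands.const hX hC).mul_eps_pow hX i).mono hX (by omega)
    have h2 : Expands X κ I (M + 1) (fun ε x => ∑ i ∈ Finset.range N, ε ^ i *
        (-1 * (h i (x + (ε * w ε x) • Ω + α₀ • Ω) - h i (x + α₀ • Ω)))) := by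
      refine Expands.sum hX _ fun i hi => ?_
      have hi := Finset.mem_range.1 hi
      obtain ⟨C, hC⟩ := hh i hi
      have h3 := Expands.displacement hX hκ (hX.translate (α₀ • Ω) hC) hwM
        (Or.inl fun he => by funext x; simp [hhd i hi he])
      exact ((((Expands.const hX (hX.const _ (-1))).mul hX h3).mul_eps_pow hX i).mono hX
        (by omega))
    refine (((h1.mono hX hM).add hX (hγE.mono hX hM)).add hX h2).congr ?_
    filter_upwards [hw] with ε hε x
    have h4 : ∀ y, v ε y = ∑ i ∈ Finset.range N, ε ^ i * h i y := fun y => rfl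
    have h3 := hε.2 x
    rw [add_right_comm x] at h3
    simp only [mul_sub, Finset.sum_sub_distrib, neg_mul, one_mul, mul_neg, Finset.sum_neg_distrib,
      ← h4]
    linarith

/-- The change of variables is invertible, and its inverse is close to the identity. -/
theorem exists_inverse (hX : RegularityScale A ω Ω α₀ c K X)
    {v : ℝ → (Fin (e + 1) → ℝ) → ℝ} (hv : ∃ C, ∀ᶠ ε in 𝓝[I] (0 : ℝ), X 1 C (v ε))
    (hvd : ∀ ε, IsDisplaceable (v ε)) :
    ∃ k : ℝ → (Fin (e + 1) → ℝ) → ℝ, ∃ C, ∀ᶠ ε in 𝓝[I] (0 : ℝ), X 0 C (k ε) ∧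
      (∀ x s s', |ε * v ε (x + s • Ω) - ε * v ε (x + s' • Ω)| ≤ 1 / 2 * |s - s'|) ∧
      ∀ y, k ε y = -v ε (y + (ε * k ε y) • Ω) := by
  obtain ⟨C₁, hC₁⟩ := hv
  obtain ⟨B, hB⟩ := hX.mul 1
  obtain ⟨C₂, hC₂⟩ := hX.implicit 0 (B * |(-1 : ℝ)| * C₁)
  obtain ⟨L, hL0, hL⟩ := hX.exists_lipschitz C₁
  have hev : ∀ᶠ ε in 𝓝[I] (0 : ℝ), ∃ q, X 0 C₂ q ∧
      (∀ x s s', |ε * v ε (x + s • Ω) - ε * v ε (x + s' • Ω)| ≤ 1 / 2 * |s - s'|) ∧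
      ∀ y, q y = -v ε (y + (ε * q y) • Ω) := by
    filter_upwards [hC₁, nhdsWithin_le_nhds hC₂,
      eventually_abs_mul_le (I := I) L (by norm_num : (0 : ℝ) < 1 / 2)] with ε h3 h4 h5
    obtain ⟨q, hq, hq'⟩ := h4 _ (fun x => -1 * v ε x) (hX.zero 0)
      (hB (hX.const 1 (-1)) h3) (fun he => by funext x; simp [hvd ε he])
    refine ⟨q, hq, fun x s s' => ?_, fun x => ?_⟩
    · rw [← mul_sub, abs_mul]
      calc |ε| * |v ε (x + s • Ω) - v ε (x + s' • Ω)| ≤ |ε| * (L * |s - s'|) := by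
            gcongr; exact hL (hX.mono h3 (Nat.zero_le _) le_rfl) x s s'
        _ = |ε| * L * |s - s'| := by ring
        _ ≤ _ := by gcongr
    · have h6 := hq' x
      linarith
  classical
  refine ⟨fun ε => if h : _ then Classical.choose (p := fun q => X 0 C₂ q ∧
      (∀ x s s', |ε * v ε (x + s • Ω) - ε * v ε (x + s' • Ω)| ≤ 1 / 2 * |s - s'|) ∧
      ∀ y, q y = -v ε (y + (ε * q y) • Ω)) h else 0, C₂, ?_⟩
  filter_upwards [hev] with ε h
  rw [dif_pos h]
  exact Classical.choose_spec h

end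

/-! ### The averaging procedure -/

theorem pow_isBigO_pow {l : Filter ℝ} (hl : l ≤ 𝓝 0) {i j : ℕ} (h : j ≤ i) :
    (fun ε : ℝ => ε ^ i) =O[l] fun ε => ε ^ j := by
  refine Asymptotics.IsBigO.of_bound (1 : ℝ) ?_
  filter_upwards [hl (Metric.ball_mem_nhds (0 : ℝ) one_pos)] with ε hε
  rw [one_mul, norm_pow, norm_pow]
  exact pow_le_pow_of_le_one (norm_nonneg _) (mem_ball_zero_iff.1 hε).le h

/-- An expansion of order `N` with bounded remainder is also one of every lower order. -/
theorem truncation_isBigO {l : Filter ℝ} (hl : l ≤ 𝓝 0) {N j : ℕ} (hj : j ≤ N) {w R : ℝ → ℝ}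
    {a : ℕ → ℝ} {C : ℝ} (hR : ∀ᶠ ε in l, |R ε| ≤ C)
    (hw : ∀ᶠ ε in l, w ε = ∑ i ∈ Finset.range N, ε ^ i * a i + ε ^ N * R ε) :
    (fun ε => w ε - ∑ i ∈ Finset.range j, ε ^ i * a i) =O[l] fun ε => ε ^ j := by
  have h1 : (fun ε => ∑ i ∈ Finset.Ico j N, ε ^ i * a i) =O[l] fun ε : ℝ => ε ^ j := by
    refine Asymptotics.IsBigO.fun_sum fun i hi => ?_
    have := (pow_isBigO_pow hl (Finset.mem_Ico.1 hi).1).const_mul_left (a i)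
    simpa only [mul_comm] using this
  have h2 : (fun ε => ε ^ N * R ε) =O[l] fun ε : ℝ => ε ^ j := by
    have h3 : R =O[l] fun _ => (1 : ℝ) := Asymptotics.IsBigO.of_bound C (by simpa using hR)
    simpa using (pow_isBigO_pow hl hj).mul h3
  refine (h1.add h2).congr' ?_ (EventuallyEq.refl _ _)
  filter_upwards [hw] with ε hε
  rw [hε, ← Finset.sum_range_add_sum_Ico _ hj]
  ring

section

variable {e : ℕ} {A : Matrix.SpecialLinearGroup (Fin (e + 1)) ℤ} {ω : Fin e → ℝ}
  {Ω : Fin (e + 1) → ℝ} {α₀ : ℝ} {c : ℕ} {K : FunctionClass}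
  {X : ℕ → ℝ → ((Fin (e + 1) → ℝ) → ℝ) → Prop} {κ : ℕ} {I : Set ℝ}
  {f : ℝ → (Fin (e + 1) → ℝ) → ℝ}

/-- For `d = 1` there are no fast modes, so the solution of the cohomology equation vanishes. -/
theorem isDisplaceable_cohomologySolution (P : (Fin (e + 1) → ℝ) → ℝ) :
    IsDisplaceable (cohomologySolution A ω P) := by
  rintro rfl
  funext x
  have h : ∀ k : Fin (0 + 1) → ℤ, (Fin.init k : Fin 0 → ℤ) = 0 := fun k => Subsingleton.elim _ _
  simp [cohomologySolution, h]

/-- The displacement, divided by `ε`, of the change of variables of order `j`. -/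
noncomputable def averagingDisplacement {e : ℕ} (A : Matrix.SpecialLinearGroup (Fin (e + 1)) ℤ)
    (ω : Fin e → ℝ) (I : Set ℝ) (Ω : Fin (e + 1) → ℝ) (f : ℝ → (Fin (e + 1) → ℝ) → ℝ) (α₀ : ℝ)
    (j : ℕ) (ε : ℝ) (x : Fin (e + 1) → ℝ) : ℝ :=
  ∑ i ∈ Finset.range j, ε ^ i * averagingH A ω I Ω f α₀ i x

theorem changeOfVariables_eq (N : ℕ) (ε : ℝ) :
    changeOfVariables A ω I Ω f α₀ N ε =
      leafMap Ω fun x => ε * averagingDisplacement A ω I Ω f α₀ N ε x := by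
  simp only [changeOfVariables, averagingDisplacement, Finset.mul_sum]
  congr 1; funext y
  exact Finset.sum_congr rfl fun i _ => by ring

/-- The recursion that defines `p^j`, in terms of the conjugated map of order `j`. -/
theorem averagedTerm_apply (j : ℕ) (x : Fin (e + 1) → ℝ) :
    averagedTerm A ω I Ω f α₀ j x = limUnder (𝓝[I \ {0}] (0 : ℝ)) fun ε : ℝ =>
      (ε ^ (j + 1))⁻¹ * along Ω
      (conjugated A ω I Ω f α₀ j α₀ ε x
        - (x + α₀ • Ω + (∑ i ∈ Finset.range j,
            ε ^ (i + 1) * resonantPart A (averagedTerm A ω I Ω f α₀ i)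
              (act A x (Fin.last e))) • Ω)) := by
  rw [averagedTerm]
  simp only [conjugated, changeOfVariables, averagingH, Finset.sum_range]

/-- The comparison of the conjugations of orders `j` and `j + 1`: they differ by
`ε^{j+1} (h - h ∘ T)` up to terms of order `ε^{j+2}`. Here `w` and `w'` solve the implicit equations
for `v` and `v + ε^j h`. -/
theorem RegularityScale.sub_isBigO (hX : RegularityScale A ω Ω α₀ c K X)
    {v v' γ w w' : ℝ → (Fin (e + 1) → ℝ) → ℝ} {h : (Fin (e + 1) → ℝ) → ℝ} {j : ℕ}
    (hh : ∃ C, X 0 C h) (hv : ∃ C, ∀ᶠ ε in 𝓝[I] (0 : ℝ), X 0 C (v ε))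
    (hγ : ∃ C, ∀ᶠ ε in 𝓝[I] (0 : ℝ), X 0 C (γ ε))
    (hw' : ∃ C, ∀ᶠ ε in 𝓝[I] (0 : ℝ), X 0 C (w' ε))
    (hvv' : ∀ ε x, v' ε x = v ε x + ε ^ j * h x)
    (hw : ∀ᶠ ε in 𝓝[I] (0 : ℝ), ∀ x,
      w ε x = v ε x + γ ε (x + (ε * v ε x) • Ω) - v ε (x + α₀ • Ω + (ε * w ε x) • Ω))
    (hwe' : ∀ᶠ ε in 𝓝[I] (0 : ℝ), ∀ x,
      w' ε x = v' ε x + γ ε (x + (ε * v' ε x) • Ω) - v' ε (x + α₀ • Ω + (ε * w' ε x) • Ω))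
    (x : Fin (e + 1) → ℝ) :
    (fun ε => w' ε x - w ε x - ε ^ j * (h x - h (x + α₀ • Ω))) =O[𝓝[I] (0 : ℝ)]
      fun ε => ε ^ (j + 1) := by
  obtain ⟨Ch, hCh⟩ := hh
  obtain ⟨Cv, hCv⟩ := hv
  obtain ⟨Cγ, hCγ⟩ := hγ
  obtain ⟨Cw, hCw⟩ := hw'
  obtain ⟨Lv, hLv0, hLv⟩ := hX.exists_lipschitz Cv
  obtain ⟨Lγ, hLγ0, hLγ⟩ := hX.exists_lipschitz Cγ
  obtain ⟨Lh, hLh0, hLh⟩ := hX.exists_lipschitz Ch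
  set y := x + α₀ • Ω with hy
  set δ := h x - h y with hδ
  set k₁ : ℝ := Lγ * |h x| + Lh * |Cw| + Lv * |δ| with hk₁
  refine Asymptotics.IsBigO.of_bound (2 * k₁) ?_
  filter_upwards [hCv, hCγ, hCw, hw, hwe',
    eventually_abs_mul_le (I := I) Lv (by norm_num : (0 : ℝ) < 1 / 2)] with ε h1 h2 h3 h4 h5 h6
  have h4 := h4 x
  have h5 := h5 x
  rw [hvv' ε x, hvv' ε (y + _)] at h5
  set D := w' ε x - w ε x with hD
  -- the three contributions: of the map, of `v`, and of `h`
  have e1 : |γ ε (x + (ε * (v ε x + ε ^ j * h x)) • Ω) - γ ε (x + (ε * v ε x) • Ω)| ≤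
      Lγ * |h x| * |ε| ^ (j + 1) := by
    refine (hLγ h2 x _ _).trans (le_of_eq ?_)
    rw [← mul_sub, add_sub_cancel_left, abs_mul, abs_mul, abs_pow]; ring
  have e2 : |v ε (y + (ε * w ε x) • Ω) - v ε (y + (ε * w' ε x) • Ω)| ≤ Lv * |ε| * |D| := by
    refine (hLv h1 y _ _).trans (le_of_eq ?_)
    rw [← mul_sub, abs_mul, abs_sub_comm]; ring
  have e3 : |ε ^ j * (h y - h (y + (ε * w' ε x) • Ω))| ≤ Lh * |Cw| * |ε| ^ (j + 1) := by
    have h7 := hLh hCh y 0 (ε * w' ε x)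
    rw [zero_smul, add_zero, zero_sub, abs_neg, abs_mul] at h7
    have h8 := (hX.bound h3 x).trans (le_abs_self _)
    rw [abs_mul, abs_pow]
    calc |ε| ^ j * |h y - h (y + (ε * w' ε x) • Ω)| ≤ |ε| ^ j * (Lh * (|ε| * |Cw|)) := by
          refine mul_le_mul_of_nonneg_left (h7.trans ?_) (by positivity)
          gcongr
      _ = _ := by ring
  have hE : D - ε ^ j * δ =
      (γ ε (x + (ε * (v ε x + ε ^ j * h x)) • Ω) - γ ε (x + (ε * v ε x) • Ω)) +
      (v ε (y + (ε * w ε x) • Ω) - v ε (y + (ε * w' ε x) • Ω)) +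
      ε ^ j * (h y - h (y + (ε * w' ε x) • Ω)) := by
    rw [hD, hδ]
    linear_combination h5 - h4
  have e4 : |D| ≤ |D - ε ^ j * δ| + |ε| ^ j * |δ| := by
    have h9 : D = (D - ε ^ j * δ) + ε ^ j * δ := by ring
    calc |D| = |(D - ε ^ j * δ) + ε ^ j * δ| := by rw [← h9]
      _ ≤ _ := (abs_add_le _ _).trans (by rw [abs_mul (ε ^ j), abs_pow])
  have e5 : |D - ε ^ j * δ| ≤ Lγ * |h x| * |ε| ^ (j + 1) + Lv * |ε| * |D|
      + Lh * |Cw| * |ε| ^ (j + 1) := by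
    nth_rewrite 1 [hE]
    exact (abs_add_three _ _ _).trans (add_le_add (add_le_add e1 e2) e3)
  have e6 : Lv * |ε| * |D| ≤ 1 / 2 * |D - ε ^ j * δ| + Lv * |δ| * |ε| ^ (j + 1) := by
    calc Lv * |ε| * |D| ≤ Lv * |ε| * (|D - ε ^ j * δ| + |ε| ^ j * |δ|) := by gcongr
      _ = (|ε| * Lv) * |D - ε ^ j * δ| + Lv * |δ| * |ε| ^ (j + 1) := by ring
      _ ≤ _ := by gcongr
  rw [Real.norm_eq_abs, Real.norm_eq_abs, abs_pow]
  rw [hk₁]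
  linarith

end

section

variable {e : ℕ} {A : Matrix.SpecialLinearGroup (Fin (e + 1)) ℤ} {ω : Fin e → ℝ}
  {Ω : Fin (e + 1) → ℝ} {α₀ : ℝ} {c : ℕ} {K : FunctionClass}
  {X : ℕ → ℝ → ((Fin (e + 1) → ℝ) → ℝ) → Prop} {κ : ℕ} {I : Set ℝ}
  {f : ℝ → (Fin (e + 1) → ℝ) → ℝ}

/-- The conjugated map in terms of a solution of the implicit equation. -/
theorem eventually_conjugated_eq (hX : RegularityScale A ω Ω α₀ c K X) {j : ℕ}
    (hv : ∃ C, ∀ᶠ ε in 𝓝[I] (0 : ℝ), X 1 C (averagingDisplacement A ω I Ω f α₀ j ε))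
    {γ w : ℝ → (Fin (e + 1) → ℝ) → ℝ}
    (hf : ∀ᶠ ε in 𝓝[I] (0 : ℝ), ∀ x, ε * f ε x = ε * γ ε x)
    (hw : ∀ᶠ ε in 𝓝[I] (0 : ℝ), ∀ x, w ε x = averagingDisplacement A ω I Ω f α₀ j ε x
      + γ ε (x + (ε * averagingDisplacement A ω I Ω f α₀ j ε x) • Ω)
      - averagingDisplacement A ω I Ω f α₀ j ε (x + α₀ • Ω + (ε * w ε x) • Ω)) :
    ∀ᶠ ε in 𝓝[I] (0 : ℝ), ∀ x, conjugated A ω I Ω f α₀ j α₀ ε x =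
      x + α₀ • Ω + (ε * w ε x) • Ω := by
  have hvd : ∀ ε, IsDisplaceable (averagingDisplacement A ω I Ω f α₀ j ε) := by
    intro ε he
    funext x
    exact Finset.sum_eq_zero fun i _ => by
      simp [averagingH, isDisplaceable_cohomologySolution _ he]
  obtain ⟨k, C, hk⟩ := exists_inverse hX hv hvd
  filter_upwards [hk, hf, hw] with ε h1 h2 h3 x
  rw [conjugated, changeOfVariables_eq]
  refine invFun_leafMap_fptm h1.2.1 h1.2.2 x ?_
  rw [h2]
  linear_combination ε * h3 x

/-- The limit that defines `p^j` exists, and is the coefficient of `ε^{j+1}` in the displacement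
`ε w_ε` of the conjugated map. -/
theorem averagedTerm_eq [(𝓝[I \ {0}] (0 : ℝ)).NeBot] (hX : RegularityScale A ω Ω α₀ c K X)
    (hΩ : Ω ≠ 0) {N j : ℕ} (hj : j < N) {w R : ℝ → (Fin (e + 1) → ℝ) → ℝ}
    {a : ℕ → (Fin (e + 1) → ℝ) → ℝ} {C : ℝ}
    (hR : ∀ᶠ ε in 𝓝[I] (0 : ℝ), X 0 C (R ε) ∧
      ∀ x, w ε x = ∑ i ∈ Finset.range N, ε ^ i * a i x + ε ^ N * R ε x)
    (hconj : ∀ᶠ ε in 𝓝[I] (0 : ℝ), ∀ x, conjugated A ω I Ω f α₀ j α₀ ε x =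
      x + α₀ • Ω + (ε * w ε x) • Ω)
    (ha : ∀ i < j, ∀ x, a i x =
      resonantPart A (averagedTerm A ω I Ω f α₀ i) (act A x (Fin.last e))) :
    averagedTerm A ω I Ω f α₀ j = a j := by
  funext x
  rw [averagedTerm_apply]
  have hle : 𝓝[I \ {0}] (0 : ℝ) ≤ 𝓝[I] 0 := nhdsWithin_mono _ Set.sdiff_subset
  have hle0 : 𝓝[I \ {0}] (0 : ℝ) ≤ 𝓝 0 := nhdsWithin_le_nhds
  have h1 := truncation_isBigO (l := 𝓝[I \ {0}] (0 : ℝ)) hle0 (j := j + 1) hj (w := fun ε => w ε x)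
    (R := fun ε => R ε x) (a := fun i => a i x)
    (hle (hR.mono fun ε h => hX.bound h.1 x)) (hle (hR.mono fun ε h => h.2 x))
  have hne : ∀ᶠ ε in 𝓝[I \ {0}] (0 : ℝ), ε ≠ 0 := by
    filter_upwards [self_mem_nhdsWithin] with ε hε using hε.2
  have h2 : Tendsto (fun ε : ℝ => (ε ^ j)⁻¹ *
      (w ε x - ∑ i ∈ Finset.range (j + 1), ε ^ i * a i x)) (𝓝[I \ {0}] 0) (𝓝 0) := by
    have h3 := (Asymptotics.isBigO_refl (fun ε : ℝ => (ε ^ j)⁻¹) (𝓝[I \ {0}] (0 : ℝ))).mul h1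
    have h4 : Tendsto (fun ε : ℝ => ε) (𝓝[I \ {0}] (0 : ℝ)) (𝓝 0) := hle0
    refine (h3.congr' (EventuallyEq.refl _ _) ?_).trans_tendsto h4
    filter_upwards [hne] with ε hε
    rw [pow_succ, ← mul_assoc, inv_mul_cancel₀ (pow_ne_zero _ hε), one_mul]
  refine Tendsto.limUnder_eq ?_
  have h5 := h2.add_const (a j x)
  rw [zero_add] at h5
  refine h5.congr' ?_
  filter_upwards [hne, hle hconj] with ε hε h6
  rw [h6, add_sub_add_left_eq_sub, ← sub_smul, along_smul hΩ]
  have h7 : ∑ i ∈ Finset.range j, ε ^ (i + 1) *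
      resonantPart A (averagedTerm A ω I Ω f α₀ i) (act A x (Fin.last e)) =
      ε * ∑ i ∈ Finset.range j, ε ^ i * a i x := by
    rw [Finset.mul_sum]
    refine Finset.sum_congr rfl fun i hi => ?_
    rw [ha i (Finset.mem_range.1 hi)]; ring
  rw [h7, Finset.sum_range_succ]
  have h8 : ε ^ j ≠ 0 := pow_ne_zero _ hε
  field_simp
  ring

theorem averagingDisplacement_succ (j : ℕ) (ε : ℝ) (x : Fin (e + 1) → ℝ) :
    averagingDisplacement A ω I Ω f α₀ (j + 1) ε x =
      averagingDisplacement A ω I Ω f α₀ j ε x + ε ^ j * averagingH A ω I Ω f α₀ j x :=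
  Finset.sum_range_succ _ _

/-- The averaging procedure: each `p^j`, `j < N`, is regular, and after `N` steps the terms of order
at most `N` of the conjugated map are resonant. -/
theorem averaging [(𝓝[I \ {0}] (0 : ℝ)).NeBot] (hX : RegularityScale A ω Ω α₀ c K X)
    (hΩ : Ω ≠ 0) {N : ℕ} (hN : 1 ≤ N)
    {γ ψ : ℝ → (Fin (e + 1) → ℝ) → ℝ} {γ₀ : ℕ → (Fin (e + 1) → ℝ) → ℝ}
    (hγ₀ : ∀ i < N, ∃ C, X (N * (c + 1)) C (γ₀ i))
    (hψ : ∃ C, ∀ᶠ ε in 𝓝[I] (0 : ℝ), X (N * (c + 1)) C (ψ ε))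
    (hγ : ∀ᶠ ε in 𝓝[I] (0 : ℝ), ∀ x,
      γ ε x = ∑ i ∈ Finset.range N, ε ^ i * γ₀ i x + ε ^ N * ψ ε x)
    (hf : ∀ᶠ ε in 𝓝[I] (0 : ℝ), ∀ x, ε * f ε x = ε * γ ε x) :
    ∀ j ≤ N, (∀ i < j, ∃ C, X ((N - i) * (c + 1)) C (averagedTerm A ω I Ω f α₀ i)) ∧
      ∃ w : ℝ → (Fin (e + 1) → ℝ) → ℝ,
      (∀ᶠ ε in 𝓝[I] (0 : ℝ), ∀ x, w ε x = averagingDisplacement A ω I Ω f α₀ j ε x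
        + γ ε (x + (ε * averagingDisplacement A ω I Ω f α₀ j ε x) • Ω)
        - averagingDisplacement A ω I Ω f α₀ j ε (x + α₀ • Ω + (ε * w ε x) • Ω)) ∧
      ∃ (a : ℕ → (Fin (e + 1) → ℝ) → ℝ) (R : ℝ → (Fin (e + 1) → ℝ) → ℝ) (C : ℝ),
      (∀ i < N, ∃ C, X ((N - i) * (c + 1)) C (a i)) ∧
      (∀ᶠ ε in 𝓝[I] (0 : ℝ), X 0 C (R ε) ∧
        ∀ x, w ε x = ∑ i ∈ Finset.range N, ε ^ i * a i x + ε ^ N * R ε x) ∧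
      (∀ i < j, ∀ x, a i x =
        resonantPart A (averagedTerm A ω I Ω f α₀ i) (act A x (Fin.last e))) := by
  have hγ0 : ∃ C, ∀ᶠ ε in 𝓝[I] (0 : ℝ), X 0 C (γ ε) := by
    have h1 : Expands X (c + 1) I 0 (fun ε x => ∑ i ∈ Finset.range N, ε ^ i * γ₀ i x) :=
      hX.bounded_polynomial _ fun i hi => by
        obtain ⟨C, hC⟩ := hγ₀ i (Finset.mem_range.1 hi)
        exact ⟨C, hX.mono hC (Nat.zero_le _) le_rfl⟩
    have h2 : Expands X (c + 1) I 0 ψ := by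
      obtain ⟨C, hC⟩ := hψ
      exact ⟨C, hC.mono fun ε h => hX.mono h (Nat.zero_le _) le_rfl⟩
    exact (h1.add hX ((h2.mul_eps_pow hX N).mono hX (Nat.zero_le _))).congr hγ
  -- regularity of the solutions of the cohomology equation, from that of the averaged terms
  have hreg : ∀ i < N, (∃ C, X ((N - i) * (c + 1)) C (averagedTerm A ω I Ω f α₀ i)) →
      (∃ C, X ((N - 1 - i) * (c + 1) + 1) C (averagingH A ω I Ω f α₀ i)) ∧
      (∀ x, averagingH A ω I Ω f α₀ i x - averagingH A ω I Ω f α₀ i (x + α₀ • Ω) =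
        resonantPart A (averagedTerm A ω I Ω f α₀ i) (act A x (Fin.last e))
          - averagedTerm A ω I Ω f α₀ i x) ∧
      ∃ C, X ((N - i) * (c + 1)) C
        (fun x => averagingH A ω I Ω f α₀ i x - averagingH A ω I Ω f α₀ i (x + α₀ • Ω)) := by
    rintro i hi ⟨C, hC⟩
    have h1 : (N - i) * (c + 1) = (N - 1 - i) * (c + 1) + 1 + c := by
      have : N - i = N - 1 - i + 1 := by omega
      rw [this]; ring
    have h2 : ∀ x, averagingH A ω I Ω f α₀ i x - averagingH A ω I Ω f α₀ i (x + α₀ • Ω) =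
        resonantPart A (averagedTerm A ω I Ω f α₀ i) (act A x (Fin.last e))
          - averagedTerm A ω I Ω f α₀ i x := by
      intro x
      have := hX.cohomology_eq (hX.mono hC (by omega) le_rfl) x
      simp only [averagingH]
      linarith
    refine ⟨hX.cohomology (h1 ▸ hC), h2, ?_⟩
    obtain ⟨C', hC'⟩ := hX.resonant hC
    obtain ⟨C'', hC''⟩ := hX.neg hC
    refine ⟨C' + C'', ?_⟩
    rw [funext h2]
    simpa only [sub_eq_add_neg] using hX.add hC' hC''
  have hvbdd : ∀ j ≤ N, (∀ i < j, ∃ C, X ((N - i) * (c + 1)) C (averagedTerm A ω I Ω f α₀ i)) →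
      ∃ C, ∀ᶠ ε in 𝓝[I] (0 : ℝ), X 1 C (averagingDisplacement A ω I Ω f α₀ j ε) := by
    intro j hj h
    refine hX.bounded_polynomial _ fun i hi => ?_
    have hi := Finset.mem_range.1 hi
    obtain ⟨C, hC⟩ := (hreg i (by omega) (h i hi)).1
    exact ⟨C, hX.mono hC (by omega) le_rfl⟩
  -- the conjugated map of order `j` has an expansion
  have hexp : ∀ j ≤ N, (∀ i < j, ∃ C, X ((N - i) * (c + 1)) C (averagedTerm A ω I Ω f α₀ i)) →
      ∃ w : ℝ → (Fin (e + 1) → ℝ) → ℝ, Expands X (c + 1) I N w ∧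
      ∀ᶠ ε in 𝓝[I] (0 : ℝ), ∀ x, w ε x = averagingDisplacement A ω I Ω f α₀ j ε x
        + γ ε (x + (ε * averagingDisplacement A ω I Ω f α₀ j ε x) • Ω)
        - averagingDisplacement A ω I Ω f α₀ j ε (x + α₀ • Ω + (ε * w ε x) • Ω) := by
    intro j hj h
    refine exists_conjugated_expansion (κ := c + 1) hX (by omega) hN
      (h := fun i => if i < j then averagingH A ω I Ω f α₀ i else fun _ => 0) ?_ ?_ ?_ hγ₀ hψ hγ ?_
    · intro i hi
      split_ifs with hij
      · exact (hreg i hi (h i hij)).1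
      · exact ⟨0, hX.zero _⟩
    · intro i hi
      split_ifs with hij
      · exact isDisplaceable_cohomologySolution _
      · exact fun _ => rfl
    · intro i hi
      split_ifs with hij
      · exact (hreg i hi (h i hij)).2.2
      · exact ⟨0, by simpa using hX.zero _⟩
    · intro ε x
      rw [averagingDisplacement, ← Finset.sum_subset (Finset.range_subset_range.2 hj)]
      · exact Finset.sum_congr rfl fun i hi => by rw [if_pos (Finset.mem_range.1 hi)]
      · intro i _ hi
        rw [if_neg (by simpa using hi), mul_zero]
  intro j
  induction j with
  | zero =>
    intro hj
    obtain ⟨w, hw, hweq⟩ := hexp 0 hj (by simp)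
    obtain ⟨a, R, ha, C, hR⟩ := hw.exists_coeff
    exact ⟨by simp, w, hweq, a, R, C, ha, hR, by simp⟩
  | succ j ih =>
    intro hj
    obtain ⟨hp, w, hweq, a, R, C, ha, hR, hres⟩ := ih (by omega)
    have hpj : averagedTerm A ω I Ω f α₀ j = a j :=
      averagedTerm_eq hX hΩ hj hR (eventually_conjugated_eq hX (hvbdd j (by omega) hp) hf hweq) hres
    have hp' : ∀ i < j + 1, ∃ C, X ((N - i) * (c + 1)) C (averagedTerm A ω I Ω f α₀ i) := by
      intro i hi
      rcases Nat.lt_succ_iff_lt_or_eq.1 hi with h | rfl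
      · exact hp i h
      · rw [hpj]; exact ha _ (by omega)
    obtain ⟨w', hw', hweq'⟩ := hexp (j + 1) hj hp'
    obtain ⟨a', R', ha', C', hR'⟩ := hw'.exists_coeff
    refine ⟨hp', w', hweq', a', R', C', ha', hR', ?_⟩
    obtain ⟨hhreg, hheq, -⟩ := hreg j (by omega) (hp' j (by omega))
    have key : ∀ x, ∀ i < j + 1, a' i x - a i x - (if i = j then
        averagingH A ω I Ω f α₀ j x - averagingH A ω I Ω f α₀ j (x + α₀ • Ω) else 0) = 0 := by
      intro x
      have hle : 𝓝[I \ {0}] (0 : ℝ) ≤ 𝓝[I] 0 := nhdsWithin_mono _ Set.sdiff_subset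
      have hle0 : 𝓝[I \ {0}] (0 : ℝ) ≤ 𝓝 0 := nhdsWithin_le_nhds
      have h1 := truncation_isBigO (l := 𝓝[I \ {0}] (0 : ℝ)) hle0 (j := j + 1) hj
        (w := fun ε => w ε x) (R := fun ε => R ε x) (a := fun i => a i x)
        (hle (hR.mono fun ε h => hX.bound h.1 x)) (hle (hR.mono fun ε h => h.2 x))
      have h2 := truncation_isBigO (l := 𝓝[I \ {0}] (0 : ℝ)) hle0 (j := j + 1) hj
        (w := fun ε => w' ε x) (R := fun ε => R' ε x) (a := fun i => a' i x)
        (hle (hR'.mono fun ε h => hX.bound h.1 x)) (hle (hR'.mono fun ε h => h.2 x))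
      have h3 := (hX.sub_isBigO (h := averagingH A ω I Ω f α₀ j) (j := j)
        (by obtain ⟨C, hC⟩ := hhreg; exact ⟨C, hX.mono hC (Nat.zero_le _) le_rfl⟩)
        (by
          obtain ⟨C, hC⟩ := hvbdd j (by omega) hp
          exact ⟨C, hC.mono fun ε h => hX.mono h (Nat.zero_le _) le_rfl⟩)
        hγ0 (hw'.bounded hX) (averagingDisplacement_succ j) hweq hweq' x).mono hle
      refine coeff_eq_zero_of_isBigO (nhdsWithin_mono _ fun ε hε => hε.2)
        (((h3.add h1).sub h2).congr (fun ε => ?_) fun ε => rfl)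
      simp only [mul_sub, Finset.sum_sub_distrib, mul_ite, mul_zero, Finset.sum_ite_eq',
        Finset.mem_range, Nat.lt_succ_self, if_true]
      ring
    intro i hi x
    have h4 := key x i hi
    rcases Nat.lt_succ_iff_lt_or_eq.1 hi with h | rfl
    · rw [if_neg h.ne] at h4
      rw [← hres i h x]; linarith
    · rw [if_pos rfl, hheq, hpj] at h4
      rw [hpj]; linarith

end

/-! ### The normal form -/

section Act

variable {d : ℕ} (A : Matrix.SpecialLinearGroup (Fin d) ℤ)

/-- The linear map `act A`, as a continuous linear map. -/
noncomputable def actCLM : (Fin d → ℝ) →L[ℝ] (Fin d → ℝ) :=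
  LinearMap.toContinuousLinearMap
    (Matrix.mulVecLin ((A : Matrix (Fin d) (Fin d) ℤ).map (fun t : ℤ => (t : ℝ))))

@[simp]
theorem actCLM_apply (x : Fin d → ℝ) : actCLM A x = act A x := rfl

theorem act_add (x y : Fin d → ℝ) : act A (x + y) = act A x + act A y := (actCLM A).map_add x y

theorem act_sub (x y : Fin d → ℝ) : act A (x - y) = act A x - act A y := (actCLM A).map_sub x y

theorem act_smul (c : ℝ) (x : Fin d → ℝ) : act A (c • x) = c • act A x := (actCLM A).map_smul c x

theorem act_mul (B : Matrix.SpecialLinearGroup (Fin d) ℤ) (x : Fin d → ℝ) :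
    act A (act B x) = act (A * B) x := by
  simp only [act, Matrix.mulVec_mulVec, Matrix.SpecialLinearGroup.coe_mul]
  congr 1
  exact (Matrix.map_mul (f := Int.castRingHom ℝ)).symm

@[simp]
theorem act_one (x : Fin d → ℝ) : act (1 : Matrix.SpecialLinearGroup (Fin d) ℤ) x = x := by
  simp [act]

@[simp]
theorem act_act_inv (x : Fin d → ℝ) : act A (act A⁻¹ x) = x := by simp [act_mul]

@[simp]
theorem act_inv_act (x : Fin d → ℝ) : act A⁻¹ (act A x) = x := by simp [act_mul]

/-- Integer matrices preserve the lattice. -/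
theorem act_intVec (k : Fin d → ℤ) :
    act A (intVec k) = intVec ((A : Matrix (Fin d) (Fin d) ℤ) *ᵥ k) := by
  funext i
  simp [act, intVec, Matrix.mulVec, dotProduct]

end Act

/-- A polynomial in `ε` whose terms of order less than `n` vanish is divisible by `ε ^ n`. -/
theorem sum_range_eq_pow_mul_sum_Icc {n m : ℕ} (hn : 1 ≤ n) (ε : ℝ) {q : ℕ → ℝ}
    (hq : ∀ i, i + 1 < n → q i = 0) :
    ∑ i ∈ Finset.range (n + m - 1), ε ^ (i + 1) * q i =
      ε ^ n * ∑ j ∈ Finset.Icc n (n + m - 1), ε ^ (j - n) * q (j - 1) := by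
  have h1 : ∑ j ∈ Finset.Icc 1 (n + m - 1), ε ^ j * q (j - 1) =
      ∑ i ∈ Finset.range (n + m - 1), ε ^ (i + 1) * q i := by
    rw [← Finset.Ico_add_one_right_eq_Icc, Finset.sum_Ico_eq_sum_range]
    simp [add_comm 1]
  rw [← h1, Finset.mul_sum, ← Finset.sum_subset (Finset.Icc_subset_Icc_left hn)]
  · refine Finset.sum_congr rfl fun j hj => ?_
    rw [← mul_assoc, ← pow_add, Nat.add_sub_cancel' (Finset.mem_Icc.1 hj).1]
  · intro j hj hj'
    rw [hq, mul_zero]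
    simp only [Finset.mem_Icc] at hj hj'
    omega

section

variable {e : ℕ} {A : Matrix.SpecialLinearGroup (Fin (e + 1)) ℤ} {ω : Fin e → ℝ}
  {Ω : Fin (e + 1) → ℝ} {α₀ : ℝ} {c : ℕ} {K : FunctionClass}
  {X : ℕ → ℝ → ((Fin (e + 1) → ℝ) → ℝ) → Prop} {κ : ℕ} {I : Set ℝ}
  {f : ℝ → (Fin (e + 1) → ℝ) → ℝ} {L : Fin (e + 1) → ℤ}

/-- In the coordinates given by `A`, the direction `Ω` is `α₀⁻¹ (ω + L₁, L₂)`; this is where the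
vectors in the definitions of `β` and `η` come from. -/
theorem IsIntrinsicFrequency.act_eq (h : IsIntrinsicFrequency (α₀ • Ω) A ω L) (hα₀ : α₀ ≠ 0) :
    act A Ω = α₀⁻¹ • ((Fin.snoc ω 0 : Fin (e + 1) → ℝ) + intVec L) := by
  rw [← h.1, act_smul, smul_smul, inv_mul_cancel₀ hα₀, one_smul]

/-- The normal form, when the terms of order at most `n + m - 1` in the conjugated map are
resonant. -/
theorem act_conjugated_eq_normalForm (hint : IsIntrinsicFrequency (α₀ • Ω) A ω L) (hα₀ : α₀ ≠ 0)
    {n m : ℕ} (hm : 1 ≤ m) (hn : IsResonanceOrder A ω I Ω f α₀ n) {ε : ℝ}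
    {w R : (Fin (e + 1) → ℝ) → ℝ}
    (hconj : ∀ x, conjugated A ω I Ω f α₀ (n + m - 1) α₀ ε x = x + α₀ • Ω + (ε * w x) • Ω)
    (hw : ∀ x, w x = ∑ i ∈ Finset.range (n + m - 1), ε ^ i *
      resonantPart A (averagedTerm A ω I Ω f α₀ i) (act A x (Fin.last e)) + ε ^ (n + m - 1) * R x)
    (α : ℝ) (x : Fin (e + 1) → ℝ) :
    act A (conjugated A ω I Ω f α₀ (n + m - 1) α ε (act A⁻¹ x)) =
      normalForm A ω I Ω f α₀ L n m (fun x => R (act A⁻¹ x) • act A Ω) α ε x + intVec L := by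
  have hn1 : 1 ≤ n := hn.1.1
  have h1 : ε * w (act A⁻¹ x) =
      ε ^ n * resonantSum A ω I Ω f α₀ n m (x (Fin.last e)) ε
        + ε ^ (n + m) * R (act A⁻¹ x) := by
    rw [hw, act_act_inv, mul_add, Finset.mul_sum]
    simp only [resonantSum, resonantTerm]
    rw [← sum_range_eq_pow_mul_sum_Icc hn1 ε
      (q := fun i => resonantPart A (averagedTerm A ω I Ω f α₀ i) (x (Fin.last e)))]
    · congr 1
      · exact Finset.sum_congr rfl fun i _ => by ring
      · rw [← mul_assoc, ← pow_succ', Nat.sub_add_cancel (by omega)]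
    · intro i hi
      by_contra hne
      have := hn.2 (show i + 1 ∈ _ from ⟨by omega, _, hne⟩)
      omega
  have h2 : act A (conjugated A ω I Ω f α₀ (n + m - 1) α ε (act A⁻¹ x)) =
      x + ((Fin.snoc ω 0 : Fin (e + 1) → ℝ) + intVec L)
      + (ε ^ n * resonantSum A ω I Ω f α₀ n m (x (Fin.last e)) ε
        + ε ^ (n + m) * R (act A⁻¹ x)) • act A Ω
      + deltaMapA A ω I Ω f α₀ (n + m - 1) α ε x := by
    rw [deltaMapA, deltaMap, act_sub, hconj (act A⁻¹ x), act_add, act_add, act_act_inv, hint.1,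
      act_smul, h1]
    abel
  rw [h2, hint.act_eq hα₀]
  funext i
  refine Fin.lastCases ?_ (fun i => ?_) i
  · simp only [normalForm, normalEta, Fin.snoc_last, Pi.add_apply, Pi.smul_apply, smul_eq_mul,
      intVec]
    ring
  · simp only [normalForm, normalBeta, Fin.snoc_castSucc, Pi.add_apply, Pi.smul_apply, smul_eq_mul,
      intVec, Fin.init]
    ring

/-- The resonant normal form theorem for a scale of function spaces. -/
theorem RegularityScale.hasResonantNormalForm [(𝓝[I \ {0}] (0 : ℝ)).NeBot]
    (hX : RegularityScale A ω Ω α₀ c K X) (hΩ : Ω ≠ 0) (hα₀ : α₀ ≠ 0)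
    (hint : IsIntrinsicFrequency (α₀ • Ω) A ω L) {n m : ℕ} (hm : 1 ≤ m)
    (hn : IsResonanceOrder A ω I Ω f α₀ n)
    {γ ψ : ℝ → (Fin (e + 1) → ℝ) → ℝ} {γ₀ : ℕ → (Fin (e + 1) → ℝ) → ℝ}
    (hγ₀ : ∀ i < n + m - 1, ∃ C, X ((n + m - 1) * (c + 1)) C (γ₀ i))
    (hψ : ∃ C, ∀ᶠ ε in 𝓝[I] (0 : ℝ), X ((n + m - 1) * (c + 1)) C (ψ ε))
    (hγ : ∀ᶠ ε in 𝓝[I] (0 : ℝ), ∀ x,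
      γ ε x = ∑ i ∈ Finset.range (n + m - 1), ε ^ i * γ₀ i x + ε ^ (n + m - 1) * ψ ε x)
    (hf : ∀ᶠ ε in 𝓝[I] (0 : ℝ), ∀ x, ε * f ε x = ε * γ ε x) :
    HasResonantNormalForm A ω I Ω f α₀ L K n m := by
  have hn1 : 1 ≤ n := hn.1.1
  set N := n + m - 1 with hNdef
  obtain ⟨hp, w, hweq, a, R, CR, -, hR, hres⟩ :=
    averaging hX hΩ (by omega) hγ₀ hψ hγ hf N le_rfl
  have hh : ∀ i < N, ∃ C, X 1 C (averagingH A ω I Ω f α₀ i) := by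
    intro i hi
    obtain ⟨C, hC⟩ := hp i hi
    have h1 : 0 + 1 + c ≤ (N - i) * (c + 1) := by
      have : 1 ≤ N - i := by omega
      nlinarith
    exact hX.cohomology (t := 0) (hX.mono hC h1 le_rfl)
  have hv : ∃ C, ∀ᶠ ε in 𝓝[I] (0 : ℝ), X 1 C (averagingDisplacement A ω I Ω f α₀ N ε) :=
    hX.bounded_polynomial _ fun i hi => hh i (Finset.mem_range.1 hi)
  have hconj := eventually_conjugated_eq hX hv hf hweq
  have hvd : ∀ ε, IsDisplaceable (averagingDisplacement A ω I Ω f α₀ N ε) := by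
    intro ε he
    funext x
    exact Finset.sum_eq_zero fun i _ => by
      simp [averagingH, isDisplaceable_cohomologySolution _ he]
  obtain ⟨k, Ck, hk⟩ := exists_inverse hX hv hvd
  obtain ⟨Cv, hCv⟩ := hv
  -- the resonant sum
  obtain ⟨Cs, hCs⟩ : ∃ C, ∀ᶠ ε in 𝓝[I] (0 : ℝ), X 0 C
      (fun x => resonantSum A ω I Ω f α₀ n m (act A x (Fin.last e)) ε) := by
    obtain ⟨C, hC⟩ := hX.bounded_polynomial (I := I) (t := 0) (Finset.range m)
      (h := fun i x => resonantTerm A ω I Ω f α₀ (n + i) (act A x (Fin.last e)))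
      (fun i hi => by
        have hi := Finset.mem_range.1 hi
        obtain ⟨C, hC⟩ := hp (n + i - 1) (by omega)
        exact hX.resonant (hX.mono hC (Nat.zero_le _) le_rfl))
    refine ⟨C, hC.mono fun ε h => ?_⟩
    convert h using 2 with x
    rw [resonantSum, ← Finset.Ico_add_one_right_eq_Icc, Finset.sum_Ico_eq_sum_range]
    have : n + m - 1 + 1 - n = m := by omega
    rw [this]
    simp
  -- a common constant
  obtain ⟨B₀, hB₀⟩ := hX.mul 0
  obtain ⟨B₄, hB₄⟩ := hX.toClass
  obtain ⟨B₁, hB₁⟩ := hX.toClass_act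
  obtain ⟨B₂, hB₂⟩ := hX.toClass_circle
  obtain ⟨B₃, hB₃⟩ := hX.fderiv_le
  obtain ⟨Ch, hCh⟩ : ∃ C, ∀ i < N, X 0 C (averagingH A ω I Ω f α₀ i) := by
    choose! C hC using hh
    exact ⟨∑ i ∈ Finset.range N, |C i|, fun i hi => hX.mono (hC i hi) (Nat.zero_le _)
      ((le_abs_self _).trans (Finset.single_le_sum (f := fun i => |C i|)
        (fun i _ => abs_nonneg _) (Finset.mem_range.2 hi)))⟩
  set M : ℝ := ‖(actCLM A : (Fin (e + 1) → ℝ) →L[ℝ] (Fin (e + 1) → ℝ))‖ with hM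
  have hM0 : 0 ≤ M := norm_nonneg _
  set D : ℝ := 1 + |B₃ * Ck| * ‖Ω‖ with hD
  have hD0 : 0 ≤ D := by positivity
  set C₀ : ℝ := B₄ * Ch with hC₀
  set C₁ : ℝ := B₄ * (B₀ * ‖Ω‖ * (B₀ * 1 * Cv)) with hC₁
  set C₂ : ℝ := B₄ * (B₀ * ‖Ω‖ * (B₀ * 1 * Ck)) with hC₂
  set C₃ : ℝ := B₁ * (B₀ * CR * ‖act A Ω‖) with hC₃
  set C₄ : ℝ := B₂ * (B₀ * Cs * ‖act A Ω‖) with hC₄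
  set C₅ : ℝ := M * (D * ‖Ω‖) with hC₅
  have hbig : ∀ᶠ ε in 𝓝[I] (0 : ℝ), X 0 Cv (averagingDisplacement A ω I Ω f α₀ N ε) ∧
      X 0 Ck (k ε) ∧ Function.Bijective (changeOfVariables A ω I Ω f α₀ N ε) ∧
      (∀ y, Function.invFun (changeOfVariables A ω I Ω f α₀ N ε) y = y + (ε * k ε y) • Ω) ∧
      X 0 CR (R ε) ∧
      (∀ x, w ε x = ∑ i ∈ Finset.range N, ε ^ i * a i x + ε ^ N * R ε x) ∧
      (∀ x, conjugated A ω I Ω f α₀ N α₀ ε x = x + α₀ • Ω + (ε * w ε x) • Ω) ∧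
      X 0 Cs (fun x => resonantSum A ω I Ω f α₀ n m (act A x (Fin.last e)) ε) ∧ |ε| ≤ 1 := by
    filter_upwards [hCv, hk, hR, hconj, hCs, eventually_abs_mul_le (I := I) 1 one_pos]
      with ε h1 h2 h3 h4 h5 h6
    obtain ⟨h7, h8⟩ := leafMap_bijective h2.2.1 h2.2.2
    rw [← changeOfVariables_eq] at h7 h8
    exact ⟨hX.mono h1 (Nat.zero_le _) le_rfl, h2.1, h7, h8, h3.1, h3.2, h4, h5, by simpa using h6⟩
  obtain ⟨ε₁, hε₁, hball⟩ := Metric.mem_nhdsWithin_iff.1 hbig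
  refine ⟨ε₁, hε₁, |C₀| + |C₁| + |C₂| + |C₃| + |C₄| + |C₅|,
    fun ε x => R ε (act A⁻¹ x) • act A Ω, ?_, ?_⟩
  · intro j hj
    refine hX.class_mono (hB₄ (hCh j hj)) ?_
    linarith [le_abs_self C₀, abs_nonneg C₁, abs_nonneg C₂, abs_nonneg C₃, abs_nonneg C₄,
      abs_nonneg C₅]
  intro ε hεI hε
  obtain ⟨e1, e2, e3, e4, e5, e6, e7, e8, e9⟩ := hball ⟨by simpa using hε, hεI⟩
  have hcoord : ∀ (z : Fin (e + 1) → ℝ) (i : Fin (e + 1)), X 0 ‖z‖ (fun _ => z i) := fun z i =>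
    hX.mono (hX.const 0 (z i)) le_rfl (norm_le_pi_norm z i)
  have hεX : X 0 1 (fun _ => ε) := hX.mono (hX.const 0 ε) le_rfl e9
  have hinv : Function.invFun (changeOfVariables A ω I Ω f α₀ N ε) = fun y => y + (ε * k ε y) • Ω :=
    funext e4
  obtain ⟨hkd, hkD⟩ := hB₃ e2
  have hderiv : ∀ y, HasFDerivAt (fun y => y + (ε * k ε y) • Ω)
      (ContinuousLinearMap.id ℝ _ + ((ε • fderiv ℝ (k ε) y).smulRight Ω)) y := fun y =>
    (hasFDerivAt_id y).add (((hkd y).hasFDerivAt.const_mul ε).smul_const Ω)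
  have hDle : ∀ y, ‖fderiv ℝ (Function.invFun (changeOfVariables A ω I Ω f α₀ N ε)) y‖ ≤ D := by
    intro y
    rw [hinv, (hderiv y).fderiv]
    refine (norm_add_le _ _).trans ?_
    refine add_le_add ContinuousLinearMap.norm_id_le ?_
    rw [ContinuousLinearMap.norm_smulRight_apply, norm_smul, Real.norm_eq_abs]
    refine mul_le_mul_of_nonneg_right ?_ (norm_nonneg _)
    calc |ε| * ‖fderiv ℝ (k ε) y‖ ≤ 1 * |B₃ * Ck| := by
          gcongr; exact (hkD y).trans (le_abs_self _)
      _ = _ := one_mul _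
  have hbdd : BddAbove (Set.range fun y =>
      ‖fderiv ℝ (Function.invFun (changeOfVariables A ω I Ω f α₀ N ε)) y‖) :=
    ⟨D, by rintro _ ⟨y, rfl⟩; exact hDle y⟩
  have hdelta : ∀ (α : ℝ) (x : Fin (e + 1) → ℝ), ‖deltaMap A ω I Ω f α₀ N α ε x‖ ≤
        (⨆ y, ‖fderiv ℝ (Function.invFun (changeOfVariables A ω I Ω f α₀ N ε)) y‖)
          * ‖Ω‖ * |α - α₀| := by
    intro α x
    rw [deltaMap, conjugated, conjugated]
    have h1 := Convex.norm_image_sub_le_of_norm_fderiv_le (𝕜 := ℝ) (s := Set.univ)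
      (f := Function.invFun (changeOfVariables A ω I Ω f α₀ N ε))
      (x := fptm Ω f α₀ ε (changeOfVariables A ω I Ω f α₀ N ε x))
      (y := fptm Ω f α ε (changeOfVariables A ω I Ω f α₀ N ε x))
      (fun y _ => by rw [hinv]; exact (hderiv y).differentiableAt)
      (fun y _ => le_ciSup hbdd y) convex_univ (Set.mem_univ _) (Set.mem_univ _)
    refine h1.trans (le_of_eq ?_)
    have h2 : fptm Ω f α ε (changeOfVariables A ω I Ω f α₀ N ε x) -
        fptm Ω f α₀ ε (changeOfVariables A ω I Ω f α₀ N ε x) = (α - α₀) • Ω := by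
      simp only [fptm]; module
    rw [h2, norm_smul, Real.norm_eq_abs]; ring
  have hAΩ := hint.act_eq hα₀
  refine ⟨e3, ?_, ?_, ?_, ?_, ?_, ?_, hbdd, hdelta, ?_⟩
  · intro i
    have h1 := hB₄ (hB₀ (hcoord Ω i) (hB₀ hεX e1))
    refine hX.class_mono (C := C₁) ?_ (by
      linarith [abs_nonneg C₀, le_abs_self C₁, abs_nonneg C₂, abs_nonneg C₃, abs_nonneg C₄,
        abs_nonneg C₅])
    convert h1 using 2 with x
    rw [changeOfVariables_eq]
    simp only [leafMap, Pi.add_apply, Pi.smul_apply, smul_eq_mul]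
    ring
  · intro i
    have h1 := hB₄ (hB₀ (hcoord Ω i) (hB₀ hεX e2))
    refine hX.class_mono (C := C₂) ?_ (by
      linarith [abs_nonneg C₀, abs_nonneg C₁, le_abs_self C₂, abs_nonneg C₃, abs_nonneg C₄,
        abs_nonneg C₅])
    convert h1 using 2 with x
    rw [e4]
    simp only [Pi.add_apply, Pi.smul_apply, smul_eq_mul]
    ring
  · intro α x
    refine act_conjugated_eq_normalForm hint hα₀ hm hn e7 (fun x => ?_) α x
    rw [e6 x]
    congr 1
    exact Finset.sum_congr rfl fun i hi => by rw [hres i (Finset.mem_range.1 hi)]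
  · intro i
    refine hX.class_mono (C := C₃) ?_ (by
      linarith [abs_nonneg C₀, abs_nonneg C₁, abs_nonneg C₂, le_abs_self C₃, abs_nonneg C₄,
        abs_nonneg C₅])
    exact hB₁ (hB₀ e5 (hcoord (act A Ω) i))
  · intro i
    refine hX.class_mono (C := C₄) ?_ (by
      linarith [abs_nonneg C₀, abs_nonneg C₁, abs_nonneg C₂, abs_nonneg C₃, le_abs_self C₄,
        abs_nonneg C₅])
    convert hB₂ (hB₀ e8 (hcoord (act A Ω) i.castSucc)) using 2 with y
    rw [act_act_inv, Fin.snoc_last, hAΩ]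
    simp only [normalBeta, Pi.add_apply, Pi.smul_apply, smul_eq_mul, intVec, Fin.init,
      Fin.snoc_castSucc]
    ring
  · refine hX.class_mono (C := C₄) ?_ (by
      linarith [abs_nonneg C₀, abs_nonneg C₁, abs_nonneg C₂, abs_nonneg C₃, le_abs_self C₄,
        abs_nonneg C₅])
    convert hB₂ (hB₀ e8 (hcoord (act A Ω) (Fin.last e))) using 2 with y
    rw [act_act_inv, Fin.snoc_last, hAΩ]
    simp only [normalEta, Pi.add_apply, Pi.smul_apply, smul_eq_mul, intVec, Fin.snoc_last]
    ring
  · intro α x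
    have h1 : ‖deltaMapA A ω I Ω f α₀ N α ε x‖ ≤ C₅ * |α - α₀| := by
      rw [deltaMapA, ← actCLM_apply]
      refine (ContinuousLinearMap.le_opNorm _ _).trans ?_
      have h2 : (⨆ y, ‖fderiv ℝ (Function.invFun (changeOfVariables A ω I Ω f α₀ N ε)) y‖) ≤ D :=
        ciSup_le hDle
      calc M * ‖deltaMap A ω I Ω f α₀ N α ε (act A⁻¹ x)‖
          ≤ M * (D * ‖Ω‖ * |α - α₀|) := by
            refine mul_le_mul_of_nonneg_left ((hdelta α _).trans ?_) hM0
            gcongr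
        _ = C₅ * |α - α₀| := by rw [hC₅]; ring
    refine h1.trans (mul_le_mul_of_nonneg_right ?_ (abs_nonneg _))
    linarith [abs_nonneg C₀, abs_nonneg C₁, abs_nonneg C₂, abs_nonneg C₃, abs_nonneg C₄,
      le_abs_self C₅]

end

/-! ### Integrals depending on a parameter -/

section ParametricIntegral

variable {S : Type*} [MeasurableSpace S] {μ : Measure S} [IsFiniteMeasure μ]

/-- Differentiation under the integral sign, for a family of `C^n` functions with uniformly bounded
derivatives. -/
theorem contDiff_integral {E G : Type*} [NormedAddCommGroup E] [NormedSpace ℝ E]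
    [NormedAddCommGroup G] [NormedSpace ℝ G] [CompleteSpace G] {n : ℕ} {F : S → E → G} {C : ℝ}
    (hF : ∀ᵐ s ∂μ, ContDiff ℝ n (F s))
    (hmeas : ∀ i ≤ n, ∀ x, AEStronglyMeasurable (fun s => iteratedFDeriv ℝ i (F s) x) μ)
    (hC : ∀ᵐ s ∂μ, ∀ i ≤ n, ∀ x, ‖iteratedFDeriv ℝ i (F s) x‖ ≤ C) :
    ContDiff ℝ n (fun x => ∫ s, F s x ∂μ) ∧
      ∀ i ≤ n, ∀ x, iteratedFDeriv ℝ i (fun x => ∫ s, F s x ∂μ) x =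
        ∫ s, iteratedFDeriv ℝ i (F s) x ∂μ := by
  have hint : ∀ i ≤ n, ∀ x, Integrable (fun s => iteratedFDeriv ℝ i (F s) x) μ := fun i hi x =>
    Integrable.of_bound (hmeas i hi x) C (hC.mono fun s h => h i hi x)
  have hT : HasFTaylorSeriesUpTo n (fun x => ∫ s, F s x ∂μ)
      (fun x i => ∫ s, iteratedFDeriv ℝ i (F s) x ∂μ) := by
    refine ⟨fun x => ?_, fun m hm x => ?_, fun m hm => ?_⟩
    · have := ((continuousMultilinearCurryFin0 ℝ E G).toContinuousLinearEquiv :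
        _ →L[ℝ] G).integral_comp_comm (hint 0 (Nat.zero_le _) x)
      exact this.symm
    · have hm : m < n := by exact_mod_cast hm
      have hcurry : ∀ T : S → ContinuousMultilinearMap ℝ (fun _ : Fin (m + 1) => E) G,
          Integrable T μ → (∫ s, T s ∂μ).curryLeft = ∫ s, (T s).curryLeft ∂μ := by
        intro T hT
        let Λ : (E [×(m + 1)]→L[ℝ] G) →L[ℝ] (E →L[ℝ] (E [×m]→L[ℝ] G)) :=
          (continuousMultilinearCurryLeftEquiv ℝ (fun _ : Fin (m + 1) => E)
            G).toContinuousLinearEquiv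
        exact (ContinuousLinearMap.integral_comp_comm (𝕜 := ℝ)
          (Fₗ := E →L[ℝ] (E [×m]→L[ℝ] G)) Λ hT).symm
      rw [hcurry _ (hint (m + 1) hm x)]
      refine hasFDerivAt_integral_of_dominated_of_fderiv_le (𝕜 := ℝ) (bound := fun _ => C)
        (s := Set.univ) (F := fun x s => iteratedFDeriv ℝ m (F s) x)
        (F' := fun x s => (iteratedFDeriv ℝ (m + 1) (F s) x).curryLeft) univ_mem
        (Eventually.of_forall fun x => hmeas m hm.le x) (hint m hm.le x) ?_ ?_
        (integrable_const _) ?_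
      · exact ((continuousMultilinearCurryLeftEquiv ℝ (fun _ : Fin (m + 1) => E)
          G).continuous.comp_aestronglyMeasurable (hmeas (m + 1) hm x))
      · filter_upwards [hC] with s hs x _
        rw [ContinuousMultilinearMap.curryLeft_norm]
        exact hs (m + 1) hm x
      · filter_upwards [hF] with s hs x _
        exact (hs.ftaylorSeries).fderiv m (by exact_mod_cast hm) x
    · have hm : m ≤ n := by exact_mod_cast hm
      refine continuous_of_dominated (bound := fun _ => C) (hmeas m hm)
        (fun x => hC.mono fun s h => h m hm x) (integrable_const _) ?_
      filter_upwards [hF] with s hs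
      exact hs.continuous_iteratedFDeriv (by exact_mod_cast hm)
  refine ⟨hT.contDiff, fun i hi x => ?_⟩
  exact (hT.eq_iteratedFDeriv (by exact_mod_cast hi) x).symm

/-- The Cauchy estimate for the derivative, on a ball. -/
theorem norm_fderiv_le_of_ball {E : Type*} [NormedAddCommGroup E] [NormedSpace ℂ E] {G : E → ℂ}
    {z : E} {R C : ℝ} (hR : 0 < R) (hG : DifferentiableOn ℂ G (Metric.ball z R))
    (hC : ∀ y ∈ Metric.ball z R, ‖G y‖ ≤ C) : ‖fderiv ℂ G z‖ ≤ 2 * C / R := by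
  refine Complex.norm_fderiv_le_div_of_mapsTo_ball hG (fun y hy => ?_) hR
  rw [Metric.mem_closedBall, dist_eq_norm]
  refine (norm_sub_le _ _).trans ?_
  linarith [hC y hy, hC z (Metric.mem_ball_self hR)]

/-- An integral of holomorphic functions of several variables, uniformly bounded, is holomorphic. -/
theorem differentiableOn_integral {d : ℕ} {U : Set (Fin d → ℂ)} (hU : IsOpen U)
    {G : S → (Fin d → ℂ) → ℂ} {C : ℝ} (hG : ∀ᵐ s ∂μ, DifferentiableOn ℂ (G s) U)
    (hmeas : ∀ z ∈ U, AEStronglyMeasurable (fun s => G s z) μ)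
    (hC : ∀ᵐ s ∂μ, ∀ z ∈ U, ‖G s z‖ ≤ C) :
    DifferentiableOn ℂ (fun z => ∫ s, G s z ∂μ) U := by
  intro z hz
  obtain ⟨R, hR, hball⟩ := Metric.isOpen_iff.1 hU z hz
  have hev : ∀ᶠ y in 𝓝 z, y ∈ U := hU.mem_nhds hz
  have hhalf : ∀ y ∈ Metric.ball z (R / 2), Metric.ball y (R / 2) ⊆ U := fun y hy =>
    (Metric.ball_subset_ball' (by linarith [Metric.mem_ball.1 hy])).trans hball
  refine (hasFDerivAt_integral_of_dominated_of_fderiv_le (𝕜 := ℂ)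
    (bound := fun _ => 2 * C / (R / 2)) (s := Metric.ball z (R / 2)) (F := fun z s => G s z)
    (F' := fun z s => fderiv ℂ (G s) z) (Metric.ball_mem_nhds _ (by positivity))
    (hev.mono fun y hy => hmeas y hy)
    (Integrable.of_bound (hmeas z hz) C (hC.mono fun s h => h z hz)) ?_ ?_
    (integrable_const _) ?_).differentiableAt.differentiableWithinAt
  · -- the derivative is measurable in the parameter, as a limit of difference quotients
    have hcoord : ∀ v : Fin d → ℂ, AEStronglyMeasurable (fun s => fderiv ℂ (G s) z v) μ := by
      intro v
      have hlim : Tendsto (fun n : ℕ => ((n : ℂ) + 1)⁻¹) atTop (𝓝 0) := by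
        simpa using tendsto_one_div_add_atTop_nhds_zero_nat (𝕜 := ℂ)
      have hline : Tendsto (fun n : ℕ => z + ((n : ℂ) + 1)⁻¹ • v) atTop (𝓝 z) := by
        simpa using tendsto_const_nhds.add (hlim.smul_const v)
      obtain ⟨n₀, hn₀⟩ := eventually_atTop.1 (hline.eventually hev)
      refine aestronglyMeasurable_of_tendsto_ae atTop
        (f := fun n s => ((n + n₀ : ℕ) + 1 : ℂ) * (G s (z + (((n + n₀ : ℕ) : ℂ) + 1)⁻¹ • v) - G s z))
        (fun n => ?_) ?_
      · exact ((hmeas _ (hn₀ _ (Nat.le_add_left _ _))).sub (hmeas z hz)).const_mul _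
      · filter_upwards [hG] with s hs
        have hd : HasFDerivAt (G s) (fderiv ℂ (G s) z) z :=
          ((hs z hz).differentiableAt (hU.mem_nhds hz)).hasFDerivAt
        have h1 := hd.hasLineDerivAt v
        have h2 := h1.tendsto_slope_zero
        have hne : Tendsto (fun n : ℕ => (((n + n₀ : ℕ) : ℂ) + 1)⁻¹) atTop (𝓝[≠] 0) := by
          refine tendsto_nhdsWithin_iff.2 ⟨hlim.comp (tendsto_add_atTop_nat n₀),
            Eventually.of_forall fun n => inv_ne_zero (Nat.cast_add_one_ne_zero _)⟩
        have h3 := h2.comp hne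
        refine h3.congr fun n => ?_
        simp
    have hexp : ∀ s, fderiv ℂ (G s) z = ∑ i : Fin d,
        (ContinuousLinearMap.proj (R := ℂ) (φ := fun _ : Fin d => ℂ) i).smulRight
          (fderiv ℂ (G s) z fun j => if i = j then 1 else 0) := by
      intro s
      refine ContinuousLinearMap.ext fun v => ?_
      rw [← ContinuousLinearMap.coe_coe, LinearMap.pi_apply_eq_sum_univ, ContinuousLinearMap.coe_coe,
        _root_.sum_apply]
      rfl
    rw [funext hexp]
    refine Finset.aestronglyMeasurable_fun_sum _ fun i _ => ?_
    exact ((ContinuousLinearMap.smulRightL ℂ (Fin d → ℂ) ℂ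
      (ContinuousLinearMap.proj (R := ℂ) (φ := fun _ : Fin d => ℂ) i)).continuous
      ).comp_aestronglyMeasurable (hcoord _)
  · filter_upwards [hG, hC] with s h1 h2 y hy
    exact norm_fderiv_le_of_ball (by positivity) (h1.mono (hhalf y hy))
      fun x hx => h2 x (hhalf y hy hx)
  · filter_upwards [hG] with s h1 y hy
    have hyU := hhalf y hy (Metric.mem_ball_self (by positivity))
    exact ((h1 y hyU).differentiableAt (hU.mem_nhds hyU)).hasFDerivAt

end ParametricIntegral

/-! ### Small divisors -/

theorem expi_add (s t : ℝ) : expi (s + t) = expi s * expi t := by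
  simp only [expi, Complex.ofReal_add, mul_add, Complex.exp_add]

@[simp]
theorem expi_zero : expi 0 = 1 := by simp [expi]

theorem expi_intCast (l : ℤ) : expi l = 1 := by
  rw [expi, Complex.exp_eq_one_iff]
  exact ⟨l, by push_cast; ring⟩

theorem norm_expi (t : ℝ) : ‖expi t‖ = 1 := by
  have : (2 * Real.pi * Complex.I * (t : ℂ)) = ((2 * Real.pi * t : ℝ) : ℂ) * Complex.I := by
    push_cast; ring
  rw [expi, this, Complex.norm_exp_ofReal_mul_I]

theorem continuous_expi : Continuous expi := by
  unfold expi
  fun_prop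

theorem intVec_zero {d : ℕ} : intVec (0 : Fin d → ℤ) = 0 := by
  funext i; simp [intVec]

theorem intVec_sub {d : ℕ} (k l : Fin d → ℤ) : intVec (k - l) = intVec k - intVec l := by
  funext i; simp [intVec]

/-- The distance of `t` to the nearest integer controls `e^{2πit} - 1`. -/
theorem abs_sub_round_le_norm_expi_sub_one (t : ℝ) : |t - round t| ≤ ‖expi t - 1‖ := by
  set r := t - round t with hr
  have hr2 : |r| ≤ 1 / 2 := abs_sub_round t
  have h1 : expi t = expi r := by
    have : t = r + ((round t : ℤ) : ℝ) := by rw [hr]; ring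
    rw [this, expi_add, expi_intCast, mul_one]
  have h2 : expi r = Complex.exp (Complex.I * ((2 * Real.pi * r : ℝ) : ℂ)) := by
    rw [expi]; congr 1; push_cast; ring
  rw [h1, h2, Complex.norm_exp_I_mul_ofReal_sub_one, norm_mul, Real.norm_eq_abs, Real.norm_eq_abs]
  have h3 : 2 * Real.pi * r / 2 = Real.pi * r := by ring
  rw [h3]
  have h4 : |Real.pi * r| ≤ Real.pi / 2 := by
    rw [abs_mul, abs_of_pos Real.pi_pos]
    nlinarith [Real.pi_pos]
  have h5 := Real.mul_abs_le_abs_sin h4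
  rw [abs_mul, abs_of_pos Real.pi_pos] at h5
  have h6 : 2 / Real.pi * (Real.pi * |r|) = 2 * |r| := by field_simp
  rw [h6] at h5
  rw [abs_two]
  linarith [abs_nonneg r]

theorem one_le_norm_of_ne_zero {s : ℕ} {k : Fin s → ℤ} (hk : k ≠ 0) : 1 ≤ ‖k‖ := by
  obtain ⟨i, hi⟩ := Function.ne_iff.1 hk
  refine le_trans ?_ (norm_le_pi_norm k i)
  rw [Int.norm_eq_abs]
  exact_mod_cast Int.one_le_abs hi

section SmallDivisors

variable {s : ℕ} {ω : Fin s → ℝ} {ν τ : ℝ}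

/-- The Diophantine exponent is nonnegative: the quantities `|k·ω - l|`, with `l` the nearest integer,
are at most `1 / 2`, while `‖k‖` is unbounded. -/
theorem IsDiophantine.exponent_nonneg (h : IsDiophantine ν τ ω) (hν : 0 < ν) (hs : s ≠ 0) :
    0 ≤ τ := by
  by_contra hτ
  push Not at hτ
  have : NeZero s := ⟨hs⟩
  set k : Fin s → ℤ := fun _ => 1 with hk
  have hlim : Tendsto (fun n : ℕ => ν * (n : ℝ) ^ (-τ)) atTop atTop :=
    ((tendsto_rpow_atTop (by linarith)).comp tendsto_natCast_atTop_atTop).const_mul_atTop hν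
  obtain ⟨n, hn, hn0⟩ := ((hlim.eventually_gt_atTop 1).and (eventually_gt_atTop 0)).exists
  have hne : (fun _ : Fin s => (n : ℤ)) ≠ 0 := fun h => by
    have := congrFun h 0
    simp at this
    omega
  have h1 := h _ hne (round (intVec (fun _ : Fin s => (n : ℤ)) ⬝ᵥ ω))
  have h2 := abs_sub_round (intVec (fun _ : Fin s => (n : ℤ)) ⬝ᵥ ω)
  have h3 : ‖(fun _ : Fin s => (n : ℤ))‖ = n := by
    rw [pi_norm_const]; simp
  rw [h3] at h1
  linarith

theorem IsDiophantine.expi_ne_one (h : IsDiophantine ν τ ω) (hν : 0 < ν) {k : Fin s → ℤ}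
    (hk : k ≠ 0) : expi (intVec k ⬝ᵥ ω) - 1 ≠ 0 := by
  intro h0
  have h1 := abs_sub_round_le_norm_expi_sub_one (intVec k ⬝ᵥ ω)
  rw [h0, norm_zero] at h1
  have h2 := h k hk (round (intVec k ⬝ᵥ ω))
  have h3 : 0 < ‖k‖ := by linarith [one_le_norm_of_ne_zero hk]
  have := Real.rpow_pos_of_pos h3 (-τ)
  nlinarith

/-- A sharp summability estimate for small divisors: for every `c > τ`,
`∑_k ‖k‖^{-c} / |e^{2πi k·ω} - 1| < ∞`. Estimating each small divisor by its lower bound would need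
`c > τ + s`. The distances of the numbers `k·ω` with `‖k‖ < 2^{j+1}` to the integers are spaced by
`δ = ν 2^{-(j+2)τ}`, so that `k` is determined by `j` and by the position of `k·ω` modulo one in a
grid of mesh `δ`; hence the sum over `k` is at most a product of a geometric series
in `j` and a `p`-series in the position. -/
theorem IsDiophantine.summable_inv (h : IsDiophantine ν τ ω) (hν : 0 < ν) {c : ℕ} (hc : τ < c) :
    Summable fun k : Fin s → ℤ => (‖k‖ ^ c)⁻¹ * ‖expi (intVec k ⬝ᵥ ω) - 1‖⁻¹ := by
  rcases Nat.eq_zero_or_pos s with rfl | hs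
  · exact (hasSum_fintype _).summable
  have hτ := h.exponent_nonneg hν hs.ne'
  have hc0 : 0 < (c : ℝ) := hτ.trans_lt hc
  -- the exponent `σ > 1` of the `p`-series
  obtain ⟨σ, hσ1, hσ⟩ : ∃ σ : ℝ, 1 < σ ∧ τ * σ < c := by
    have hp : 0 < ((c : ℝ) - τ) / (τ + 1) := div_pos (by linarith) (by linarith)
    refine ⟨1 + ((c : ℝ) - τ) / (τ + 1), by linarith, ?_⟩
    have : τ * (((c : ℝ) - τ) / (τ + 1)) < c - τ := by
      rw [← mul_div_assoc, div_lt_iff₀ (by linarith)]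
      nlinarith
    linarith
  set t : (Fin s → ℤ) → ℝ := fun k => intVec k ⬝ᵥ ω - round (intVec k ⬝ᵥ ω) with ht
  set J : (Fin s → ℤ) → ℕ := fun k => Nat.log 2 ⌊‖k‖⌋₊ with hJ
  set δ : ℕ → ℝ := fun j => ν * ((2 : ℝ) ^ (j + 2)) ^ (-τ) with hδ
  have hδ0 : ∀ j, 0 < δ j := fun j => mul_pos hν (Real.rpow_pos_of_pos (by positivity) _)
  have hJle : ∀ k : Fin s → ℤ, k ≠ 0 → (2 : ℝ) ^ J k ≤ ‖k‖ := by
    intro k hk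
    have h1 : ⌊‖k‖⌋₊ ≠ 0 := (Nat.floor_pos.2 (one_le_norm_of_ne_zero hk)).ne'
    have h2 := Nat.pow_log_le_self 2 h1
    exact le_trans (by exact_mod_cast h2) (Nat.floor_le (norm_nonneg k))
  have hJlt : ∀ k : Fin s → ℤ, ‖k‖ < (2 : ℝ) ^ (J k + 1) := by
    intro k
    have h1 : ⌊‖k‖⌋₊ + 1 ≤ 2 ^ (J k + 1) := Nat.lt_pow_succ_log_self one_lt_two _
    exact (Nat.lt_floor_add_one _).trans_le (by exact_mod_cast h1)
  -- the spacing
  have hsep : ∀ (k : Fin s → ℤ) (j : ℕ), k ≠ 0 → ‖k‖ ≤ (2 : ℝ) ^ (j + 2) → ∀ l : ℤ,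
      δ j ≤ |intVec k ⬝ᵥ ω - l| := by
    intro k j hk hkj l
    refine le_trans ?_ (h k hk l)
    refine mul_le_mul_of_nonneg_left ?_ hν.le
    exact Real.rpow_le_rpow_of_nonpos (by linarith [one_le_norm_of_ne_zero hk]) hkj (by linarith)
  have hle2 : ∀ j : ℕ, (2 : ℝ) ^ (j + 1) ≤ 2 ^ (j + 2) := fun j =>
    pow_le_pow_right₀ one_le_two (by omega)
  have htge : ∀ k : Fin s → ℤ, k ≠ 0 → δ (J k) ≤ |t k| := fun k hk =>
    hsep k (J k) hk ((hJlt k).le.trans (hle2 _)) _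
  set m : (Fin s → ℤ) → ℤ := fun k => ⌊t k / δ (J k)⌋ with hm
  have hinj : Function.Injective
      (fun k : {k : Fin s → ℤ // k ≠ 0} => (J k.1, m k.1)) := by
    rintro ⟨k, hk⟩ ⟨k', hk'⟩ hkk'
    simp only [Prod.mk.injEq] at hkk'
    obtain ⟨h1, h2⟩ := hkk'
    by_contra hne
    have hne' : k - k' ≠ 0 := fun h0 => hne (Subtype.ext (sub_eq_zero.1 h0))
    have h3 : |t k - t k'| < δ (J k) := by
      have h4 : m k = ⌊t k' / δ (J k)⌋ := by rw [h2, h1]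
      have h5 := Int.abs_sub_lt_one_of_floor_eq_floor h4
      rwa [← sub_div, abs_div, abs_of_pos (hδ0 _), div_lt_one (hδ0 _)] at h5
    have h6 : ‖k - k'‖ ≤ (2 : ℝ) ^ (J k + 2) := by
      have h7 := hJlt k'
      rw [← h1] at h7
      calc ‖k - k'‖ ≤ ‖k‖ + ‖k'‖ := norm_sub_le _ _
        _ ≤ 2 ^ (J k + 1) + 2 ^ (J k + 1) := add_le_add (hJlt k).le h7.le
        _ = 2 ^ (J k + 2) := by ring
    have h8 := hsep (k - k') (J k) hne' h6 (round (intVec k ⬝ᵥ ω) - round (intVec k' ⬝ᵥ ω))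
    have h9 : intVec (k - k') ⬝ᵥ ω -
        ((round (intVec k ⬝ᵥ ω) - round (intVec k' ⬝ᵥ ω) : ℤ) : ℝ) = t k - t k' := by
      rw [intVec_sub, sub_dotProduct]
      push_cast
      simp only [ht]; ring
    rw [h9] at h8
    linarith
  -- the majorant
  set q : ℝ := 2 ^ (τ * σ - c) with hq
  have hq0 : 0 ≤ q := by positivity
  have hq1 : q < 1 := Real.rpow_lt_one_of_one_lt_of_neg one_lt_two (by linarith)
  set B : ℝ := 2 * (ν ^ (-σ) * (4 : ℝ) ^ (τ * σ)) with hB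
  have hF : Summable fun p : ℕ × ℤ => (B * q ^ p.1) * |(p.2 : ℝ)| ^ (-σ) := by
    refine Summable.mul_of_nonneg (f := fun j : ℕ => B * q ^ j) (g := fun m : ℤ => |(m : ℝ)| ^ (-σ))
      ((summable_geometric_of_lt_one hq0 hq1).mul_left B) ?_ ?_ ?_
    · exact Real.summable_abs_int_rpow hσ1
    · intro j; positivity
    · intro j; positivity
  have hsub : Summable fun k : {k : Fin s → ℤ // k ≠ 0} =>
      (‖k.1‖ ^ c)⁻¹ * ‖expi (intVec k.1 ⬝ᵥ ω) - 1‖⁻¹ := by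
    refine Summable.of_nonneg_of_le (fun k => by positivity) ?_ (hF.comp_injective hinj)
    rintro ⟨k, hk⟩
    simp only [Function.comp_apply]
    set j := J k with hj
    have ht0 : 0 < |t k| := (hδ0 j).trans_le (htge k hk)
    have hmne : m k ≠ 0 := by
      intro h0
      have h1 := Int.floor_eq_zero_iff.1 h0
      have h2 : |t k / δ j| < 1 := by
        rw [abs_of_nonneg h1.1]; exact h1.2
      rw [abs_div, abs_of_pos (hδ0 _), div_lt_one (hδ0 _)] at h2
      exact absurd (htge k hk) (not_le.2 h2)
    have hm1 : (1 : ℝ) ≤ |(m k : ℝ)| := by exact_mod_cast Int.one_le_abs hmne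
    have hmle : |(m k : ℝ)| ≤ 2 * |t k| / δ j := by
      have h1 : |(m k : ℝ)| ≤ |t k / δ j| + 1 := by
        have h2 := Int.floor_le (t k / δ j)
        have h3 := Int.lt_floor_add_one (t k / δ j)
        rw [abs_le]
        constructor
        · linarith [neg_abs_le (t k / δ j)]
        · linarith [le_abs_self (t k / δ j)]
      rw [abs_div, abs_of_pos (hδ0 _)] at h1
      have h4 : 1 ≤ |t k| / δ j := (one_le_div (hδ0 j)).2 (htge k hk)
      rw [mul_div_assoc]; linarith
    have hmle' : |(m k : ℝ)| ≤ (δ j)⁻¹ := by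
      refine hmle.trans ?_
      rw [inv_eq_one_div]
      refine div_le_div_of_nonneg_right ?_ (hδ0 j).le
      have := abs_sub_round (intVec k ⬝ᵥ ω)
      simp only [ht]; linarith
    -- `1 / |t k| ≤ 2 δ^{-σ} |m|^{-σ}`
    have h1 : |t k|⁻¹ ≤ 2 * (δ j ^ (-σ) * |(m k : ℝ)| ^ (-σ)) := by
      have h2 : |(m k : ℝ)| ^ (-σ) = |(m k : ℝ)|⁻¹ * |(m k : ℝ)| ^ (-(σ - 1)) := by
        rw [← Real.rpow_neg_one, ← Real.rpow_add (by linarith)]; congr 1; ring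
      have h3 : δ j ^ (-σ) = (δ j)⁻¹ * (δ j) ^ (-(σ - 1)) := by
        rw [← Real.rpow_neg_one, ← Real.rpow_add (hδ0 j)]; congr 1; ring
      have h4 : 1 ≤ (δ j) ^ (-(σ - 1)) * |(m k : ℝ)| ^ (-(σ - 1)) := by
        rw [← Real.mul_rpow (hδ0 j).le (abs_nonneg _)]
        refine Real.one_le_rpow_of_pos_of_le_one_of_nonpos
          (mul_pos (hδ0 j) (by linarith)) ?_ (by linarith)
        calc δ j * |(m k : ℝ)| ≤ δ j * (δ j)⁻¹ := mul_le_mul_of_nonneg_left hmle' (hδ0 j).le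
          _ = 1 := mul_inv_cancel₀ (hδ0 j).ne'
      have h5 : |t k|⁻¹ ≤ 2 * ((δ j)⁻¹ * |(m k : ℝ)|⁻¹) := by
        rw [← mul_inv, inv_eq_one_div, inv_eq_one_div, ← mul_div_assoc, mul_one,
          div_le_div_iff₀ ht0 (mul_pos (hδ0 j) (by linarith)), one_mul]
        have := (le_div_iff₀ (hδ0 j)).1 hmle
        linarith
      calc |t k|⁻¹ ≤ 2 * ((δ j)⁻¹ * |(m k : ℝ)|⁻¹) * 1 := by rw [mul_one]; exact h5
        _ ≤ 2 * ((δ j)⁻¹ * |(m k : ℝ)|⁻¹) *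
            ((δ j) ^ (-(σ - 1)) * |(m k : ℝ)| ^ (-(σ - 1))) := by
          refine mul_le_mul_of_nonneg_left h4 ?_
          have := hδ0 j
          positivity
        _ = _ := by rw [h2, h3]; ring
    have h6 : ‖expi (intVec k ⬝ᵥ ω) - 1‖⁻¹ ≤ |t k|⁻¹ :=
      inv_anti₀ ht0 (abs_sub_round_le_norm_expi_sub_one _)
    have h7 : (‖k‖ ^ c)⁻¹ ≤ (((2 : ℝ) ^ j) ^ c)⁻¹ :=
      inv_anti₀ (by positivity) (pow_le_pow_left₀ (by positivity) (hJle k hk) c)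
    have h8 : δ j ^ (-σ) = ν ^ (-σ) * (4 : ℝ) ^ (τ * σ) * ((2 : ℝ) ^ (τ * σ)) ^ j := by
      simp only [hδ]
      rw [Real.mul_rpow hν.le (by positivity), ← Real.rpow_mul (by positivity), neg_mul_neg,
        pow_add, Real.mul_rpow (by positivity) (by positivity), ← Real.rpow_natCast 2 j,
        ← Real.rpow_mul (by norm_num), mul_comm (j : ℝ), Real.rpow_mul (by norm_num),
        Real.rpow_natCast]
      norm_num
      ring
    have h9 : q ^ j = ((2 : ℝ) ^ (τ * σ)) ^ j * (((2 : ℝ) ^ j) ^ c)⁻¹ := by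
      rw [hq, Real.rpow_sub (by norm_num), Real.rpow_natCast, div_pow, div_eq_mul_inv, ← pow_mul,
        ← pow_mul, mul_comm c j]
    calc (‖k‖ ^ c)⁻¹ * ‖expi (intVec k ⬝ᵥ ω) - 1‖⁻¹
        ≤ (((2 : ℝ) ^ j) ^ c)⁻¹ * (2 * (δ j ^ (-σ) * |(m k : ℝ)| ^ (-σ))) :=
          mul_le_mul h7 (h6.trans h1) (by positivity) (by positivity)
      _ = B * q ^ j * |(m k : ℝ)| ^ (-σ) := by rw [h8, h9, hB]; ring
  rw [← Function.Injective.summable_iff (g := fun k : {k : Fin s → ℤ // k ≠ 0} => k.1)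
    Subtype.val_injective]
  · exact hsub
  · intro k hk
    have : k = 0 := by
      by_contra h0
      exact hk ⟨⟨k, h0⟩, rfl⟩
    simp [this, intVec_zero]

end SmallDivisors

/-! ### Fourier series on tori -/

section FourierSeries

theorem isPeriodic_coe_eq_iff {d : ℕ} {x y : Fin d → ℝ}
    (h : (fun i => (x i : UnitAddCircle)) = fun i => (y i : UnitAddCircle)) :
    ∃ k : Fin d → ℤ, x = y + intVec k := by
  have h1 : ∀ i, ∃ k : ℤ, x i = y i + k := by
    intro i
    have h2 := congrFun h i
    rw [eq_comm, QuotientAddGroup.eq] at h2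
    obtain ⟨k, hk⟩ := AddSubgroup.mem_zmultiples_iff.1 h2
    refine ⟨k, ?_⟩
    simp at hk
    linarith
  choose k hk using h1
  exact ⟨k, funext hk⟩

theorem exists_continuousMap_torus {d : ℕ} {φ : (Fin d → ℝ) → ℂ} (hφ : Continuous φ)
    (hper : ∀ x (k : Fin d → ℤ), φ (x + intVec k) = φ x) :
    ∃ Φ : C(UnitAddTorus (Fin d), ℂ), ∀ x : Fin d → ℝ, Φ (fun i => (x i : UnitAddCircle)) = φ x := by
  have hq : IsOpenQuotientMap
      (Pi.map fun (_ : Fin d) (t : ℝ) => (t : UnitAddCircle)) :=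
    IsOpenQuotientMap.piMap fun _ => QuotientAddGroup.isOpenQuotientMap_mk
  have hlift : ∀ x : Fin d → ℝ, φ (Function.surjInv hq.surjective (fun i => (x i : UnitAddCircle)))
      = φ x := by
    intro x
    obtain ⟨k, hk⟩ := isPeriodic_coe_eq_iff
      (Function.surjInv_eq hq.surjective (fun i => (x i : UnitAddCircle)))
    rw [hk, hper]
  refine ⟨⟨fun u => φ (Function.surjInv hq.surjective u), ?_⟩, hlift⟩
  rw [hq.isQuotientMap.continuous_iff]
  exact hφ.congr fun x => (hlift x).symm

theorem mFourier_coe {d : ℕ} (k : Fin d → ℤ) (x : Fin d → ℝ) :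
    UnitAddTorus.mFourier k (fun i => (x i : UnitAddCircle)) = expi (intVec k ⬝ᵥ x) := by
  simp only [UnitAddTorus.mFourier, ContinuousMap.coe_mk, fourier_coe_apply, ← Complex.exp_sum, expi,
    dotProduct, intVec]
  congr 1
  push_cast
  rw [Finset.mul_sum]
  exact Finset.sum_congr rfl fun i _ => by ring

theorem Icc_ae_eq_box {d : ℕ} (a : Fin d → ℝ) :
    {x : Fin d → ℝ | ∀ i, x i ∈ Set.Ioc (a i) (a i + 1)} =ᵐ[volume] Set.Icc a (a + 1) := by
  have h := Measure.univ_pi_Ioc_ae_eq_Icc (μ := fun _ : Fin d => (volume : Measure ℝ)) (f := a)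
    (g := a + 1)
  have h2 : {x : Fin d → ℝ | ∀ i, x i ∈ Set.Ioc (a i) (a i + 1)} =
      Set.univ.pi fun i => Set.Ioc (a i) ((a + 1) i) := by
    ext x; simp
  rw [h2]
  exact h

theorem mFourierCoeff_eq_setIntegral {d : ℕ} (Φ : C(UnitAddTorus (Fin d), ℂ)) (k : Fin d → ℤ)
    (a : Fin d → ℝ) : UnitAddTorus.mFourierCoeff Φ k =
      ∫ x in Set.Icc a (a + 1), Φ (fun i => (x i : UnitAddCircle)) * expi (-(intVec k ⬝ᵥ x)) := by
  rw [UnitAddTorus.mFourierCoeff_eq_integral _ _ a, setIntegral_congr_set (Icc_ae_eq_box a)]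
  refine integral_congr_ae (Eventually.of_forall fun x => ?_)
  have h : intVec (-k) ⬝ᵥ x = -(intVec k ⬝ᵥ x) := by
    rw [← neg_dotProduct]; congr 1; funext i; simp [intVec]
  simp only [mFourier_coe, h, smul_eq_mul, mul_comm]

/-- The integral of a periodic function over a cell does not depend on the cell. -/
theorem setIntegral_Icc_comp_add {d : ℕ} {φ : (Fin d → ℝ) → ℂ} (hφ : Continuous φ)
    (hper : ∀ x (k : Fin d → ℤ), φ (x + intVec k) = φ x) (a : Fin d → ℝ) :
    ∫ s in Set.Icc (0 : Fin d → ℝ) 1, φ (s + a) = ∫ s in Set.Icc (0 : Fin d → ℝ) 1, φ s := by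
  obtain ⟨Φ, hΦ⟩ := exists_continuousMap_torus hφ hper
  have h0 := mFourierCoeff_eq_setIntegral Φ 0 0
  have h1 := mFourierCoeff_eq_setIntegral Φ 0 a
  rw [h0] at h1
  simp only [hΦ, intVec_zero, zero_dotProduct, neg_zero, expi_zero, mul_one, zero_add] at h1
  rw [h1]
  have h2 := (measurePreserving_add_right (volume : Measure (Fin d → ℝ)) a).setIntegral_preimage_emb
    (measurableEmbedding_addRight a) φ (Set.Icc a (a + 1))
  rw [← h2]
  congr 2
  simp [add_comm a]

/-- A continuous periodic function with summable Fourier coefficients is the sum of its Fourier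
series. -/
theorem hasSum_fourier {d : ℕ} {φ : (Fin d → ℝ) → ℂ} (hφ : Continuous φ)
    (hper : ∀ x (k : Fin d → ℤ), φ (x + intVec k) = φ x)
    (hs : Summable fun k : Fin d → ℤ =>
      ∫ s in Set.Icc (0 : Fin d → ℝ) 1, φ s * expi (-(intVec k ⬝ᵥ s))) (x : Fin d → ℝ) :
    HasSum (fun k : Fin d → ℤ => (∫ s in Set.Icc (0 : Fin d → ℝ) 1, φ s * expi (-(intVec k ⬝ᵥ s))) *
      expi (intVec k ⬝ᵥ x)) (φ x) := by
  obtain ⟨Φ, hΦ⟩ := exists_continuousMap_torus hφ hper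
  have h0 := fun k => mFourierCoeff_eq_setIntegral Φ k 0
  simp only [hΦ, zero_add] at h0
  have h1 := UnitAddTorus.hasSum_mFourier_series_apply_of_summable (f := Φ)
    (hs.congr fun k => (h0 k).symm) (fun i => (x i : UnitAddCircle))
  simpa only [h0, mFourier_coe, smul_eq_mul, hΦ] using h1

theorem fourierCoeffOn_zero_one (b : ℝ → ℂ) (l : ℤ) :
    fourierCoeffOn (zero_lt_one' ℝ) b l = ∫ t in Set.Icc (0 : ℝ) 1, b t * expi (-(l * t)) := by
  rw [fourierCoeffOn_eq_integral, intervalIntegral.integral_of_le zero_le_one,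
    integral_Icc_eq_integral_Ioc]
  simp only [sub_zero, div_one, one_smul]
  refine integral_congr_ae (Eventually.of_forall fun t => ?_)
  simp only [fourier_coe_apply, expi, smul_eq_mul]
  rw [mul_comm]
  congr 2
  push_cast
  simp
  ring

/-- The Fourier coefficients of a `C¹` function on the circle are absolutely summable: those of
the derivative are square summable. -/
theorem summable_fourier_circle {b b' : ℝ → ℂ} (hb : ∀ t, HasDerivAt b (b' t) t)
    (hb' : Continuous b') (hper : ∀ t, b (t + 1) = b t) {M : ℝ} (hM : 0 < M)
    (h0 : ∀ t, ‖b t‖ ≤ M) (h1 : ∀ t, ‖b' t‖ ≤ M) :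
    (Summable fun l : ℤ => ‖∫ t in Set.Icc (0 : ℝ) 1, b t * expi (-(l * t))‖) ∧
      ∑' l : ℤ, ‖∫ t in Set.Icc (0 : ℝ) 1, b t * expi (-(l * t))‖ ≤
        (2 + ∑' l : ℤ, ((l : ℝ) ^ 2)⁻¹) * M := by
  simp only [← fourierCoeffOn_zero_one]
  have hL2 : MemLp b' 2 (volume.restrict (Set.Ioc (0 : ℝ) 1)) :=
    MemLp.of_bound hb'.aestronglyMeasurable M (Eventually.of_forall h1)
  have hsq := hasSum_sq_fourierCoeffOn (zero_lt_one' ℝ) hL2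
  have hsqM : ∑' l, ‖fourierCoeffOn (zero_lt_one' ℝ) b' l‖ ^ 2 ≤ M ^ 2 := by
    rw [hsq.tsum_eq]
    simp only [sub_zero, inv_one, one_smul]
    have h2 : ∀ t ∈ Set.uIoc (0 : ℝ) 1, ‖(‖b' t‖ ^ 2 : ℝ)‖ ≤ M ^ 2 := by
      intro t _
      rw [Real.norm_of_nonneg (by positivity)]
      exact pow_le_pow_left₀ (norm_nonneg _) (h1 t) 2
    have h3 := intervalIntegral.norm_integral_le_of_norm_le_const h2
    simpa using (le_abs_self _).trans h3
  have hpi : Summable fun l : ℤ => ((l : ℝ) ^ 2)⁻¹ := by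
    simpa using Real.summable_one_div_int_pow.2 one_lt_two
  have hzero : ‖fourierCoeffOn (zero_lt_one' ℝ) b 0‖ ≤ M := by
    rw [fourierCoeffOn_zero_one]
    have h3 := norm_setIntegral_le_of_norm_le_const (μ := volume) (s := Set.Icc (0 : ℝ) 1)
      (f := fun t => b t * expi (-((0 : ℤ) * t))) (C := M) (by simp)
      (fun t _ => by rw [norm_mul, norm_expi, mul_one]; exact h0 t)
    simpa using h3
  have hle : ∀ l : ℤ, ‖fourierCoeffOn (zero_lt_one' ℝ) b l‖ ≤
      (if l = 0 then M else 0) + (M * ((l : ℝ) ^ 2)⁻¹ +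
        M⁻¹ * ‖fourierCoeffOn (zero_lt_one' ℝ) b' l‖ ^ 2) := by
    intro l
    by_cases hl : l = 0
    · subst hl
      rw [if_pos rfl]
      have : 0 ≤ M * (((0 : ℤ) : ℝ) ^ 2)⁻¹ + M⁻¹ * ‖fourierCoeffOn (zero_lt_one' ℝ) b' 0‖ ^ 2 := by
        positivity
      linarith
    · rw [if_neg hl, zero_add, fourierCoeffOn_of_hasDerivAt (zero_lt_one' ℝ) hl
        (fun t _ => hb t) (hb'.intervalIntegrable 0 1)]
      have hb01 : b 1 - b 0 = 0 := by rw [← hper 0]; simp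
      rw [hb01, mul_zero, zero_sub, norm_mul]
      set β := ‖fourierCoeffOn (zero_lt_one' ℝ) b' l‖ with hβ
      have hl1 : (1 : ℝ) ≤ |(l : ℝ)| := by exact_mod_cast Int.one_le_abs hl
      have e1 : ‖1 / (-2 * (Real.pi : ℂ) * Complex.I * (l : ℂ))‖ ≤ |(l : ℝ)|⁻¹ := by
        rw [norm_div, norm_mul, norm_mul, norm_mul, norm_one, Complex.norm_I, norm_neg,
          Complex.norm_real, Complex.norm_intCast, one_div, Real.norm_of_nonneg Real.pi_pos.le]
        refine inv_anti₀ (by linarith) ?_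
        have : (1 : ℝ) ≤ ‖(2 : ℂ)‖ * Real.pi * 1 := by
          rw [Complex.norm_ofNat]; linarith [Real.pi_gt_three]
        nlinarith
      have e2 : ‖-(((1 : ℝ) : ℂ) - ((0 : ℝ) : ℂ)) * fourierCoeffOn (zero_lt_one' ℝ) b' l‖ = β := by
        rw [norm_mul]; simp [hβ]
      rw [← neg_mul, e2]
      have e3 : |(l : ℝ)|⁻¹ * β ≤ M * (|(l : ℝ)|⁻¹) ^ 2 + M⁻¹ * β ^ 2 := by
        have e4 : M * (|(l : ℝ)|⁻¹) ^ 2 + M⁻¹ * β ^ 2 - |(l : ℝ)|⁻¹ * β =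
            M⁻¹ * ((M * |(l : ℝ)|⁻¹ - β / 2) ^ 2 + 3 / 4 * β ^ 2) := by
          field_simp
          ring
        have : 0 ≤ M⁻¹ * ((M * |(l : ℝ)|⁻¹ - β / 2) ^ 2 + 3 / 4 * β ^ 2) := by positivity
        linarith
      refine (mul_le_mul_of_nonneg_right e1 (norm_nonneg _)).trans (e3.trans (le_of_eq ?_))
      rw [inv_pow, sq_abs]
  have hsum : HasSum (fun l : ℤ => (if l = 0 then M else 0) + (M * ((l : ℝ) ^ 2)⁻¹ +
      M⁻¹ * ‖fourierCoeffOn (zero_lt_one' ℝ) b' l‖ ^ 2))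
      (M + (M * ∑' l : ℤ, ((l : ℝ) ^ 2)⁻¹ +
        M⁻¹ * ∑' l, ‖fourierCoeffOn (zero_lt_one' ℝ) b' l‖ ^ 2)) :=
    (hasSum_ite_eq 0 M).add ((hpi.hasSum.mul_left M).add (hsq.summable.hasSum.mul_left M⁻¹))
  have hs := Summable.of_nonneg_of_le (fun _ => norm_nonneg _) hle hsum.summable
  refine ⟨hs, (hs.tsum_le_tsum hle hsum.summable).trans ?_⟩
  rw [hsum.tsum_eq]
  have : M⁻¹ * ∑' l, ‖fourierCoeffOn (zero_lt_one' ℝ) b' l‖ ^ 2 ≤ M := by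
    calc _ ≤ M⁻¹ * M ^ 2 := mul_le_mul_of_nonneg_left hsqM (by positivity)
      _ = M := by field_simp
  linarith

theorem hasSum_fourier_circle {b : ℝ → ℂ} (hb : Continuous b) (hper : ∀ t, b (t + 1) = b t)
    (hs : Summable fun l : ℤ => ∫ t in Set.Icc (0 : ℝ) 1, b t * expi (-(l * t))) (t : ℝ) :
    HasSum (fun l : ℤ => (∫ t in Set.Icc (0 : ℝ) 1, b t * expi (-(l * t))) * expi (l * t))
      (b t) := by
  have hfun : ∀ (k : Fin 1 → ℤ) (x : Fin 1 → ℝ), intVec k ⬝ᵥ x = k 0 * x 0 := by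
    intro k x; simp [dotProduct, intVec]
  have hint : ∀ l : ℤ, ∫ s in Set.Icc (0 : Fin 1 → ℝ) 1, b (s 0) * expi (-(l * s 0)) =
      ∫ t in Set.Icc (0 : ℝ) 1, b t * expi (-(l * t)) := by
    intro l
    have h1 := (volume_preserving_funUnique (Fin 1) ℝ).setIntegral_preimage_emb
      (MeasurableEquiv.measurableEmbedding _) (fun t => b t * expi (-(l * t))) (Set.Icc (0 : ℝ) 1)
    rw [← h1]
    have h2 : (MeasurableEquiv.funUnique (Fin 1) ℝ) ⁻¹' Set.Icc (0 : ℝ) 1 =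
        Set.Icc (0 : Fin 1 → ℝ) 1 := by
      ext x
      simp [Set.mem_Icc, Pi.le_def, MeasurableEquiv.funUnique]
    rw [h2]
    rfl
  have hperZ : ∀ (t : ℝ) (k : ℤ), b (t + k) = b t := by
    intro t k
    have : Function.Periodic b 1 := hper
    simpa using this.int_mul k t
  have hs' : Summable fun k : Fin 1 → ℤ => ∫ t in Set.Icc (0 : ℝ) 1, b t * expi (-(k 0 * t)) :=
    hs.comp_injective (Equiv.funUnique (Fin 1) ℤ).injective
  have h := hasSum_fourier (d := 1) (φ := fun x => b (x 0)) (hb.comp (continuous_apply 0))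
    (fun x k => hperZ _ _) (by simpa only [hfun, hint] using hs') (fun _ => t)
  simp only [hfun, hint] at h
  exact (Equiv.funUnique (Fin 1) ℤ).hasSum_iff.1 h

end FourierSeries

/-! ### Fourier modes in the fast directions -/

section Modes

variable {e : ℕ}

/-- The vector `(s, 0) ∈ ℝ^{d-1} × ℝ`. -/
def fastVec (s : Fin e → ℝ) : Fin (e + 1) → ℝ := Fin.snoc s 0

@[simp]
theorem fastVec_castSucc (s : Fin e → ℝ) (i : Fin e) : fastVec s i.castSucc = s i := by
  simp [fastVec]

@[simp]
theorem fastVec_last (s : Fin e → ℝ) : fastVec s (Fin.last e) = 0 := by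
  simp [fastVec]

theorem fastVec_add (s t : Fin e → ℝ) : fastVec (s + t) = fastVec s + fastVec t := by
  funext i
  refine Fin.lastCases ?_ (fun j => ?_) i <;> simp

theorem fastVec_smul (a : ℝ) (t : Fin e → ℝ) : fastVec (a • t) = a • fastVec t := by
  funext i
  refine Fin.lastCases ?_ (fun j => ?_) i <;> simp

theorem fastVec_intVec (k : Fin e → ℤ) :
    fastVec (intVec k) = intVec (Fin.snoc k 0 : Fin (e + 1) → ℤ) := by
  funext i
  refine Fin.lastCases ?_ (fun j => ?_) i <;> simp [intVec]

theorem continuous_fastVec : Continuous (fastVec : (Fin e → ℝ) → Fin (e + 1) → ℝ) :=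
  continuous_pi fun i => by
    refine Fin.lastCases ?_ (fun j => ?_) i
    · simpa using continuous_const
    · simpa using continuous_apply j

theorem norm_fastVec_single_le (a : Fin e) : ‖fastVec (Pi.single a (1 : ℝ))‖ ≤ 1 := by
  refine (pi_norm_le_iff_of_nonneg zero_le_one).2 fun i => ?_
  refine Fin.lastCases ?_ (fun j => ?_) i
  · simp
  · rw [fastVec_castSucc, Pi.single_apply]
    split_ifs <;> simp

theorem intVec_single_dotProduct (k : Fin e → ℤ) (a : Fin e) (t : ℝ) :
    intVec k ⬝ᵥ (t • Pi.single a (1 : ℝ)) = k a * t := by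
  rw [dotProduct_smul, dotProduct_single]
  simp [intVec, mul_comm]

theorem intVec_snoc_dotProduct (k : Fin e → ℤ) (l : ℤ) (s : Fin e → ℝ) (t : ℝ) :
    intVec (Fin.snoc k l : Fin (e + 1) → ℤ) ⬝ᵥ (Fin.snoc s t : Fin (e + 1) → ℝ) =
      intVec k ⬝ᵥ s + l * t := by
  simp [dotProduct, Fin.sum_univ_castSucc, intVec]

/-- The mode of `g` with wave number `k` in the fast directions (the first `d-1` ones), as a
function on the torus: `(x₁, x₂) ↦ b(x₂) e^{2πi k·x₁}`, where `b(x₂)` is the Fourier coefficient of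
`g (·, x₂)`. -/
noncomputable def fastMode (g : (Fin (e + 1) → ℝ) → ℝ) (k : Fin e → ℤ) (y : Fin (e + 1) → ℝ) : ℂ :=
  ∫ s in Set.Icc (0 : Fin e → ℝ) 1, (g (y + fastVec s) : ℂ) * expi (-(intVec k ⬝ᵥ s))

variable {g : (Fin (e + 1) → ℝ) → ℝ}

theorem fastMode_add_intVec (hper : IsPeriodic g) (k : Fin e → ℤ) (y : Fin (e + 1) → ℝ)
    (l : Fin (e + 1) → ℤ) : fastMode g k (y + intVec l) = fastMode g k y := by
  have h : ∀ x, g (x + intVec l) = g x := fun x => hper x l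
  simp only [fastMode, add_right_comm y (intVec l), h]

theorem expi_neg_mul_self (t : ℝ) : expi t * expi (-t) = 1 := by
  rw [← expi_add, add_neg_cancel, expi_zero]

theorem intVec_dotProduct_intVec {d : ℕ} (k l : Fin d → ℤ) :
    intVec k ⬝ᵥ intVec l = ((∑ i, k i * l i : ℤ) : ℝ) := by
  simp [dotProduct, intVec]

theorem continuous_dotProduct_right {d : ℕ} (v : Fin d → ℝ) : Continuous fun s => v ⬝ᵥ s :=
  continuous_finsetSum _ fun i _ => continuous_const.mul (continuous_apply i)

/-- A mode oscillates with frequency `k` in the fast directions. -/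
theorem fastMode_add_fastVec (hper : IsPeriodic g) (hg : Continuous g) (k : Fin e → ℤ)
    (y : Fin (e + 1) → ℝ) (a : Fin e → ℝ) :
    fastMode g k (y + fastVec a) = expi (intVec k ⬝ᵥ a) * fastMode g k y := by
  have h := setIntegral_Icc_comp_add
    (φ := fun s => (g (y + fastVec s) : ℂ) * expi (-(intVec k ⬝ᵥ s))) ?_ ?_ a
  · rw [fastMode, fastMode, ← h, ← integral_const_mul]
    refine integral_congr_ae (Eventually.of_forall fun s => ?_)
    simp only [fastVec_add, dotProduct_add, neg_add, expi_add]
    rw [mul_left_comm, mul_left_comm (expi _) (expi _) (expi _), expi_neg_mul_self, mul_one,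
      add_assoc, add_comm (fastVec a)]
  · exact (Complex.continuous_ofReal.comp (hg.comp (continuous_const.add continuous_fastVec))).mul
      (continuous_expi.comp (continuous_dotProduct_right _).neg)
  · intro s l
    simp only [fastVec_add, ← add_assoc, fastVec_intVec, hper _ _, dotProduct_add, neg_add, expi_add,
      intVec_dotProduct_intVec, ← Int.cast_neg, expi_intCast, mul_one]

/-- A mode is determined by its restriction to the slow axis. -/
theorem fastMode_eq (hper : IsPeriodic g) (hg : Continuous g) (k : Fin e → ℤ)
    (y : Fin (e + 1) → ℝ) : fastMode g k y =
      expi (intVec k ⬝ᵥ (Fin.init y : Fin e → ℝ)) *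
        fastMode g k (Fin.snoc (0 : Fin e → ℝ) (y (Fin.last e))) := by
  rw [← fastMode_add_fastVec hper hg]
  congr 1
  funext i
  refine Fin.lastCases ?_ (fun j => ?_) i <;> simp [Fin.init]

/-- A derivative of a mode is at most the corresponding derivative of the function. -/
theorem contDiff_fastMode {r : ℕ} {C : ℝ} (hg : ckClass r (e + 1) C g) (k : Fin e → ℤ) :
    ContDiff ℝ r (fastMode g k) ∧ ∀ i ≤ r, ∀ y, ‖iteratedFDeriv ℝ i (fastMode g k) y‖ ≤ C := by
  obtain ⟨-, hg, hC⟩ := hg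
  have hC0 : 0 ≤ C := (norm_nonneg _).trans (hC 0 (Nat.zero_le _) 0)
  have hvol : volume (Set.Icc (0 : Fin e → ℝ) 1) = 1 := by simp [Real.volume_Icc_pi]
  have : IsProbabilityMeasure (volume.restrict (Set.Icc (0 : Fin e → ℝ) 1)) := ⟨by simp [hvol]⟩
  have hiter : ∀ (s : Fin e → ℝ), ∀ i ≤ r, ∀ y,
      iteratedFDeriv ℝ i (fun y => (g (y + fastVec s) : ℂ) * expi (-(intVec k ⬝ᵥ s))) y =
        expi (-(intVec k ⬝ᵥ s)) • Complex.ofRealCLM.compContinuousMultilinearMap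
          (iteratedFDeriv ℝ i g (y + fastVec s)) := by
    intro s i hi y
    have h0 : ContDiffAt ℝ i (fun y => g (y + fastVec s)) y :=
      ((hg.of_le (by exact_mod_cast hi)).comp (contDiff_id.add contDiff_const)).contDiffAt
    have h1 : (fun y => (g (y + fastVec s) : ℂ) * expi (-(intVec k ⬝ᵥ s))) =
        expi (-(intVec k ⬝ᵥ s)) • (Complex.ofRealCLM ∘ fun y => g (y + fastVec s)) := by
      funext y; simp [mul_comm]
    rw [h1, iteratedFDeriv_const_smul_apply (Complex.ofRealCLM.contDiff.contDiffAt.comp y h0),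
      ContinuousLinearMap.iteratedFDeriv_comp_left _ h0 le_rfl, iteratedFDeriv_comp_add_right]
  have hnorm : ∀ (s : Fin e → ℝ), ∀ i ≤ r, ∀ y,
      ‖iteratedFDeriv ℝ i (fun y => (g (y + fastVec s) : ℂ) * expi (-(intVec k ⬝ᵥ s))) y‖ ≤ C := by
    intro s i hi y
    rw [hiter s i hi, norm_smul, norm_expi, one_mul]
    refine (ContinuousLinearMap.norm_compContinuousMultilinearMap_le _ _).trans ?_
    refine (mul_le_mul_of_nonneg_right Complex.ofRealCLM_norm.le (norm_nonneg _)).trans ?_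
    rw [one_mul]
    exact hC i hi _
  have key := contDiff_integral (μ := volume.restrict (Set.Icc (0 : Fin e → ℝ) 1)) (n := r) (C := C)
    (F := fun s y => (g (y + fastVec s) : ℂ) * expi (-(intVec k ⬝ᵥ s)))
    (Eventually.of_forall fun s =>
      (Complex.ofRealCLM.contDiff.comp (hg.comp (contDiff_id.add contDiff_const))).mul contDiff_const)
    (fun i hi y => ?_) (Eventually.of_forall fun s i hi y => hnorm s i hi y)
  · refine ⟨key.1, fun i hi y => ?_⟩
    have h2 := key.2 i hi y
    change iteratedFDeriv ℝ i (fastMode g k) y = _ at h2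
    rw [h2]
    refine (norm_integral_le_of_norm_le_const (Eventually.of_forall fun s => hnorm s i hi y)).trans ?_
    simp
  · simp only [hiter _ i hi]
    refine Continuous.aestronglyMeasurable ?_
    refine (continuous_expi.comp (continuous_dotProduct_right _).neg).smul ?_
    exact (ContinuousLinearMap.compContinuousMultilinearMapL ℝ (fun _ : Fin i => (Fin (e + 1) → ℝ)) ℝ ℂ
      Complex.ofRealCLM).continuous.comp ((hg.continuous_iteratedFDeriv (by exact_mod_cast hi)).comp
        (continuous_const.add continuous_fastVec))

theorem hasDerivAt_expi (c : ℝ) : HasDerivAt (fun t : ℝ => expi (c * t))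
    (2 * Real.pi * Complex.I * c) 0 := by
  have h1 : HasDerivAt (fun t : ℝ => 2 * Real.pi * Complex.I * ((c * t : ℝ) : ℂ))
      (2 * Real.pi * Complex.I * c) 0 := by
    have h2 : HasDerivAt (fun t : ℝ => ((c * t : ℝ) : ℂ)) (c : ℂ) 0 := by
      simpa using ((hasDerivAt_id (0 : ℝ)).const_mul c).ofReal_comp
    exact h2.const_mul _
  have h3 := h1.cexp
  simpa [expi] using h3

/-- A function that oscillates with frequency `c` in the direction `v` is dominated by its
derivatives. -/
theorem abs_mul_norm_iteratedFDeriv_le {d : ℕ} {K : (Fin d → ℝ) → ℂ} {v : Fin d → ℝ} {c : ℝ}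
    (hv : ‖v‖ ≤ 1) (hK : ∀ y (t : ℝ), K (y + t • v) = expi (c * t) * K y) {i : ℕ}
    (hd : ContDiff ℝ (i + 1 : ℕ) K) (y : Fin d → ℝ) :
    |c| * ‖iteratedFDeriv ℝ i K y‖ ≤ ‖iteratedFDeriv ℝ (i + 1) K y‖ := by
  have h1 : ∀ t : ℝ, iteratedFDeriv ℝ i K (y + t • v) = expi (c * t) • iteratedFDeriv ℝ i K y := by
    intro t
    rw [← iteratedFDeriv_comp_add_right (f := K) i (t • v) y]
    have : (fun y => K (y + t • v)) = expi (c * t) • K := by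
      funext y; simp [hK]
    rw [this, iteratedFDeriv_const_smul_apply]
    exact (hd.of_le (by exact_mod_cast Nat.le_succ i)).contDiffAt
  have hdiff : DifferentiableAt ℝ (iteratedFDeriv ℝ i K) y :=
    (hd.differentiable_iteratedFDeriv (by exact_mod_cast Nat.lt_succ_self i)) y
  have h2 : HasDerivAt (fun t : ℝ => iteratedFDeriv ℝ i K (y + t • v))
      (fderiv ℝ (iteratedFDeriv ℝ i K) y v) 0 := hdiff.hasFDerivAt.hasLineDerivAt v
  have h3 : HasDerivAt (fun t : ℝ => iteratedFDeriv ℝ i K (y + t • v))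
      ((2 * Real.pi * Complex.I * c) • iteratedFDeriv ℝ i K y) 0 := by
    rw [funext h1]
    exact (hasDerivAt_expi c).smul_const (iteratedFDeriv ℝ i K y)
  have h4 := h2.unique h3
  have h5 : ‖(2 * (Real.pi : ℂ) * Complex.I * (c : ℂ))‖ = 2 * Real.pi * |c| := by
    simp [abs_of_pos Real.pi_pos]
  have h6 : 2 * Real.pi * |c| * ‖iteratedFDeriv ℝ i K y‖ ≤ ‖iteratedFDeriv ℝ (i + 1) K y‖ := by
    rw [← h5, ← norm_smul, ← h4, ← norm_fderiv_iteratedFDeriv]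
    refine (ContinuousLinearMap.le_opNorm _ _).trans ?_
    exact mul_le_of_le_one_right (norm_nonneg _) hv
  refine le_trans ?_ h6
  refine mul_le_mul_of_nonneg_right ?_ (norm_nonneg _)
  nlinarith [abs_nonneg c, Real.pi_gt_three]

theorem exists_norm_eq_abs {k : Fin e → ℤ} (hk : k ≠ 0) : ∃ a, ‖k‖ = |(k a : ℝ)| := by
  have : Nonempty (Fin e) := by
    obtain ⟨i, -⟩ := Function.ne_iff.1 hk
    exact ⟨i⟩
  obtain ⟨a, ha⟩ := exists_eq_ciSup_of_finite (f := fun a => ‖k a‖₊)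
  refine ⟨a, ?_⟩
  rw [← Int.norm_eq_abs]
  refine le_antisymm ?_ (norm_le_pi_norm k a)
  refine (pi_norm_le_iff_of_nonneg (norm_nonneg _)).2 fun b => ?_
  have : ‖k b‖₊ ≤ ‖k a‖₊ := 
    (le_ciSup (f := fun a => ‖k a‖₊) (Set.finite_range _).bddAbove b).trans ha.ge
  exact_mod_cast this

/-- Decay of the modes of a smooth function. -/
theorem norm_iteratedFDeriv_fastMode_le {r : ℕ} {C : ℝ} (hg : ckClass r (e + 1) C g)
    {k : Fin e → ℤ} (hk : k ≠ 0) {i j : ℕ} (hij : i + j ≤ r) (y : Fin (e + 1) → ℝ) :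
    ‖iteratedFDeriv ℝ i (fastMode g k) y‖ ≤ C * (‖k‖ ^ j)⁻¹ := by
  have hk0 : 0 < ‖k‖ := by linarith [one_le_norm_of_ne_zero hk]
  rw [← div_eq_mul_inv, le_div_iff₀' (by positivity)]
  obtain ⟨a, ha⟩ := exists_norm_eq_abs hk
  obtain ⟨h1, h2⟩ := contDiff_fastMode hg k
  have hcov : ∀ y (t : ℝ), fastMode g k (y + t • fastVec (Pi.single a 1)) =
      expi (k a * t) * fastMode g k y := by
    intro y t
    rw [← fastVec_smul, fastMode_add_fastVec hg.1 hg.2.1.continuous, intVec_single_dotProduct]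
  induction j generalizing i with
  | zero => simpa using h2 i hij y
  | succ j ih =>
    have h3 := abs_mul_norm_iteratedFDeriv_le (norm_fastVec_single_le a) hcov (i := i)
      (h1.of_le (by exact_mod_cast (by omega : i + 1 ≤ r))) y
    rw [← ha] at h3
    calc ‖k‖ ^ (j + 1) * ‖iteratedFDeriv ℝ i (fastMode g k) y‖
        = ‖k‖ ^ j * (‖k‖ * ‖iteratedFDeriv ℝ i (fastMode g k) y‖) := by ring
      _ ≤ ‖k‖ ^ j * ‖iteratedFDeriv ℝ (i + 1) (fastMode g k) y‖ :=
        mul_le_mul_of_nonneg_left h3 (by positivity)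
      _ ≤ C := ih (by omega)

/-- The Fourier coefficients of a function in terms of its modes. -/
theorem fourierCoef_snoc (hg : Continuous g) (k : Fin e → ℤ) (l : ℤ) :
    fourierCoef g (Fin.snoc k l : Fin (e + 1) → ℤ) =
      ∫ t in Set.Icc (0 : ℝ) 1,
        fastMode g k (Fin.snoc (0 : Fin e → ℝ) t) * expi (-(l * t)) := by
  set Φ := (MeasurableEquiv.piFinSuccAbove (fun _ : Fin (e + 1) => ℝ) (Fin.last e)).symm with hΦ
  have hΦa : ∀ (t : ℝ) (s : Fin e → ℝ), Φ (t, s) = (Fin.snoc s t : Fin (e + 1) → ℝ) := by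
    intro t s
    simp only [hΦ, MeasurableEquiv.piFinSuccAbove_symm_apply]
    exact Fin.insertNth_last' t s
  have hpre : Φ ⁻¹' Set.Icc (0 : Fin (e + 1) → ℝ) 1 =
      Set.Icc (0 : ℝ) 1 ×ˢ Set.Icc (0 : Fin e → ℝ) 1 := by
    ext ⟨t, s⟩
    rw [Set.mem_preimage, hΦa]
    simp only [Set.mem_Icc, Pi.le_def, Set.mem_prod, Fin.forall_fin_succ', Fin.snoc_castSucc,
      Fin.snoc_last, Pi.zero_apply, Pi.one_apply]
    tauto
  have h1 := (volume_preserving_piFinSuccAbove (fun _ : Fin (e + 1) => ℝ)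
    (Fin.last e)).symm.setIntegral_preimage_emb (MeasurableEquiv.measurableEmbedding _)
    (fun x => (g x : ℂ) * expi (-(intVec (Fin.snoc k l : Fin (e + 1) → ℤ) ⬝ᵥ x)))
    (Set.Icc (0 : Fin (e + 1) → ℝ) 1)
  have hcont : Continuous fun x : Fin (e + 1) → ℝ =>
      (g x : ℂ) * expi (-(intVec (Fin.snoc k l : Fin (e + 1) → ℤ) ⬝ᵥ x)) :=
    (Complex.continuous_ofReal.comp hg).mul
      (continuous_expi.comp (continuous_dotProduct_right _).neg)
  have hsnoc : Continuous fun p : ℝ × (Fin e → ℝ) => (Fin.snoc p.2 p.1 : Fin (e + 1) → ℝ) := by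
    refine continuous_pi fun i => ?_
    refine Fin.lastCases ?_ (fun j => ?_) i
    · simpa using continuous_fst
    · simp only [Fin.snoc_castSucc]
      exact (continuous_apply j).comp continuous_snd
  change ∫ p in Φ ⁻¹' Set.Icc (0 : Fin (e + 1) → ℝ) 1, _ = _ at h1
  rw [fourierCoef, ← h1, hpre]
  have hfun : ∀ p : ℝ × (Fin e → ℝ), (fun x => (g x : ℂ) *
      expi (-(intVec (Fin.snoc k l : Fin (e + 1) → ℤ) ⬝ᵥ x))) (Φ p) =
      (g (Fin.snoc (0 : Fin e → ℝ) p.1 + fastVec p.2) : ℂ) * expi (-(intVec k ⬝ᵥ p.2)) *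
        expi (-(l * p.1)) := by
    rintro ⟨t, s⟩
    have h2 : (Fin.snoc (0 : Fin e → ℝ) t + fastVec s : Fin (e + 1) → ℝ) = Fin.snoc s t := by
      funext i
      refine Fin.lastCases ?_ (fun j => ?_) i <;> simp
    simp only [hΦa, h2, intVec_snoc_dotProduct, neg_add, expi_add, mul_assoc]
  have hint : IntegrableOn (fun p : ℝ × (Fin e → ℝ) => (fun x => (g x : ℂ) *
      expi (-(intVec (Fin.snoc k l : Fin (e + 1) → ℤ) ⬝ᵥ x))) (Φ p))
      (Set.Icc (0 : ℝ) 1 ×ˢ Set.Icc (0 : Fin e → ℝ) 1) (volume.prod volume) := by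
    refine ContinuousOn.integrableOn_compact (isCompact_Icc.prod isCompact_Icc) ?_
    refine Continuous.continuousOn ?_
    refine (hcont.comp hsnoc).congr fun p => ?_
    simp only [Function.comp_apply, ← hΦa]
  have h3 := setIntegral_prod (μ := (volume : Measure ℝ)) (ν := (volume : Measure (Fin e → ℝ))) _ hint
  refine h3.trans ?_
  refine integral_congr_ae (Eventually.of_forall fun t => ?_)
  simp only [hfun, integral_mul_const, fastMode]

theorem snoc_zero_add_smul (t : ℝ) : (Fin.snoc (0 : Fin e → ℝ) t : Fin (e + 1) → ℝ) =
    t • (Fin.snoc (0 : Fin e → ℝ) 1 : Fin (e + 1) → ℝ) := by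
  funext i
  refine Fin.lastCases ?_ (fun j => ?_) i <;> simp

theorem norm_snoc_zero_one_le : ‖(Fin.snoc (0 : Fin e → ℝ) 1 : Fin (e + 1) → ℝ)‖ ≤ 1 := by
  refine (pi_norm_le_iff_of_nonneg zero_le_one).2 fun i => ?_
  refine Fin.lastCases ?_ (fun j => ?_) i <;> simp

/-- The Fourier series, in the slow variable, of a mode. -/
theorem hasSum_fastMode (hg : Continuous g) (hper : IsPeriodic g) {k : Fin e → ℤ}
    (hd : ContDiff ℝ 1 (fastMode g k)) {M : ℝ} (hM : 0 < M) (h0 : ∀ y, ‖fastMode g k y‖ ≤ M)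
    (h1 : ∀ y, ‖fderiv ℝ (fastMode g k) y‖ ≤ M) :
    (Summable fun l : ℤ => ‖fourierCoef g (Fin.snoc k l : Fin (e + 1) → ℤ)‖) ∧
      ∑' l : ℤ, ‖fourierCoef g (Fin.snoc k l : Fin (e + 1) → ℤ)‖ ≤
        (2 + ∑' l : ℤ, ((l : ℝ) ^ 2)⁻¹) * M ∧
      ∀ y, HasSum (fun l : ℤ => fourierCoef g (Fin.snoc k l : Fin (e + 1) → ℤ) *
        expi (intVec (Fin.snoc k l : Fin (e + 1) → ℤ) ⬝ᵥ y)) (fastMode g k y) := by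
  set v : Fin (e + 1) → ℝ := Fin.snoc (0 : Fin e → ℝ) 1 with hv
  set b : ℝ → ℂ := fun t => fastMode g k (Fin.snoc (0 : Fin e → ℝ) t) with hb
  have hbv : ∀ t, b t = fastMode g k (t • v) := fun t => by rw [hb, hv, ← snoc_zero_add_smul]
  have hderiv : ∀ t, HasDerivAt b (fderiv ℝ (fastMode g k) (t • v) v) t := by
    intro t
    have h2 : HasFDerivAt (fastMode g k) (fderiv ℝ (fastMode g k) (t • v)) (t • v) :=
      ((hd.differentiable one_ne_zero) _).hasFDerivAt
    have h3 : HasDerivAt (fun t : ℝ => t • v) v t := by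
      simpa using (hasDerivAt_id t).smul_const v
    have := h2.comp_hasDerivAt t h3
    rw [funext hbv]
    exact this
  have hcont : Continuous fun t : ℝ => fderiv ℝ (fastMode g k) (t • v) v := by
    have := (hd.continuous_fderiv one_ne_zero).comp (continuous_id.smul continuous_const :
      Continuous fun t : ℝ => t • v)
    exact this.clm_apply continuous_const
  have hbper : ∀ t, b (t + 1) = b t := by
    intro t
    have : (Fin.snoc (0 : Fin e → ℝ) (t + 1) : Fin (e + 1) → ℝ) =
        Fin.snoc (0 : Fin e → ℝ) t + intVec (Fin.snoc (0 : Fin e → ℤ) 1) := by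
      funext i
      refine Fin.lastCases ?_ (fun j => ?_) i <;> simp [intVec]
    simp only [hb]
    rw [this, fastMode_add_intVec hper]
  have h4 := summable_fourier_circle hderiv hcont hbper hM (fun t => h0 _) (fun t => by
    refine ((fderiv ℝ (fastMode g k) (t • v)).le_opNorm v).trans ?_
    refine (mul_le_of_le_one_right (norm_nonneg _) norm_snoc_zero_one_le).trans (h1 _))
  simp only [hb, ← fourierCoef_snoc hg] at h4
  refine ⟨h4.1, h4.2, fun y => ?_⟩
  have h5 := hasSum_fourier_circle (b := b)
    (continuous_iff_continuousAt.2 fun t => (hderiv t).continuousAt) hbper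
    (by simp only [hb, ← fourierCoef_snoc hg]; exact h4.1.of_norm) (y (Fin.last e))
  simp only [hb, ← fourierCoef_snoc hg] at h5
  rw [fastMode_eq hper hg]
  have h6 := h5.mul_left (expi (intVec k ⬝ᵥ (Fin.init y : Fin e → ℝ)))
  refine h6.congr_fun fun l => ?_
  have h7 : intVec (Fin.snoc k l : Fin (e + 1) → ℤ) ⬝ᵥ y =
      intVec k ⬝ᵥ (Fin.init y : Fin e → ℝ) + l * y (Fin.last e) := by
    rw [← intVec_snoc_dotProduct, Fin.snoc_init_self]
  rw [h7, expi_add]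
  ring

end Modes

/-! ### The cohomology equation -/

/-- The inverse `(e^{2πi k·ω} - 1)⁻¹` of the small divisor; it is zero for `k = 0`, so that the mode
`k = 0` drops out of sums over all `k`. -/
noncomputable def divisorInv {e : ℕ} (ω : Fin e → ℝ) (k : Fin e → ℤ) : ℂ :=
  (expi (intVec k ⬝ᵥ ω) - 1)⁻¹

@[simp]
theorem divisorInv_zero {e : ℕ} (ω : Fin e → ℝ) : divisorInv ω 0 = 0 := by
  simp [divisorInv, intVec_zero]

/-- Small divisors are tame of order `c`: the sum of their inverses, weighted by `‖k‖^{-c}`,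
converges. -/
structure TameDivisors {e : ℕ} (ω : Fin e → ℝ) (c : ℕ) : Prop where
  summable : Summable fun k : Fin e → ℤ => (‖k‖ ^ c)⁻¹ * ‖divisorInv ω k‖
  ne_one : ∀ k : Fin e → ℤ, k ≠ 0 → expi (intVec k ⬝ᵥ ω) - 1 ≠ 0

theorem IsDiophantine.tameDivisors {e : ℕ} {ω : Fin e → ℝ} {ν τ : ℝ} (h : IsDiophantine ν τ ω)
    (hν : 0 < ν) {c : ℕ} (hc : τ < c) : TameDivisors ω c :=
  ⟨by simpa only [divisorInv, norm_inv] using h.summable_inv hν hc, fun _ hk => h.expi_ne_one hν hk⟩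

/-- For `d = 1` there are no small divisors. -/
theorem tameDivisors_of_isEmpty (ω : Fin 0 → ℝ) (c : ℕ) : TameDivisors ω c :=
  ⟨(hasSum_fintype _).summable, fun k hk => absurd (Subsingleton.elim k 0) hk⟩

section Cohomology

variable {e : ℕ} {A : Matrix.SpecialLinearGroup (Fin (e + 1)) ℤ} {ω : Fin e → ℝ}
  {P : (Fin (e + 1) → ℝ) → ℝ} {g : (Fin (e + 1) → ℝ) → ℝ}

theorem ckClass_mono {d k k' : ℕ} {C C' : ℝ} {f : (Fin d → ℝ) → ℝ} (h : ckClass k d C f)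
    (hk : k' ≤ k) (hC : C ≤ C') : ckClass k' d C' f :=
  ⟨h.1, h.2.1.of_le (by exact_mod_cast hk), fun i hi x => (h.2.2 i (hi.trans hk) x).trans hC⟩

theorem ckClass_nonneg {d k : ℕ} {C : ℝ} {f : (Fin d → ℝ) → ℝ} (h : ckClass k d C f) : 0 ≤ C :=
  (norm_nonneg _).trans (h.2.2 0 (Nat.zero_le _) 0)

/-- The decay of a mode and of its derivative, with constants in the form used for Fourier series. -/
theorem fastMode_bounds {r : ℕ} {C : ℝ} (hg : ckClass r (e + 1) C g) {k : Fin e → ℤ}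
    (hk : k ≠ 0) {c : ℕ} (hc : 1 + c ≤ r) :
    (∀ y, ‖fastMode g k y‖ ≤ C * (‖k‖ ^ c)⁻¹) ∧
      ∀ y, ‖fderiv ℝ (fastMode g k) y‖ ≤ C * (‖k‖ ^ c)⁻¹ := by
  refine ⟨fun y => ?_, fun y => ?_⟩
  · simpa using norm_iteratedFDeriv_fastMode_le hg hk (i := 0) (j := c) (by omega) y
  · simpa using norm_iteratedFDeriv_fastMode_le hg hk (i := 1) (j := c) hc y

/-- The resonant part is the average over the fast directions. -/
theorem resonantPart_eq {C : ℝ} (hg : ckClass 1 (e + 1) C (fun x => P (act A⁻¹ x)))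
    (y : Fin (e + 1) → ℝ) :
    resonantPart A P (y (Fin.last e)) = (fastMode (fun x => P (act A⁻¹ x)) 0 y).re := by
  obtain ⟨h1, h2⟩ := contDiff_fastMode hg 0
  have hC := ckClass_nonneg hg
  obtain ⟨-, -, h3⟩ := hasSum_fastMode hg.2.1.continuous hg.1 (k := 0) (by simpa using h1)
    (M := C + 1) (by linarith)
    (fun y => by
      have := h2 0 (by norm_num) y
      rw [norm_iteratedFDeriv_zero] at this
      linarith)
    (fun y => by
      have := h2 1 le_rfl y
      rw [norm_iteratedFDeriv_one] at this
      linarith)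
  rw [resonantPart, ← (h3 y).tsum_eq]
  congr 2
  funext l
  have : intVec (Fin.snoc (0 : Fin e → ℤ) l : Fin (e + 1) → ℤ) ⬝ᵥ y = l * y (Fin.last e) := by
    conv_lhs => rw [← Fin.snoc_init_self (α := fun _ => ℝ) y]
    rw [intVec_snoc_dotProduct, intVec_zero, zero_dotProduct, zero_add]
  rw [this]

/-- The solution of the cohomology equation in terms of the fast modes. -/
theorem cohomologySolution_eq {c : ℕ} (hω : TameDivisors ω c) {r : ℕ} {C : ℝ} (hr : 1 + c ≤ r)
    (hg : ckClass r (e + 1) C (fun x => P (act A⁻¹ x))) (x : Fin (e + 1) → ℝ) :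
    cohomologySolution A ω P x =
      (∑' k : Fin e → ℤ, divisorInv ω k * fastMode (fun x => P (act A⁻¹ x)) k (act A x)).re := by
  set g : (Fin (e + 1) → ℝ) → ℝ := fun x => P (act A⁻¹ x) with hgdef
  set y := act A x with hy
  have hC := ckClass_nonneg hg
  have key : ∀ k : Fin e → ℤ, k ≠ 0 →
      (Summable fun l : ℤ => ‖fourierCoef g (Fin.snoc k l : Fin (e + 1) → ℤ)‖) ∧
      ∑' l : ℤ, ‖fourierCoef g (Fin.snoc k l : Fin (e + 1) → ℤ)‖ ≤
        (2 + ∑' l : ℤ, ((l : ℝ) ^ 2)⁻¹) * ((C + 1) * (‖k‖ ^ c)⁻¹) ∧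
      ∀ y, HasSum (fun l : ℤ => fourierCoef g (Fin.snoc k l : Fin (e + 1) → ℤ) *
        expi (intVec (Fin.snoc k l : Fin (e + 1) → ℤ) ⬝ᵥ y)) (fastMode g k y) := by
    intro k hk
    have hk1 := one_le_norm_of_ne_zero hk
    have hg' := ckClass_mono hg le_rfl (by linarith : C ≤ C + 1)
    obtain ⟨h1, h2⟩ := fastMode_bounds hg' hk hr
    exact hasSum_fastMode hg.2.1.continuous hg.1
      ((contDiff_fastMode hg k).1.of_le (by exact_mod_cast (by omega : 1 ≤ r)))
      (by positivity) h1 h2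
  set F : (Fin (e + 1) → ℤ) → ℂ := fun k => if (Fin.init k : Fin e → ℤ) = 0 then 0 else
    fourierCoef g k / (expi (intVec (Fin.init k : Fin e → ℤ) ⬝ᵥ ω) - 1) *
      expi (intVec k ⬝ᵥ y) with hF
  have hFs : ∀ (k : Fin e → ℤ) (l : ℤ), F (Fin.snoc k l : Fin (e + 1) → ℤ) =
      divisorInv ω k * (fourierCoef g (Fin.snoc k l : Fin (e + 1) → ℤ) *
        expi (intVec (Fin.snoc k l : Fin (e + 1) → ℤ) ⬝ᵥ y)) := by
    intro k l
    simp only [hF, Fin.init_snoc]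
    by_cases hk : k = 0
    · simp [hk]
    · rw [if_neg hk, divisorInv]
      ring
  let φ : (Fin e → ℤ) × ℤ ≃ (Fin (e + 1) → ℤ) :=
    (Equiv.prodComm _ _).trans (Fin.snocEquiv fun _ => ℤ)
  have hφ : ∀ k l, φ (k, l) = Fin.snoc k l := fun k l => rfl
  have hnorm : ∀ (k : Fin e → ℤ) (l : ℤ), ‖F (φ (k, l))‖ =
      ‖divisorInv ω k‖ * ‖fourierCoef g (Fin.snoc k l : Fin (e + 1) → ℤ)‖ := by
    intro k l
    rw [hφ, hFs, norm_mul, norm_mul, norm_expi, mul_one]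
  have hsum : Summable fun p : (Fin e → ℤ) × ℤ => F (φ p) := by
    refine Summable.of_norm ((summable_prod_of_nonneg fun p => norm_nonneg _).2 ⟨fun k => ?_, ?_⟩)
    · simp only [hnorm]
      by_cases hk : k = 0
      · simp [hk]
      · exact (key k hk).1.mul_left _
    · simp only [hnorm, tsum_mul_left]
      refine Summable.of_nonneg_of_le (fun k => by positivity) (fun k => ?_)
        (hω.summable.mul_left ((2 + ∑' l : ℤ, ((l : ℝ) ^ 2)⁻¹) * (C + 1)))
      by_cases hk : k = 0
      · simp [hk]
      · have h3 := mul_le_mul_of_nonneg_left (key k hk).2.1 (norm_nonneg (divisorInv ω k))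
        refine h3.trans (le_of_eq ?_)
        ring
  have h4 : ∑' k, F k = ∑' k : Fin e → ℤ, divisorInv ω k * fastMode g k y := by
    rw [← φ.tsum_eq, hsum.tsum_prod]
    refine tsum_congr fun k => ?_
    simp only [hφ, hFs, tsum_mul_left]
    by_cases hk : k = 0
    · simp [hk]
    · rw [((key k hk).2.2 y).tsum_eq]
  rw [cohomologySolution, ← h4]

theorem TameDivisors.summable_inv {c : ℕ} (hω : TameDivisors ω c) :
    Summable fun k : {k : Fin e → ℤ // k ≠ 0} => (‖k.1‖ ^ c)⁻¹ := by
  refine Summable.of_nonneg_of_le (fun k => by positivity) (fun k => ?_)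
    ((hω.summable.comp_injective Subtype.val_injective).mul_left 2)
  have h1 : ‖expi (intVec k.1 ⬝ᵥ ω) - 1‖ ≤ 2 := by
    refine (norm_sub_le _ _).trans ?_
    rw [norm_expi, norm_one]; norm_num
  have h2 : 0 < ‖expi (intVec k.1 ⬝ᵥ ω) - 1‖ := norm_pos_iff.2 (hω.ne_one k.1 k.2)
  have h3 : 1 ≤ 2 * ‖divisorInv ω k.1‖ := by
    rw [divisorInv, norm_inv, ← div_eq_mul_inv, one_le_div h2]
    exact h1
  have h4 : 0 ≤ (‖k.1‖ ^ c)⁻¹ := by positivity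
  simp only [Function.comp_apply]
  nlinarith

theorem summable_of_subtype_ne_zero {f : (Fin e → ℤ) → ℂ}
    (h : Summable fun k : {k : Fin e → ℤ // k ≠ 0} => f k.1) : Summable f := by
  rw [← (Set.finite_singleton (0 : Fin e → ℤ)).summable_compl_iff]
  exact h

/-- The modes of a function add up to the function. -/
theorem hasSum_fastMode_apply {c : ℕ} (hω : TameDivisors ω c) {r : ℕ} {C : ℝ} (hr : 1 + c ≤ r)
    (hg : ckClass r (e + 1) C g) (y : Fin (e + 1) → ℝ) :
    HasSum (fun k : Fin e → ℤ => fastMode g k y) (g y : ℂ) := by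
  have h := hasSum_fourier (φ := fun s => (g (y + fastVec s) : ℂ))
    (Complex.continuous_ofReal.comp
      (hg.2.1.continuous.comp (continuous_const.add continuous_fastVec)))
    (fun s k => by rw [fastVec_add, fastVec_intVec, ← add_assoc, hg.1]) ?_ 0
  · have h0 : fastVec (0 : Fin e → ℝ) = 0 := by simpa using fastVec_smul 0 (0 : Fin e → ℝ)
    simpa [h0, fastMode] using h
  · refine summable_of_subtype_ne_zero (Summable.of_norm_bounded (hω.summable_inv.mul_left C) ?_)
    exact fun k => (fastMode_bounds hg k.2 hr).1 y

/-- The cohomology equation. -/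
theorem cohomologySolution_sub {c : ℕ} (hω : TameDivisors ω c) {r : ℕ} {C : ℝ} (hr : 1 + c ≤ r)
    (hg : ckClass r (e + 1) C (fun x => P (act A⁻¹ x))) {θ : Fin (e + 1) → ℝ}
    {L : Fin (e + 1) → ℤ} (hθ : act A θ = (Fin.snoc ω 0 : Fin (e + 1) → ℝ) + intVec L)
    (x : Fin (e + 1) → ℝ) :
    cohomologySolution A ω P (x + θ) - cohomologySolution A ω P x =
      P x - resonantPart A P (act A x (Fin.last e)) := by
  have hg1 : ckClass 1 (e + 1) C (fun x => P (act A⁻¹ x)) := ckClass_mono hg (by omega) le_rfl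
  rw [cohomologySolution_eq hω hr hg, cohomologySolution_eq hω hr hg, resonantPart_eq hg1, act_add,
    hθ]
  have hPx : P x = (fun x => P (act A⁻¹ x)) (act A x) := by simp
  rw [hPx]
  set g : (Fin (e + 1) → ℝ) → ℝ := fun x => P (act A⁻¹ x) with hgdef
  set y := act A x with hy
  have hmode : ∀ k : Fin e → ℤ, fastMode g k (y + ((Fin.snoc ω 0 : Fin (e + 1) → ℝ) + intVec L)) =
      expi (intVec k ⬝ᵥ ω) * fastMode g k y := by
    intro k
    rw [← add_assoc, fastMode_add_intVec hg.1]
    exact fastMode_add_fastVec hg.1 hg.2.1.continuous k y ω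
  have hs : ∀ y, Summable fun k : Fin e → ℤ => divisorInv ω k * fastMode g k y := by
    intro y
    refine Summable.of_norm_bounded (hω.summable.mul_left C) fun k => ?_
    by_cases hk : k = 0
    · simp [hk]
    · rw [norm_mul, mul_comm, ← mul_assoc]
      exact mul_le_mul_of_nonneg_right ((fastMode_bounds hg hk hr).1 y) (norm_nonneg _)
  have htot := hasSum_fastMode_apply hω hr hg y
  have hdiff : HasSum (fun k : Fin e → ℤ =>
      divisorInv ω k * fastMode g k (y + ((Fin.snoc ω 0 : Fin (e + 1) → ℝ) + intVec L)) -
        divisorInv ω k * fastMode g k y) (g y - fastMode g 0 y) := by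
    have h1 := htot.sub (hasSum_ite_eq (0 : Fin e → ℤ) (fastMode g 0 y))
    refine h1.congr_fun fun k => ?_
    by_cases hk : k = 0
    · simp [hk]
    · rw [if_neg hk, sub_zero, hmode, ← mul_sub, divisorInv]
      have := hω.ne_one k hk
      field_simp
  rw [← Complex.sub_re, ← (hs _).tsum_sub (hs y), hdiff.tsum_eq]
  simp

/-- The solution of the cohomology equation loses `c` derivatives. -/
theorem ckClass_cohomologySolution {c : ℕ} (hω : TameDivisors ω c) {r : ℕ} {C : ℝ} (hr : 1 ≤ r)
    (hg : ckClass (r + c) (e + 1) C (fun x => P (act A⁻¹ x))) :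
    ckClass r (e + 1) (C * ∑' k : Fin e → ℤ, (‖k‖ ^ c)⁻¹ * ‖divisorInv ω k‖)
      (fun y => cohomologySolution A ω P (act A⁻¹ y)) := by
  have heq : (fun y => cohomologySolution A ω P (act A⁻¹ y)) = fun y =>
      Complex.reCLM (∑' k : Fin e → ℤ, divisorInv ω k * fastMode (fun x => P (act A⁻¹ x)) k y) := by
    funext y
    rw [cohomologySolution_eq hω (by omega : 1 + c ≤ r + c) hg, act_act_inv]
    rfl
  rw [heq]
  set g : (Fin (e + 1) → ℝ) → ℝ := fun x => P (act A⁻¹ x) with hgdef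
  have hC := ckClass_nonneg hg
  have hcd : ∀ k, ContDiff ℝ r fun y => divisorInv ω k * fastMode g k y := fun k =>
    contDiff_const.mul ((contDiff_fastMode hg k).1.of_le (by exact_mod_cast Nat.le_add_right r c))
  have hbd : ∀ (i : ℕ) (k : Fin e → ℤ) (y : Fin (e + 1) → ℝ), (i : ℕ∞) ≤ (r : ℕ∞) →
      ‖iteratedFDeriv ℝ i (fun y => divisorInv ω k * fastMode g k y) y‖ ≤
        C * ((‖k‖ ^ c)⁻¹ * ‖divisorInv ω k‖) := by
    intro i k y hi
    have hi : i ≤ r := by exact_mod_cast hi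
    have h1 : iteratedFDeriv ℝ i (fun y => divisorInv ω k * fastMode g k y) y =
        divisorInv ω k • iteratedFDeriv ℝ i (fastMode g k) y :=
      iteratedFDeriv_const_smul_apply (a := divisorInv ω k) (f := fastMode g k)
        ((contDiff_fastMode hg k).1.of_le (by exact_mod_cast (by omega : i ≤ r + c))).contDiffAt
    rw [h1, norm_smul]
    by_cases hk : k = 0
    · simp [hk]
    · have h2 := norm_iteratedFDeriv_fastMode_le hg hk (i := i) (j := c) (by omega) y
      calc _ ≤ ‖divisorInv ω k‖ * (C * (‖k‖ ^ c)⁻¹) :=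
            mul_le_mul_of_nonneg_left h2 (norm_nonneg _)
        _ = _ := by ring
  have hsC := hω.summable.mul_left C
  have hsm : ContDiff ℝ r fun y => ∑' k : Fin e → ℤ, divisorInv ω k * fastMode g k y := by
    have := contDiff_tsum (𝕜 := ℝ) (N := (r : ℕ∞)) (f := fun k y => divisorInv ω k * fastMode g k y)
      (v := fun _ k => C * ((‖k‖ ^ c)⁻¹ * ‖divisorInv ω k‖)) (by exact_mod_cast hcd)
      (fun _ _ => hsC) hbd
    exact_mod_cast this
  refine ⟨fun y l => ?_, Complex.reCLM.contDiff.comp hsm, fun i hi y => ?_⟩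
  · simp only [fastMode_add_intVec hg.1]
  · have h3 := iteratedFDeriv_tsum (𝕜 := ℝ) (N := (r : ℕ∞))
      (f := fun k y => divisorInv ω k * fastMode g k y)
      (v := fun _ k => C * ((‖k‖ ^ c)⁻¹ * ‖divisorInv ω k‖)) (by exact_mod_cast hcd)
      (fun _ _ => hsC) hbd (k := i) (by exact_mod_cast hi)
    have h4 := ContinuousLinearMap.iteratedFDeriv_comp_left (g := Complex.reCLM) (i := i) (x := y)
      (f := fun y => ∑' k : Fin e → ℤ, divisorInv ω k * fastMode g k y)
      hsm.contDiffAt (by exact_mod_cast hi)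
    change iteratedFDeriv ℝ i (fun y => Complex.reCLM (∑' k : Fin e → ℤ, _)) y = _ at h4
    rw [h4]
    refine (ContinuousLinearMap.norm_compContinuousMultilinearMap_le _ _).trans ?_
    refine (mul_le_mul_of_nonneg_right Complex.reCLM_norm.le (norm_nonneg _)).trans ?_
    rw [one_mul, congrFun h3 y, ← tsum_mul_left]
    exact tsum_of_norm_bounded hsC.hasSum fun k => hbd i k y (by exact_mod_cast hi)

/-- Averaging over the fast directions loses no derivatives. -/
theorem ckClass_resonantPart {r : ℕ} {C : ℝ} (hr : 1 ≤ r)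
    (hg : ckClass r (e + 1) C (fun x => P (act A⁻¹ x))) :
    ckClass r (e + 1) C (fun y => resonantPart A P (y (Fin.last e))) := by
  have heq : (fun y => resonantPart A P (y (Fin.last e))) = fun y : Fin (e + 1) → ℝ =>
      Complex.reCLM (fastMode (fun x => P (act A⁻¹ x)) 0 y) := by
    funext y
    rw [resonantPart_eq (ckClass_mono hg hr le_rfl)]
    rfl
  rw [heq]
  obtain ⟨h1, h2⟩ := contDiff_fastMode hg 0
  refine ⟨fun y l => by simp only [fastMode_add_intVec hg.1], Complex.reCLM.contDiff.comp h1,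
    fun i hi y => ?_⟩
  have h4 := ContinuousLinearMap.iteratedFDeriv_comp_left (g := Complex.reCLM) (i := i) (x := y)
    h1.contDiffAt (by exact_mod_cast hi)
  change iteratedFDeriv ℝ i (fun y => Complex.reCLM (fastMode _ 0 y)) y = _ at h4
  rw [h4]
  refine (ContinuousLinearMap.norm_compContinuousMultilinearMap_le _ _).trans ?_
  refine (mul_le_mul_of_nonneg_right Complex.reCLM_norm.le (norm_nonneg _)).trans ?_
  rw [one_mul]
  exact h2 i hi y

end Cohomology

/-! ### Taylor expansion and implicit functions -/

section Calculus

/-- Taylor's formula with integral remainder on `[0, 1]`, with one-sided derivatives at the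
endpoints. -/
theorem taylor_sum_add_integral {G : Type*} [NormedAddCommGroup G] [NormedSpace ℝ G]
    [CompleteSpace G] {φ : ℕ → ℝ → G} {M : ℕ}
    (hφ : ∀ l < M + 1, ∀ s ∈ Set.Icc (0 : ℝ) 1,
      HasDerivWithinAt (φ l) (φ (l + 1) s) (Set.Icc 0 1) s)
    (hc : ContinuousOn (φ (M + 1)) (Set.Icc 0 1)) :
    φ 0 1 = ∑ l ∈ Finset.range (M + 1), ((l.factorial : ℝ))⁻¹ • φ l 0 +
      ∫ s in Set.Icc (0 : ℝ) 1, ((1 - s) ^ M * ((M.factorial : ℝ))⁻¹) • φ (M + 1) s := by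
  set T : ℝ → G := fun s =>
    ∑ l ∈ Finset.range (M + 1), ((1 - s) ^ l * ((l.factorial : ℝ))⁻¹) • φ l s with hT
  have hderiv : ∀ s ∈ Set.Icc (0 : ℝ) 1, HasDerivWithinAt T
      (((1 - s) ^ M * ((M.factorial : ℝ))⁻¹) • φ (M + 1) s) (Set.Icc 0 1) s := by
    intro s hs
    have hp : ∀ l : ℕ, HasDerivWithinAt (fun s : ℝ => (1 - s) ^ l * ((l.factorial : ℝ))⁻¹)
        (-(l * (1 - s) ^ (l - 1) * ((l.factorial : ℝ))⁻¹)) (Set.Icc 0 1) s := by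
      intro l
      have := (((hasDerivAt_id s).const_sub 1).pow l).mul_const ((l.factorial : ℝ))⁻¹
      refine this.hasDerivWithinAt.congr_deriv ?_
      simp
    have h1 : HasDerivWithinAt T (∑ l ∈ Finset.range (M + 1),
        (((1 - s) ^ l * ((l.factorial : ℝ))⁻¹) • φ (l + 1) s +
          (-(l * (1 - s) ^ (l - 1) * ((l.factorial : ℝ))⁻¹)) • φ l s)) (Set.Icc 0 1) s := by
      refine HasDerivWithinAt.fun_sum fun l hl => ?_
      exact (hp l).smul (hφ l (Finset.mem_range.1 hl) s hs)
    refine h1.congr_deriv ?_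
    rw [Finset.sum_add_distrib, Finset.sum_range_succ,
      Finset.sum_range_succ' (fun l : ℕ => (-(l * (1 - s) ^ (l - 1) * ((l.factorial : ℝ))⁻¹)) • φ l s)]
    simp only [Nat.cast_zero, zero_mul, neg_zero, zero_smul, add_zero]
    rw [add_right_comm, ← Finset.sum_add_distrib, Finset.sum_eq_zero, zero_add]
    intro l _
    rw [← add_smul]
    have : ((l + 1).factorial : ℝ) = (l + 1) * l.factorial := by
      rw [Nat.factorial_succ]; push_cast; ring
    rw [this, Nat.add_sub_cancel]
    have h2 : (l.factorial : ℝ) ≠ 0 := by positivity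
    have h3 : (l : ℝ) + 1 ≠ 0 := by positivity
    have h4 : (1 - s) ^ l * ((l.factorial : ℝ))⁻¹ +
        -(((l + 1 : ℕ) : ℝ) * (1 - s) ^ l * ((l + 1) * (l.factorial : ℝ))⁻¹) = 0 := by
      push_cast
      field_simp
      ring
    rw [h4, zero_smul]
  have hcont : ContinuousOn (fun s : ℝ => ((1 - s) ^ M * ((M.factorial : ℝ))⁻¹) • φ (M + 1) s)
      (Set.Icc 0 1) :=
    ContinuousOn.smul (by fun_prop) hc
  have h5 := intervalIntegral.integral_eq_sub_of_hasDerivAt_of_le zero_le_one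
    (fun s hs => (hderiv s hs).continuousWithinAt)
    (fun s hs => (hderiv s (Set.Ioo_subset_Icc_self hs)).hasDerivAt (Icc_mem_nhds hs.1 hs.2))
    (hcont.intervalIntegrable_of_Icc zero_le_one)
  rw [intervalIntegral.integral_of_le zero_le_one, ← integral_Icc_eq_integral_Ioc] at h5
  rw [h5]
  have hT1 : T 1 = φ 0 1 := by
    simp only [hT]
    rw [Finset.sum_range_succ', Finset.sum_eq_zero]
    · simp
    · intro l _; simp
  have hT0 : T 0 = ∑ l ∈ Finset.range (M + 1), ((l.factorial : ℝ))⁻¹ • φ l 0 := by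
    simp [hT]
  rw [hT1, hT0]
  abel

/-- A function defined by an implicit equation that has a unique solution is as smooth as the
equation. -/
theorem contDiffAt_of_implicit {𝕜 : Type*} [RCLike 𝕜] {E : Type*} [NormedAddCommGroup E]
    [NormedSpace 𝕜 E] [CompleteSpace E] {Ψ : E × 𝕜 → 𝕜} {w : E → 𝕜} {x : E} {n : ℕ} (hn : n ≠ 0)
    (hΨ : ContDiffAt 𝕜 n Ψ (x, w x)) (hinv : fderiv 𝕜 Ψ (x, w x) (0, 1) ≠ 0)
    (huniq : ∀ᶠ v in 𝓝 (x, w x), Ψ v = Ψ (x, w x) → v.2 = w v.1) : ContDiffAt 𝕜 n w x := by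
  have hn' : (n : WithTop ℕ∞) ≠ 0 := by exact_mod_cast hn
  set a := fderiv 𝕜 Ψ (x, w x) (0, 1) with ha
  have hL : fderiv 𝕜 Ψ (x, w x) ∘L .inr 𝕜 E 𝕜 = ContinuousLinearMap.toSpanSingleton 𝕜 a := by
    ext
    simp [ha]
  have hI : (fderiv 𝕜 Ψ (x, w x) ∘L .inr 𝕜 E 𝕜).IsInvertible := by
    rw [hL]
    refine ContinuousLinearMap.IsInvertible.of_inverse
      (g := ContinuousLinearMap.toSpanSingleton 𝕜 a⁻¹) ?_ ?_ <;>
    · ext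
      simp [hinv]
  have h1 := hΨ.contDiffAt_implicitFunction hn' hI
  have h2 := hΨ.eventually_apply_implicitFunction hn' hI
  have h3 := hΨ.implicitFunction_apply_self hn' hI
  have h4 : Tendsto (fun y => (y, hΨ.implicitFunction hn' hI y)) (𝓝 x) (𝓝 (x, w x)) := by
    have := (continuousAt_id.prodMk h1.continuousAt).tendsto
    simp only [id_eq] at this
    rwa [h3] at this
  refine h1.congr_of_eventuallyEq ?_
  filter_upwards [h2, h4.eventually huniq] with y h5 h6
  exact (h6 h5).symm

/-- Partial derivatives of a smooth function of two variables are continuous in the parameter. -/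
theorem continuous_iteratedFDeriv_snd {E G : Type*} [NormedAddCommGroup E] [NormedSpace ℝ E]
    [NormedAddCommGroup G] [NormedSpace ℝ G] {F : ℝ × E → G} {n : ℕ} (hF : ContDiff ℝ n F)
    {i : ℕ} (hi : i ≤ n) (x : E) :
    Continuous fun s => iteratedFDeriv ℝ i (fun x => F (s, x)) x := by
  have h1 : ∀ s, iteratedFDeriv ℝ i (fun x => F (s, x)) x =
      (iteratedFDeriv ℝ i F (s, x)).compContinuousLinearMap
        fun _ => ContinuousLinearMap.inr ℝ ℝ E := by
    intro s
    have h2 : (fun x => F (s, x)) = (fun z => F (z + (s, 0))) ∘ ContinuousLinearMap.inr ℝ ℝ E := by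
      funext x; simp
    have h3 : ContDiff ℝ n fun z => F (z + (s, 0)) := hF.comp (contDiff_id.add contDiff_const)
    rw [h2, ContinuousLinearMap.iteratedFDeriv_comp_right _ h3 _ (by exact_mod_cast hi),
      iteratedFDeriv_comp_add_right]
    simp
  simp only [h1]
  refine (ContinuousMultilinearMap.compContinuousLinearMapL (F := G)
    fun _ : Fin i => ContinuousLinearMap.inr ℝ ℝ E).continuous.comp ?_
  exact (hF.continuous_iteratedFDeriv (by exact_mod_cast hi)).comp
    (continuous_id.prodMk continuous_const)

theorem eventually_nhds_abs_mul_le (B : ℝ) {η : ℝ} (hη : 0 < η) :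
    ∀ᶠ ε in 𝓝 (0 : ℝ), |ε| * B ≤ η := by
  simpa using eventually_abs_mul_le (I := Set.univ) B hη

end Calculus

/-! ### Calculus in the classes `C^k` -/

section CkClass

variable {d k : ℕ} {C C' : ℝ} {f g v : (Fin d → ℝ) → ℝ}

theorem ckClass_const (k : ℕ) (a : ℝ) : ckClass k d |a| (fun _ => a) := by
  refine ⟨fun _ _ => rfl, contDiff_const, fun i _ x => ?_⟩
  rcases i with _ | i
  · simp
  · rw [iteratedFDeriv_succ_const]
    simp

theorem ckClass_add (hf : ckClass k d C f) (hg : ckClass k d C' g) :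
    ckClass k d (C + C') (fun x => f x + g x) := by
  refine ⟨fun x l => by simp only [hf.1 x l, hg.1 x l], hf.2.1.add hg.2.1, fun i hi x => ?_⟩
  have h : iteratedFDeriv ℝ i (fun x => f x + g x) x =
      iteratedFDeriv ℝ i f x + iteratedFDeriv ℝ i g x :=
    iteratedFDeriv_add_apply (hf.2.1.of_le (by exact_mod_cast hi)).contDiffAt
      (hg.2.1.of_le (by exact_mod_cast hi)).contDiffAt
  rw [h]
  exact (norm_add_le _ _).trans (add_le_add (hf.2.2 i hi x) (hg.2.2 i hi x))

theorem sum_choose_mul_le {i : ℕ} {a b : ℕ → ℝ} {C C' : ℝ} (hC : 0 ≤ C) (ha : ∀ j ≤ i, a j ≤ C)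
    (hb : ∀ j ≤ i, b j ≤ C') (hb0 : ∀ j, 0 ≤ b j) :
    ∑ j ∈ Finset.range (i + 1), (i.choose j : ℝ) * a j * b (i - j) ≤ 2 ^ i * (C * C') := by
  calc ∑ j ∈ Finset.range (i + 1), (i.choose j : ℝ) * a j * b (i - j)
      ≤ ∑ j ∈ Finset.range (i + 1), (i.choose j : ℝ) * (C * C') := by
        refine Finset.sum_le_sum fun j hj => ?_
        have hj : j ≤ i := Nat.lt_succ_iff.1 (Finset.mem_range.1 hj)
        rw [mul_assoc]
        refine mul_le_mul_of_nonneg_left ?_ (by positivity)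
        exact mul_le_mul (ha j hj) (hb _ (Nat.sub_le _ _)) (hb0 _) hC
    _ = 2 ^ i * (C * C') := by
        rw [← Finset.sum_mul]
        congr 1
        exact_mod_cast Nat.sum_range_choose i

theorem ckClass_mul (hf : ckClass k d C f) (hg : ckClass k d C' g) :
    ckClass k d (2 ^ k * C * C') (fun x => f x * g x) := by
  have hC := ckClass_nonneg hf
  have hC' := ckClass_nonneg hg
  refine ⟨fun x l => by simp only [hf.1 x l, hg.1 x l], hf.2.1.mul hg.2.1, fun i hi x => ?_⟩
  refine (norm_iteratedFDeriv_mul_le hf.2.1 hg.2.1 x (by exact_mod_cast hi)).trans ?_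
  refine (sum_choose_mul_le hC (fun j hj => hf.2.2 j (hj.trans hi) x)
    (fun j hj => hg.2.2 j (hj.trans hi) x) fun j => norm_nonneg _).trans ?_
  rw [mul_assoc]
  exact mul_le_mul_of_nonneg_right (pow_le_pow_right₀ one_le_two hi) (by positivity)

theorem ckClass_translate (a : Fin d → ℝ) (hf : ckClass k d C f) :
    ckClass k d C (fun x => f (x + a)) := by
  refine ⟨fun x l => by simp only [add_right_comm x, hf.1 (x + a) l],
    hf.2.1.comp (contDiff_id.add contDiff_const), fun i hi x => ?_⟩
  rw [iteratedFDeriv_comp_add_right]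
  exact hf.2.2 i hi _

theorem ckClass_abs_le (hf : ckClass k d C f) (x : Fin d → ℝ) : |f x| ≤ C := by
  simpa using hf.2.2 0 (Nat.zero_le _) x

theorem ckClass_norm_fderiv_le (hk : 1 ≤ k) (hf : ckClass k d C f) (x : Fin d → ℝ) :
    ‖fderiv ℝ f x‖ ≤ C := by
  simpa using hf.2.2 1 hk x

/-- Composition with a linear map that preserves the lattices. -/
theorem ckClass_comp_linear {d' : ℕ} (M : (Fin d' → ℝ) →L[ℝ] (Fin d → ℝ))
    (hM : ∀ l : Fin d' → ℤ, ∃ l' : Fin d → ℤ, M (intVec l) = intVec l') (hf : ckClass k d C f) :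
    ckClass k d' (max 1 ‖M‖ ^ k * C) (fun x => f (M x)) := by
  have hC := ckClass_nonneg hf
  refine ⟨fun x l => ?_, hf.2.1.comp M.contDiff, fun i hi x => ?_⟩
  · obtain ⟨l', hl'⟩ := hM l
    simp only [map_add, hl', hf.1 (M x) l']
  · have h : iteratedFDeriv ℝ i (fun x => f (M x)) x = _ :=
      M.iteratedFDeriv_comp_right hf.2.1 x (i := i) (by exact_mod_cast hi)
    rw [h]
    refine (ContinuousMultilinearMap.norm_compContinuousLinearMap_le _ _).trans ?_
    rw [Finset.prod_const, Finset.card_univ, Fintype.card_fin, mul_comm]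
    refine mul_le_mul ?_ (hf.2.2 i hi _) (norm_nonneg _) (by positivity)
    exact (pow_le_pow_left₀ (norm_nonneg _) (le_max_right _ _) i).trans
      (pow_le_pow_right₀ (le_max_left _ _) hi)

/-- Derivatives of a displacement along `u`. -/
theorem norm_iteratedFDeriv_displacement_le (u : Fin d → ℝ) {ε : ℝ} (hε : |ε| ≤ 1) (hC : 0 ≤ C')
    {j : ℕ} (hv : ContDiff ℝ j v) (x : Fin d → ℝ) (hb : ‖iteratedFDeriv ℝ j v x‖ ≤ C')
    (hj : 1 ≤ j) :
    ‖iteratedFDeriv ℝ j (fun x => x + (ε * v x) • u) x‖ ≤ (1 + C' * ‖u‖) ^ j := by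
  have h1 : (fun x : Fin d → ℝ => x + (ε * v x) • u) =
      (ContinuousLinearMap.id ℝ (Fin d → ℝ) : (Fin d → ℝ) → (Fin d → ℝ)) +
        (ContinuousLinearMap.toSpanSingleton ℝ (ε • u) ∘ v) := by
    funext x
    simp [smul_smul, mul_comm]
  have h2 : ‖iteratedFDeriv ℝ j (ContinuousLinearMap.toSpanSingleton ℝ (ε • u) ∘ v) x‖ ≤
      C' * ‖u‖ := by
    refine (ContinuousLinearMap.norm_iteratedFDeriv_comp_left _ hv.contDiffAt le_rfl).trans ?_
    rw [ContinuousLinearMap.norm_toSpanSingleton, norm_smul, Real.norm_eq_abs, mul_comm]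
    refine mul_le_mul hb ?_ (by positivity) hC
    exact mul_le_of_le_one_left (norm_nonneg _) hε
  have h3 : ‖iteratedFDeriv ℝ j
      (ContinuousLinearMap.id ℝ (Fin d → ℝ) : (Fin d → ℝ) → (Fin d → ℝ)) x‖ ≤ 1 := by
    obtain ⟨j, rfl⟩ := Nat.exists_eq_add_of_le' hj
    rw [← norm_iteratedFDeriv_fderiv]
    have h4 : fderiv ℝ (ContinuousLinearMap.id ℝ (Fin d → ℝ) : (Fin d → ℝ) → (Fin d → ℝ)) =
        fun _ => ContinuousLinearMap.id ℝ (Fin d → ℝ) := by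
      funext y; exact ContinuousLinearMap.fderiv _
    rw [h4]
    rcases j with _ | j
    · rw [norm_iteratedFDeriv_zero]
      exact ContinuousLinearMap.norm_id_le
    · rw [iteratedFDeriv_succ_const]
      simp
  rw [h1, iteratedFDeriv_add_apply (ContinuousLinearMap.contDiff _).contDiffAt
    ((ContinuousLinearMap.contDiff _).comp hv).contDiffAt]
  refine (norm_add_le _ _).trans ((add_le_add h3 h2).trans ?_)
  exact le_self_pow₀ (by linarith [mul_nonneg hC (norm_nonneg u)]) (by omega)

/-- Bounds for a composition with a displacement along `u`. -/
theorem norm_iteratedFDeriv_comp_displacement_le {G : Type*} [NormedAddCommGroup G]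
    [NormedSpace ℝ G] {f : (Fin d → ℝ) → G} (u : Fin d → ℝ) {ε : ℝ} (hε : |ε| ≤ 1)
    (hC' : 0 ≤ C') {i : ℕ} (hf : ContDiff ℝ i f) (hfb : ∀ j ≤ i, ∀ x, ‖iteratedFDeriv ℝ j f x‖ ≤ C)
    (hv : ContDiff ℝ i v) (hvb : ∀ j ≤ i, ∀ x, ‖iteratedFDeriv ℝ j v x‖ ≤ C') (x : Fin d → ℝ) :
    ‖iteratedFDeriv ℝ i (fun x => f (x + (ε * v x) • u)) x‖ ≤
      i.factorial * C * (1 + C' * ‖u‖) ^ i := by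
  refine norm_iteratedFDeriv_comp_le (f := fun x => x + (ε * v x) • u) hf ?_ le_rfl x
    (fun j hj => hfb j hj _) fun j hj1 hj => ?_
  · exact contDiff_id.add ((contDiff_const.mul hv).smul contDiff_const)
  · exact norm_iteratedFDeriv_displacement_le u hε hC' (hv.of_le (by exact_mod_cast hj)) x
      (hvb j hj x) hj1

theorem factorial_mul_pow_mono {i k : ℕ} (hik : i ≤ k) (hC : 0 ≤ C) {D : ℝ} (hD : 1 ≤ D) :
    i.factorial * C * D ^ i ≤ k.factorial * C * D ^ k := by
  have h1 : (i.factorial : ℝ) ≤ k.factorial := by exact_mod_cast Nat.factorial_le hik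
  have h2 : D ^ i ≤ D ^ k := pow_le_pow_right₀ hD hik
  have h3 : 0 ≤ D ^ i := by positivity
  gcongr

theorem ckClass_comp_displacement (u : Fin d → ℝ) {ε : ℝ} (hε : |ε| ≤ 1) (hf : ckClass k d C f)
    (hv : ckClass k d C' v) :
    ckClass k d (k.factorial * C * (1 + C' * ‖u‖) ^ k) (fun x => f (x + (ε * v x) • u)) := by
  have hC := ckClass_nonneg hf
  have hC' := ckClass_nonneg hv
  refine ⟨fun x l => ?_, hf.2.1.comp
    (contDiff_id.add ((contDiff_const.mul hv.2.1).smul contDiff_const)), fun i hi x => ?_⟩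
  · simp only [hv.1 x l]
    rw [add_right_comm, hf.1]
  · refine (norm_iteratedFDeriv_comp_displacement_le u hε hC'
      (hf.2.1.of_le (by exact_mod_cast hi)) (fun j hj => hf.2.2 j (hj.trans hi))
      (hv.2.1.of_le (by exact_mod_cast hi)) (fun j hj => hv.2.2 j (hj.trans hi)) x).trans ?_
    exact factorial_mul_pow_mono hi hC (by linarith [mul_nonneg hC' (norm_nonneg u)])

/-- Derivatives along `u`. -/
theorem ckClass_fderiv (u : Fin d → ℝ) (hf : ckClass (k + 1) d C f) :
    ckClass k d (‖u‖ * C) (fun x => fderiv ℝ f x u) := by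
  have h1 : ContDiff ℝ k (fderiv ℝ f) := hf.2.1.fderiv_right (by norm_cast)
  refine ⟨fun x l => ?_, h1.clm_apply contDiff_const, fun i hi x => ?_⟩
  · have h2 : (fun y => f (y + intVec l)) = f := funext fun y => hf.1 y l
    have h3 := fderiv_comp_add_right (𝕜 := ℝ) (f := f) (x := x) (intVec l)
    rw [h2] at h3
    change fderiv ℝ f (x + intVec l) u = fderiv ℝ f x u
    rw [← h3]
  · refine (norm_iteratedFDeriv_clm_apply_const h1.contDiffAt (by exact_mod_cast hi)).trans ?_
    rw [norm_iteratedFDeriv_fderiv]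
    exact mul_le_mul_of_nonneg_left (hf.2.2 (i + 1) (by omega) x) (norm_nonneg u)

/-- The iterated derivative of `f` along `u`. -/
noncomputable def dirDeriv (u : Fin d → ℝ) (f : (Fin d → ℝ) → ℝ) : ℕ → (Fin d → ℝ) → ℝ
  | 0 => f
  | l + 1 => fun x => fderiv ℝ (dirDeriv u f l) x u

theorem ckClass_dirDeriv (u : Fin d → ℝ) {l : ℕ} (hf : ckClass (k + l) d C f) :
    ckClass k d (‖u‖ ^ l * C) (dirDeriv u f l) := by
  induction l generalizing k with
  | zero => simpa [dirDeriv] using hf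
  | succ l ih =>
    have h := ckClass_fderiv u (ih (k := k + 1) (by rwa [add_right_comm, add_assoc]))
    rw [← mul_assoc, ← pow_succ'] at h
    exact h

/-- Taylor's formula along `u`, with a remainder in the class `C^k`. -/
theorem ckClass_taylor (u : Fin d → ℝ) {L : ℕ} (hf : ckClass (k + (L + 1)) d C f) {ε : ℝ}
    (hε : |ε| ≤ 1) (hv : ckClass k d C' v) :
    ∃ w, ckClass k d (k.factorial * (‖u‖ ^ (L + 1) * C) * (1 + C' * ‖u‖) ^ k) w ∧
      ∀ x, f (x + (ε * v x) • u) = ∑ l ∈ Finset.range (L + 1),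
        (ε * v x) ^ l * ((l.factorial : ℝ)⁻¹ * dirDeriv u f l x) + (ε * v x) ^ (L + 1) * w x := by
  have hD := ckClass_dirDeriv u hf
  have hdiff : ∀ l < L + 1, Differentiable ℝ (dirDeriv u f l) := fun l hl =>
    (ckClass_dirDeriv u (k := 1) (ckClass_mono hf (by omega) le_rfl)).2.1.differentiable one_ne_zero
  set D := dirDeriv u f (L + 1) with hDdef
  have hC0 := ckClass_nonneg hD
  have hC'0 := ckClass_nonneg hv
  set F : ℝ → (Fin d → ℝ) → ℝ := fun s x =>
    ((1 - s) ^ L * ((L.factorial : ℝ))⁻¹) * D (x + (s * ε * v x) • u) with hF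
  have hFc : ContDiff ℝ k fun z : ℝ × (Fin d → ℝ) => F z.1 z.2 := by
    refine ContDiff.mul (by fun_prop) (hD.2.1.comp ?_)
    refine contDiff_snd.add (ContDiff.fun_smul ?_ contDiff_const)
    exact (contDiff_fst.mul contDiff_const).mul (hv.2.1.comp contDiff_snd)
  have hsε : ∀ s ∈ Set.Icc (0 : ℝ) 1, |s * ε| ≤ 1 := fun s hs => by
    rw [abs_mul, abs_of_nonneg hs.1]
    exact mul_le_one₀ hs.2 (abs_nonneg _) hε
  have hFcl : ∀ s ∈ Set.Icc (0 : ℝ) 1,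
      ckClass k d (k.factorial * (‖u‖ ^ (L + 1) * C) * (1 + C' * ‖u‖) ^ k) (F s) := by
    intro s hs
    obtain ⟨h1, h2, h3⟩ := ckClass_comp_displacement u (hsε s hs) hD hv
    refine ⟨fun x l => ?_, contDiff_const.mul h2, fun i hi x => ?_⟩
    · have := h1 x l
      simp only [hF] at this ⊢
      rw [this]
    · have h4 : iteratedFDeriv ℝ i (F s) x = ((1 - s) ^ L * ((L.factorial : ℝ))⁻¹) •
          iteratedFDeriv ℝ i (fun x => D (x + (s * ε * v x) • u)) x :=
        iteratedFDeriv_const_smul_apply (a := (1 - s) ^ L * ((L.factorial : ℝ))⁻¹)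
          (f := fun x => D (x + (s * ε * v x) • u)) (h2.of_le (by exact_mod_cast hi)).contDiffAt
      rw [h4, norm_smul]
      refine (mul_le_of_le_one_left (norm_nonneg _) ?_).trans (h3 i hi x)
      rw [Real.norm_of_nonneg (mul_nonneg (pow_nonneg (by linarith [hs.2]) _) (by positivity))]
      refine mul_le_one₀ (pow_le_one₀ (by linarith [hs.2]) (by linarith [hs.1])) (by positivity) ?_
      exact inv_le_one_of_one_le₀ (by exact_mod_cast Nat.one_le_iff_ne_zero.2 (Nat.factorial_ne_zero L))
  have hprob : IsProbabilityMeasure (volume.restrict (Set.Icc (0 : ℝ) 1)) := ⟨by simp⟩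
  have hae : ∀ᵐ s ∂(volume.restrict (Set.Icc (0 : ℝ) 1)), s ∈ Set.Icc (0 : ℝ) 1 :=
    ae_restrict_mem measurableSet_Icc
  have key := contDiff_integral (μ := volume.restrict (Set.Icc (0 : ℝ) 1)) (F := F) (n := k)
    (C := k.factorial * (‖u‖ ^ (L + 1) * C) * (1 + C' * ‖u‖) ^ k)
    (hae.mono fun s hs => (hFcl s hs).2.1)
    (fun i hi x => (continuous_iteratedFDeriv_snd hFc hi x).aestronglyMeasurable)
    (hae.mono fun s hs => (hFcl s hs).2.2)
  refine ⟨fun x => ∫ s in Set.Icc (0 : ℝ) 1, F s x, ⟨fun x l => ?_, key.1, fun i hi x => ?_⟩,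
    fun x => ?_⟩
  · refine setIntegral_congr_fun measurableSet_Icc fun s hs => ?_
    exact (hFcl s hs).1 x l
  · rw [key.2 i hi]
    refine (norm_integral_le_of_norm_le_const
      (hae.mono fun s hs => (hFcl s hs).2.2 i hi x)).trans ?_
    simp
  · have hline : ∀ l < L + 1, ∀ s : ℝ, HasDerivAt
        (fun s => (ε * v x) ^ l * dirDeriv u f l (x + (s * (ε * v x)) • u))
        ((ε * v x) ^ (l + 1) * dirDeriv u f (l + 1) (x + (s * (ε * v x)) • u)) s := by
      intro l hl s
      have h1 := ((hdiff l hl) (x + (s * (ε * v x)) • u)).hasFDerivAt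
      have h2 : HasDerivAt (fun s : ℝ => x + (s * (ε * v x)) • u) ((ε * v x) • u) s := by
        have := (((hasDerivAt_id s).mul_const (ε * v x)).smul_const u).const_add x
        simpa using this
      have h3 := (h1.comp_hasDerivAt s h2).const_mul ((ε * v x) ^ l)
      refine h3.congr_deriv ?_
      rw [map_smul, dirDeriv, smul_eq_mul, pow_succ]
      ring
    have h4 := taylor_sum_add_integral (M := L)
      (φ := fun l s => (ε * v x) ^ l * dirDeriv u f l (x + (s * (ε * v x)) • u))
      (fun l hl s _ => (hline l hl s).hasDerivWithinAt) (by
        refine Continuous.continuousOn (continuous_const.mul (hD.2.1.continuous.comp ?_))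
        exact continuous_const.add ((continuous_id.mul continuous_const).smul continuous_const))
    simp only [pow_zero, one_mul, zero_mul, zero_smul, add_zero, smul_eq_mul] at h4
    change f _ = _ at h4
    rw [h4, ← integral_const_mul]
    congr 1
    · exact Finset.sum_congr rfl fun l _ => by ring
    · refine integral_congr_ae (Eventually.of_forall fun s => ?_)
      simp only [hF, hDdef, mul_assoc]
      ring_nf

end CkClass

/-! ### Implicit functions in the classes `C^k` -/

section CkImplicit

variable {d k : ℕ} {a b w : (Fin d → ℝ) → ℝ}

/-- The chain rule for the solution of an implicit equation. -/
theorem fderiv_eq_of_implicit {u : Fin d → ℝ} {ε : ℝ} (ha : Differentiable ℝ a)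
    (hb : Differentiable ℝ b) (hw : Differentiable ℝ w)
    (heq : ∀ x, w x = a x + b (x + (ε * w x) • u)) (x : Fin d → ℝ) :
    fderiv ℝ w x = (fderiv ℝ a x + fderiv ℝ b (x + (ε * w x) • u)) +
      fderiv ℝ b (x + (ε * w x) • u) (ε • u) • fderiv ℝ w x := by
  have hζ : HasFDerivAt (fun x => x + (ε * w x) • u)
      (ContinuousLinearMap.id ℝ (Fin d → ℝ) + (ε • fderiv ℝ w x).smulRight u) x :=
    (hasFDerivAt_id x).add (((hw x).hasFDerivAt.const_mul ε).smul_const u)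
  have h1 := (ha x).hasFDerivAt.add ((hb (x + (ε * w x) • u)).hasFDerivAt.comp x hζ)
  have h2 : HasFDerivAt w (fderiv ℝ a x + (fderiv ℝ b (x + (ε * w x) • u)).comp
      (ContinuousLinearMap.id ℝ (Fin d → ℝ) + (ε • fderiv ℝ w x).smulRight u)) x := by
    refine h1.congr_of_eventuallyEq (Eventually.of_forall fun y => ?_)
    exact heq y
  ext v
  have h3 := DFunLike.congr_fun h2.fderiv v
  simp at h3 ⊢
  linear_combination h3

/-- Bounds for the solution of an implicit equation. The derivative of highest order occurs
on both sides of the differentiated equation, but on the right with a small factor. -/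
theorem exists_bound_implicit (u : Fin d → ℝ) (C C' : ℝ) {j : ℕ} (hj : j ≤ k) :
    ∃ B : ℝ, ∀ ε : ℝ, |ε| ≤ 1 → |ε| * (C' * ‖u‖) ≤ 1 / 2 → ∀ a b w, ckClass k d C a →
      ckClass k d C' b → ContDiff ℝ k w → (∀ x, w x = a x + b (x + (ε * w x) • u)) →
      ∀ i ≤ j, ∀ x, ‖iteratedFDeriv ℝ i w x‖ ≤ B := by
  induction j with
  | zero =>
    refine ⟨C + C', fun ε _ _ a b w ha hb _ heq i hi x => ?_⟩
    rw [Nat.le_zero.1 hi, norm_iteratedFDeriv_zero, heq]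
    exact (abs_add_le _ _).trans (add_le_add (ckClass_abs_le ha _) (ckClass_abs_le hb _))
  | succ j ih =>
    obtain ⟨B, hB⟩ := ih (by omega)
    set K : ℝ := j.factorial * C' * (1 + |B| * ‖u‖) ^ j with hK
    refine ⟨max |B| (2 * (C + K + 2 ^ j * (‖u‖ * K * |B|))),
      fun ε hε1 hε2 a b w ha hb hw heq i hi x => ?_⟩
    have hlow : ∀ i ≤ j, ∀ x, ‖iteratedFDeriv ℝ i w x‖ ≤ |B| := fun i hi x =>
      (hB ε hε1 hε2 a b w ha hb hw heq i hi x).trans (le_abs_self B)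
    rcases Nat.lt_or_ge i (j + 1) with hij | hij
    · exact (hlow i (by omega) x).trans (le_max_left _ _)
    obtain rfl : i = j + 1 := le_antisymm hi hij
    refine le_trans ?_ (le_max_right _ _)
    have hC' := ckClass_nonneg hb
    have hk0 : (k : WithTop ℕ∞) ≠ 0 := by
      have : k ≠ 0 := by omega
      exact_mod_cast this
    have hjk : ((j : WithTop ℕ∞) + 1) ≤ k := by exact_mod_cast hj
    have hda : ContDiff ℝ j (fderiv ℝ a) := ha.2.1.fderiv_right hjk
    have hdb : ContDiff ℝ j (fderiv ℝ b) := hb.2.1.fderiv_right hjk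
    have hdw : ContDiff ℝ j (fderiv ℝ w) := hw.fderiv_right hjk
    have hwj : ContDiff ℝ j w := hw.of_le (by exact_mod_cast (by omega : j ≤ k))
    have hdbb : ∀ i ≤ j, ∀ x, ‖iteratedFDeriv ℝ i (fderiv ℝ b) x‖ ≤ C' := fun i hi x => by
      rw [norm_iteratedFDeriv_fderiv]
      exact hb.2.2 _ (by omega) x
    have hζ : ContDiff ℝ j fun x => x + (ε * w x) • u :=
      contDiff_id.add ((contDiff_const.mul hwj).smul contDiff_const)
    have hdbζ : ContDiff ℝ j fun x => fderiv ℝ b (x + (ε * w x) • u) := hdb.comp hζ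
    have hdbζb : ∀ i ≤ j, ∀ x,
        ‖iteratedFDeriv ℝ i (fun x => fderiv ℝ b (x + (ε * w x) • u)) x‖ ≤ K := by
      intro i hi x
      refine (norm_iteratedFDeriv_comp_displacement_le u hε1 (abs_nonneg B)
        (hdb.of_le (by exact_mod_cast hi)) (fun l hl => hdbb l (hl.trans hi))
        (hwj.of_le (by exact_mod_cast hi)) (fun l hl => hlow l (hl.trans hi)) x).trans ?_
      exact factorial_mul_pow_mono hi hC' (by
        linarith [mul_nonneg (abs_nonneg B) (norm_nonneg u)])
    have hK0 : 0 ≤ K := by positivity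
    set Q : (Fin d → ℝ) → ℝ := fun x => fderiv ℝ b (x + (ε * w x) • u) (ε • u) with hQ
    have hQc : ContDiff ℝ j Q := hdbζ.clm_apply contDiff_const
    have hεu : ‖ε • u‖ = |ε| * ‖u‖ := by rw [norm_smul, Real.norm_eq_abs]
    have hQb : ∀ i ≤ j, ∀ x, ‖iteratedFDeriv ℝ i Q x‖ ≤ ‖u‖ * K := by
      intro i hi x
      refine (norm_iteratedFDeriv_clm_apply_const hdbζ.contDiffAt (by exact_mod_cast hi)).trans ?_
      refine mul_le_mul ?_ (hdbζb i hi x) (norm_nonneg _) (norm_nonneg _)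
      rw [hεu]
      exact mul_le_of_le_one_left (norm_nonneg _) hε1
    have hQ0 : ∀ x, ‖iteratedFDeriv ℝ 0 Q x‖ ≤ 1 / 2 := by
      intro x
      rw [norm_iteratedFDeriv_zero]
      refine (ContinuousLinearMap.le_opNorm _ _).trans ?_
      rw [hεu]
      have := ckClass_norm_fderiv_le (by omega : 1 ≤ k) hb (x + (ε * w x) • u)
      calc _ ≤ C' * (|ε| * ‖u‖) := by gcongr
        _ = |ε| * (C' * ‖u‖) := by ring
        _ ≤ _ := hε2
    have hdw' : fderiv ℝ w = (fderiv ℝ a + fun x => fderiv ℝ b (x + (ε * w x) • u)) +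
        fun x => Q x • fderiv ℝ w x :=
      funext fun x => fderiv_eq_of_implicit (ha.2.1.differentiable hk0)
        (hb.2.1.differentiable hk0) (hw.differentiable hk0) heq x
    have hmain : ‖iteratedFDeriv ℝ j (fderiv ℝ w) x‖ ≤ (C + K) +
        (1 / 2 * ‖iteratedFDeriv ℝ j (fderiv ℝ w) x‖ + 2 ^ j * (‖u‖ * K * |B|)) := by
      conv_lhs => rw [hdw']
      have hQw : ContDiff ℝ j fun x => Q x • fderiv ℝ w x := hQc.smul hdw
      have hS : ContDiff ℝ j (fderiv ℝ a + fun x => fderiv ℝ b (x + (ε * w x) • u)) := hda.add hdbζ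
      rw [iteratedFDeriv_add_apply hS.contDiffAt hQw.contDiffAt,
        iteratedFDeriv_add_apply hda.contDiffAt hdbζ.contDiffAt]
      refine (norm_add_le _ _).trans (add_le_add ((norm_add_le _ _).trans (add_le_add ?_ ?_)) ?_)
      · rw [norm_iteratedFDeriv_fderiv]
        exact ha.2.2 _ (by omega) x
      · exact hdbζb j le_rfl x
      · refine (norm_iteratedFDeriv_smul_le hQc hdw x le_rfl).trans ?_
        rw [Finset.sum_range_succ', add_comm]
        refine add_le_add ?_ ?_
        · simp only [Nat.choose_zero_right, Nat.cast_one, one_mul, Nat.sub_zero]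
          exact mul_le_mul_of_nonneg_right (hQ0 x) (norm_nonneg _)
        · calc ∑ i ∈ Finset.range j, (j.choose (i + 1) : ℝ) * ‖iteratedFDeriv ℝ (i + 1) Q x‖ *
                ‖iteratedFDeriv ℝ (j - (i + 1)) (fderiv ℝ w) x‖
              ≤ ∑ i ∈ Finset.range j, (j.choose (i + 1) : ℝ) * (‖u‖ * K * |B|) := by
                refine Finset.sum_le_sum fun i hi => ?_
                have hi := Finset.mem_range.1 hi
                rw [mul_assoc]
                refine mul_le_mul_of_nonneg_left ?_ (by positivity)
                refine mul_le_mul (hQb _ (by omega) x) ?_ (norm_nonneg _) (by positivity)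
                rw [norm_iteratedFDeriv_fderiv]
                exact hlow _ (by omega) x
            _ ≤ _ := by
                rw [← Finset.sum_mul]
                refine mul_le_mul_of_nonneg_right ?_ (by positivity)
                have h := Nat.sum_range_choose j
                rw [Finset.sum_range_succ'] at h
                have h' : ∑ i ∈ Finset.range j, j.choose (i + 1) ≤ 2 ^ j := by omega
                exact_mod_cast h'
    rw [← norm_iteratedFDeriv_fderiv]
    linarith

/-- The implicit function theorem in the classes `C^k`, along `u`. -/
theorem ckClass_implicit (u : Fin d → ℝ) (hk : 1 ≤ k) (C C' : ℝ) :
    ∃ C'' : ℝ, ∀ᶠ ε in 𝓝 (0 : ℝ), ∀ a b, ckClass k d C a → ckClass k d C' b →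
      ∃ w, ckClass k d C'' w ∧ ∀ x, w x = a x + b (x + (ε * w x) • u) := by
  obtain ⟨B, hB⟩ := exists_bound_implicit (d := d) u C C' (le_refl k)
  refine ⟨B, ?_⟩
  filter_upwards [eventually_nhds_abs_mul_le 1 one_pos,
    eventually_nhds_abs_mul_le (C' * ‖u‖) (by norm_num : (0 : ℝ) < 1 / 2)] with ε hε1 hε2 a b ha hb
  rw [mul_one] at hε1
  have hk0 : (k : WithTop ℕ∞) ≠ 0 := by exact_mod_cast (by omega : k ≠ 0)
  have hlip : ∀ x (s t : ℝ), |b (x + (ε * s) • u) - b (x + (ε * t) • u)| ≤ 1 / 2 * |s - t| := by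
    intro x s t
    have h3 := Convex.norm_image_sub_le_of_norm_fderiv_le (𝕜 := ℝ) (s := Set.univ) (f := b)
      (x := x + (ε * t) • u) (y := x + (ε * s) • u)
      (fun y _ => (hb.2.1.differentiable hk0) y) (fun y _ => ckClass_norm_fderiv_le hk hb y)
      convex_univ (Set.mem_univ _) (Set.mem_univ _)
    rw [add_sub_add_left_eq_sub, ← sub_smul, ← mul_sub, norm_smul, norm_mul] at h3
    simp only [Real.norm_eq_abs] at h3
    calc _ ≤ _ := h3
      _ = |ε| * (C' * ‖u‖) * |s - t| := by ring
      _ ≤ _ := by gcongr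
  have huniq : ∀ x (s t : ℝ), s = a x + b (x + (ε * s) • u) → t = a x + b (x + (ε * t) • u) →
      s = t := by
    intro x s t hs ht
    have h := hlip x s t
    have h1 : b (x + (ε * s) • u) - b (x + (ε * t) • u) = s - t := by linarith
    rw [h1] at h
    have : |s - t| = 0 := le_antisymm (by linarith) (abs_nonneg _)
    linarith [abs_eq_zero.1 this]
  have hex : ∀ x, ∃ s : ℝ, s = a x + b (x + (ε * s) • u) := by
    intro x
    have hcon : ContractingWith (1 / 2) fun s : ℝ => a x + b (x + (ε * s) • u) := by
      refine ⟨by rw [← NNReal.coe_lt_coe]; norm_num, LipschitzWith.of_dist_le_mul fun s t => ?_⟩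
      rw [Real.dist_eq, Real.dist_eq, add_sub_add_left_eq_sub]
      simpa using hlip x s t
    exact ⟨_, hcon.fixedPoint_isFixedPt.symm⟩
  choose w hw using hex
  have hsmooth : ContDiff ℝ k w := by
    refine contDiff_iff_contDiffAt.2 fun x => ?_
    set Ψ : (Fin d → ℝ) × ℝ → ℝ := fun z => z.2 - (a z.1 + b (z.1 + (ε * z.2) • u)) with hΨ
    have hΨc : ContDiff ℝ k Ψ := by
      refine contDiff_snd.sub ((ha.2.1.comp contDiff_fst).add (hb.2.1.comp ?_))
      exact contDiff_fst.add ((contDiff_const.mul contDiff_snd).fun_smul contDiff_const)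
    have hΨ0 : ∀ y, Ψ (y, w y) = 0 := fun y => by
      simp only [hΨ]; linarith [hw y]
    refine contDiffAt_of_implicit (by omega) hΨc.contDiffAt ?_ ?_
    · have h1 : HasDerivAt (fun t : ℝ => Ψ (x, w x) + 0 * t) 0 0 := by
        simpa using hasDerivAt_const (0 : ℝ) (Ψ (x, w x))
      have h2 : HasDerivAt (fun s : ℝ => Ψ (x, s)) (fderiv ℝ Ψ (x, w x) (0, 1)) (w x) := by
        have h3 := ((hΨc.differentiable hk0) (x, w x)).hasFDerivAt
        exact h3.comp_hasDerivAt (w x) ((hasDerivAt_const _ x).prodMk (hasDerivAt_id _))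
      have h4 : HasDerivAt (fun s : ℝ => Ψ (x, s))
          (1 - fderiv ℝ b (x + (ε * w x) • u) (ε • u)) (w x) := by
        have h5 : HasDerivAt (fun s : ℝ => x + (ε * s) • u) (ε • u) (w x) := by
          simpa using (((hasDerivAt_id (w x)).const_mul ε).smul_const u).const_add x
        have h6 := ((hb.2.1.differentiable hk0) (x + (ε * w x) • u)).hasFDerivAt.comp_hasDerivAt
          (w x) h5
        exact (hasDerivAt_id (w x)).sub (h6.const_add (a x))
      rw [h2.unique h4]
      have h7 : |fderiv ℝ b (x + (ε * w x) • u) (ε • u)| ≤ 1 / 2 := by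
        refine ((fderiv ℝ b (x + (ε * w x) • u)).le_opNorm _).trans ?_
        rw [norm_smul, Real.norm_eq_abs]
        have := ckClass_norm_fderiv_le hk hb (x + (ε * w x) • u)
        calc _ ≤ C' * (|ε| * ‖u‖) := by gcongr
          _ = |ε| * (C' * ‖u‖) := by ring
          _ ≤ _ := hε2
      have := (abs_le.1 h7).2
      intro h0
      linarith
    · refine Eventually.of_forall fun v hv => ?_
      rw [hΨ0] at hv
      refine huniq v.1 _ _ ?_ (hw v.1)
      simp only [hΨ] at hv
      linarith
  refine ⟨w, ⟨fun x l => ?_, hsmooth, hB ε hε1 hε2 a b w ha hb hsmooth hw⟩, hw⟩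
  refine huniq x _ _ ?_ (hw x)
  conv_lhs => rw [hw, ha.1, add_right_comm, hb.1]

end CkImplicit

/-! ### The scale of the classes `C^k` -/

section CkScale

variable {e : ℕ} {A : Matrix.SpecialLinearGroup (Fin (e + 1)) ℤ} {ω : Fin e → ℝ}
  {Ω : Fin (e + 1) → ℝ} {α₀ : ℝ} {L : Fin (e + 1) → ℤ}

theorem act_inv_add_smul (A : Matrix.SpecialLinearGroup (Fin (e + 1)) ℤ) (y : Fin (e + 1) → ℝ)
    (t : ℝ) (Ω : Fin (e + 1) → ℝ) : act A⁻¹ y + t • Ω = act A⁻¹ (y + t • act A Ω) := by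
  rw [act_add, act_smul, act_inv_act]

/-- Functions `f` such that `f ∘ A⁻¹` is `C^{s t}`, for an increasing sequence `s` of orders of
differentiability. -/
def ckScale (A : Matrix.SpecialLinearGroup (Fin (e + 1)) ℤ) (s : ℕ → ℕ) (t : ℕ) (C : ℝ)
    (f : (Fin (e + 1) → ℝ) → ℝ) : Prop :=
  ckClass (s t) (e + 1) C fun y => f (act A⁻¹ y)

/-- The linear map `t ↦ (0, t)` from `ℝ` to `ℝ^{d-1} × ℝ`. -/
noncomputable def slowCLM (e : ℕ) : (Fin 1 → ℝ) →L[ℝ] (Fin (e + 1) → ℝ) :=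
  (ContinuousLinearMap.proj (R := ℝ) (φ := fun _ : Fin 1 => ℝ) 0).smulRight
    (Fin.snoc (0 : Fin e → ℝ) 1 : Fin (e + 1) → ℝ)

theorem slowCLM_apply (y : Fin 1 → ℝ) :
    slowCLM e y = (Fin.snoc (0 : Fin e → ℝ) (y 0) : Fin (e + 1) → ℝ) := by
  rw [snoc_zero_add_smul]
  rfl

theorem slowCLM_intVec (l : Fin 1 → ℤ) :
    slowCLM e (intVec l) = intVec (Fin.snoc (0 : Fin e → ℤ) (l 0) : Fin (e + 1) → ℤ) := by
  rw [slowCLM_apply]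
  funext i
  refine Fin.lastCases ?_ (fun j => ?_) i <;> simp [intVec]

/-- The classes `C^{s t}`, for a sequence `s` that grows fast enough to pay for the cohomology equation
and, if `d ≥ 2`, for derivatives along `Ω`. For `d = 1` the sequence may be constant. -/
theorem regularityScale_ck {s : ℕ → ℕ} {c k : ℕ} (hs : Monotone s) (hs1 : 1 ≤ s 0)
    (hsc : ∀ t, s t + c ≤ s (t + c)) (hsL : e ≠ 0 → ∀ t l, s t + l ≤ s (t + l)) (hk : k ≤ s 0)
    (hω : TameDivisors ω c)
    (hθ : act A (α₀ • Ω) = (Fin.snoc ω 0 : Fin (e + 1) → ℝ) + intVec L) :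
    RegularityScale A ω Ω α₀ c (ckClass k) (ckScale A s) := by
  have hst : ∀ t, 1 ≤ s t := fun t => hs1.trans (hs (Nat.zero_le t))
  refine
    { mono := fun h ht hC => ckClass_mono h (hs ht) hC
      const := fun t a => ckClass_const _ a
      add := fun hf hg => ckClass_add hf hg
      mul := fun t => ⟨2 ^ s t, fun hf hg => ckClass_mul hf hg⟩
      translate := ?_
      fderiv_le := ?_
      bound := ?_
      comp := ?_
      taylor := ?_
      implicit := ?_
      cohomology := ?_
      cohomology_eq := ?_
      resonant := ?_
      class_mono := fun h hC => ckClass_mono h le_rfl hC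
      toClass := ?_
      toClass_act := ⟨1, fun {C f} hf => ckClass_mono hf hk (one_mul C).ge⟩
      toClass_circle := ?_ }
  · intro t C f a hf
    have := ckClass_translate (act A a) hf
    simpa only [ckScale, act_add, act_inv_act] using this
  · refine ⟨‖actCLM A‖, fun {C f} hf => ?_⟩
    have hd : Differentiable ℝ fun y => f (act A⁻¹ y) :=
      hf.2.1.differentiable (by exact_mod_cast (by omega : s 0 ≠ 0))
    have h1 : ∀ x, HasFDerivAt f ((fderiv ℝ (fun y => f (act A⁻¹ y)) (act A x)).comp (actCLM A)) x := by
      intro x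
      have h2 := (hd (act A x)).hasFDerivAt.comp x (actCLM A).hasFDerivAt
      refine h2.congr_of_eventuallyEq (Eventually.of_forall fun y => ?_)
      simp
    refine ⟨fun x => (h1 x).differentiableAt, fun x => ?_⟩
    rw [(h1 x).fderiv, mul_comm]
    refine (ContinuousLinearMap.opNorm_comp_le _ _).trans ?_
    exact mul_le_mul_of_nonneg_right (ckClass_norm_fderiv_le hs1 hf _) (norm_nonneg _)
  · intro C f hf x
    simpa using ckClass_abs_le hf (act A x)
  · intro C C'
    refine ⟨(s 0).factorial * C * (1 + C' * ‖act A Ω‖) ^ s 0, ?_⟩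
    filter_upwards [eventually_nhds_abs_mul_le 1 one_pos] with ε hε f v hf hv _
    rw [mul_one] at hε
    have := ckClass_comp_displacement (act A Ω) hε (ckClass_mono hf (hs zero_le_one) le_rfl) hv
    simpa only [ckScale, act_inv_add_smul] using this
  · intro r l C f hf hl hlr
    obtain ⟨l, rfl⟩ := Nat.exists_eq_add_of_le' hl
    by_cases he : e = 0
    · -- no displacement takes place
      refine ⟨fun i => if i = 0 then f else fun _ => 0, by simp, fun i hi => ?_, fun C₂ => ⟨0, ?_⟩⟩
      · by_cases hi0 : i = 0
        · subst hi0
          exact ⟨C, by simpa using hf⟩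
        · refine ⟨|0|, ?_⟩
          simp only [hi0, if_false]
          exact ckClass_const _ 0
      · refine Eventually.of_forall fun ε v _ hfv => ⟨fun _ => 0, ?_, fun x => ?_⟩
        · simpa [ckScale] using ckClass_const (d := e + 1) (s 0) 0
        · rw [Finset.sum_range_succ']
          rcases hfv with h | h
          · simp [h he]
          · simp [h he]
    · set u := act A Ω with hu
      set g : (Fin (e + 1) → ℝ) → ℝ := fun y => f (act A⁻¹ y) with hg
      refine ⟨fun i x => ((i.factorial : ℝ))⁻¹ * dirDeriv u g i (act A x), ?_, fun i hi => ?_,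
        fun C₂ => ⟨(s 0).factorial * (‖u‖ ^ (l + 1) * C) * (1 + C₂ * ‖u‖) ^ s 0, ?_⟩⟩
      · funext x
        simp [dirDeriv, hg]
      · have h1 : s (r - i) + i ≤ s r := by
          have := hsL he (r - i) i
          rwa [Nat.sub_add_cancel (by omega)] at this
        have h2 := ckClass_mul (ckClass_const (s (r - i)) ((i.factorial : ℝ))⁻¹)
          (ckClass_dirDeriv u (ckClass_mono hf h1 le_rfl))
        refine ⟨2 ^ s (r - i) * |((i.factorial : ℝ))⁻¹| * (‖u‖ ^ i * C), ?_⟩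
        simpa only [ckScale, act_act_inv] using h2
      · filter_upwards [eventually_nhds_abs_mul_le 1 one_pos] with ε hε v hv _
        rw [mul_one] at hε
        have h1 : s 0 + (l + 1) ≤ s r :=
          (hsL he 0 (l + 1)).trans (hs (by omega))
        obtain ⟨w, hw, heq⟩ := ckClass_taylor u (ckClass_mono hf h1 le_rfl) hε hv
        refine ⟨fun x => w (act A x), by simpa only [ckScale, act_act_inv] using hw, fun x => ?_⟩
        have h2 := heq (act A x)
        simp only [act_inv_act] at h2
        rw [← h2, hu, ← act_inv_add_smul, act_inv_act]
  · intro C C'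
    obtain ⟨C'', h⟩ := ckClass_implicit (act A Ω) hs1 C C'
    refine ⟨C'', ?_⟩
    filter_upwards [h] with ε hε a b ha hb _
    obtain ⟨w, hw, heq⟩ := hε _ _ ha (ckClass_mono hb (hs zero_le_one) le_rfl)
    refine ⟨fun x => w (act A x), by simpa only [ckScale, act_act_inv] using hw, fun x => ?_⟩
    have h2 := heq (act A x)
    rwa [act_inv_act, ← act_inv_add_smul, act_inv_act] at h2
  · intro t C P hP
    exact ⟨_, ckClass_cohomologySolution hω (hst _) (ckClass_mono hP (hsc (t + 1)) le_rfl)⟩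
  · intro C P hP x
    refine cohomologySolution_sub hω (r := s (1 + c)) ?_ hP hθ x
    exact (Nat.add_le_add_right (hst 1) c).trans (hsc 1)
  · intro t C P hP
    refine ⟨C, ?_⟩
    have := ckClass_resonantPart (hst t) hP
    simpa only [ckScale, act_act_inv] using this
  · refine ⟨max 1 ‖actCLM A‖ ^ s 0, fun {C f} hf => ?_⟩
    have h := ckClass_comp_linear (actCLM A) (fun l => ⟨_, act_intVec A l⟩) hf
    simp only [actCLM_apply, act_inv_act] at h
    exact ckClass_mono h hk le_rfl
  · refine ⟨max 1 ‖slowCLM e‖ ^ s 0, fun {C f} hf => ?_⟩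
    have h := ckClass_comp_linear (slowCLM e) (fun l => ⟨_, slowCLM_intVec l⟩) hf
    simp only [slowCLM_apply] at h
    exact ckClass_mono h hk le_rfl

end CkScale

/-! ### Expansion of the perturbation in the small parameter -/

section Interval

variable {I : Set ℝ}

theorem neBot_nhdsWithin_diff (hI : I.OrdConnected) (hI0 : (0 : ℝ) ∈ I) (hI1 : I.Nontrivial) :
    (𝓝[I \ {0}] (0 : ℝ)).NeBot := by
  have h := hI.isPreconnected.preperfect_of_nontrivial hI1 0 hI0
  rw [accPt_principal_iff_nhdsWithin] at h
  exact h

theorem uniqueDiffWithinAt_interval (hI : I.OrdConnected) (hI1 : I.Nontrivial) {ε : ℝ}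
    (hε : ε ∈ I) : UniqueDiffWithinAt ℝ I ε := by
  obtain ⟨a, ha, b, hb, hab⟩ := hI1.exists_lt
  refine uniqueDiffWithinAt_convex hI.convex ⟨(a + b) / 2, ?_⟩ (subset_closure hε)
  refine mem_interior.2 ⟨Set.Ioo a b, fun x hx => hI.out ha hb (Set.Ioo_subset_Icc_self hx),
    isOpen_Ioo, by constructor <;> linarith⟩

/-- A relative compact neighbourhood of `0` in an interval. -/
theorem exists_Icc_nhdsWithin (hI : I.OrdConnected) (hI0 : (0 : ℝ) ∈ I) :
    ∃ a b : ℝ, a ≤ 0 ∧ 0 ≤ b ∧ Set.Icc a b ⊆ I ∧ ∀ᶠ ε in 𝓝[I] (0 : ℝ), ε ∈ Set.Icc a b := by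
  obtain ⟨b, hbI, hb0, hb⟩ : ∃ b ∈ I, 0 ≤ b ∧ ∀ᶠ ε in 𝓝[I] (0 : ℝ), ε ≤ b := by
    by_cases h : ∃ b ∈ I, 0 < b
    · obtain ⟨b, hbI, hb⟩ := h
      exact ⟨b, hbI, hb.le, nhdsWithin_le_nhds (Iic_mem_nhds hb)⟩
    · push Not at h
      exact ⟨0, hI0, le_rfl, eventually_mem_nhdsWithin.mono h⟩
  obtain ⟨a, haI, ha0, ha⟩ : ∃ a ∈ I, a ≤ 0 ∧ ∀ᶠ ε in 𝓝[I] (0 : ℝ), a ≤ ε := by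
    by_cases h : ∃ a ∈ I, a < 0
    · obtain ⟨a, haI, ha⟩ := h
      exact ⟨a, haI, ha.le, nhdsWithin_le_nhds (Ici_mem_nhds ha)⟩
    · push Not at h
      exact ⟨0, hI0, le_rfl, eventually_mem_nhdsWithin.mono h⟩
  exact ⟨a, b, ha0, hb0, hI.out haI hbI, ha.and hb⟩

theorem mul_mem_Icc {a b s ε : ℝ} (ha : a ≤ 0) (hb : 0 ≤ b) (hs : s ∈ Set.Icc (0 : ℝ) 1)
    (hε : ε ∈ Set.Icc a b) : s * ε ∈ Set.Icc a b := by
  obtain ⟨h0, h1⟩ := hs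
  obtain ⟨h2, h3⟩ := hε
  constructor <;> nlinarith

/-- Taylor expansion at `0` of a function on an interval that vanishes at `0`. -/
theorem eq_mul_taylor {G : ℕ → ℝ → ℝ} {N : ℕ} {a b ε : ℝ} (ha : a ≤ 0) (hb : 0 ≤ b)
    (hG : ∀ j < N + 1, ∀ ε ∈ Set.Icc a b, HasDerivWithinAt (G j) (G (j + 1) ε) (Set.Icc a b) ε)
    (hc : ContinuousOn (G (N + 1)) (Set.Icc a b)) (h0 : G 0 0 = 0) (hε : ε ∈ Set.Icc a b) :
    G 0 ε = ε * (∑ i ∈ Finset.range N, ε ^ i * (((i + 1).factorial : ℝ)⁻¹ * G (i + 1) 0) +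
      ε ^ N * ∫ s in Set.Icc (0 : ℝ) 1,
        ((1 - s) ^ N * ((N.factorial : ℝ))⁻¹) * G (N + 1) (s * ε)) := by
  have hmaps : Set.MapsTo (fun s : ℝ => s * ε) (Set.Icc 0 1) (Set.Icc a b) := fun s hs =>
    mul_mem_Icc ha hb hs hε
  have h := taylor_sum_add_integral (M := N) (φ := fun l s => ε ^ l * G l (s * ε)) ?_ ?_
  · simp only [pow_zero, one_mul, zero_mul, smul_eq_mul] at h
    rw [h, Finset.sum_range_succ', h0, mul_add, Finset.mul_sum]
    congr 1
    · simp only [mul_zero, add_zero]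
      exact Finset.sum_congr rfl fun i _ => by ring
    · rw [← integral_const_mul, ← integral_const_mul]
      exact integral_congr_ae (Eventually.of_forall fun s => by ring)
  · intro l hl s hs
    have h1 : HasDerivWithinAt (fun s : ℝ => s * ε) ε (Set.Icc 0 1) s := by
      simpa using ((hasDerivAt_id s).mul_const ε).hasDerivWithinAt
    have h2 := ((hG l hl _ (hmaps hs)).comp s h1 hmaps).const_mul (ε ^ l)
    refine h2.congr_deriv ?_
    rw [pow_succ]; ring
  · exact continuousOn_const.mul (hc.comp (continuous_id.mul continuous_const).continuousOn hmaps)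

end Interval

section Families

variable {d : ℕ} {I : Set ℝ}

/-- A vector and an integer translate of it in the unit cell. -/
theorem exists_intVec_add_mem_Icc (x : Fin d → ℝ) :
    ∃ l : Fin d → ℤ, x + intVec l ∈ Set.Icc (0 : Fin d → ℝ) 1 := by
  refine ⟨fun i => -⌊x i⌋, fun i => ?_, fun i => ?_⟩
  · simp only [Pi.add_apply, Pi.zero_apply, intVec, Int.cast_neg]
    linarith [Int.floor_le (x i)]
  · simp only [Pi.add_apply, Pi.one_apply, intVec, Int.cast_neg]
    linarith [Int.lt_floor_add_one (x i)]

/-- The derivatives with respect to `ε` of a periodic family are periodic. -/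
theorem periodic_of_hasDerivWithinAt {E V : Type*} [NormedAddCommGroup V] [NormedSpace ℝ V]
    (hI : I.OrdConnected) (hI1 : I.Nontrivial) {G : ℕ → ℝ → E → V} {k : ℕ} {S : E → E} {D : Set E}
    (hG : ∀ j < k, ∀ ε ∈ I, ∀ z ∈ D, HasDerivWithinAt (fun s => G j s z) (G (j + 1) ε z) I ε)
    (hS : Set.MapsTo S D D) (h0 : ∀ ε ∈ I, ∀ z ∈ D, G 0 ε (S z) = G 0 ε z) :
    ∀ j ≤ k, ∀ ε ∈ I, ∀ z ∈ D, G j ε (S z) = G j ε z := by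
  intro j
  induction j with
  | zero => exact fun _ => h0
  | succ j ih =>
    intro hj ε hε z hz
    have h1 := hG j hj ε hε _ (hS hz)
    have h2 := hG j hj ε hε z hz
    have h3 := h1.congr (f₁ := fun s => G j s z) (fun s hs => (ih (by omega) s hs z hz).symm)
      (ih (by omega) ε hε z hz).symm
    exact (uniqueDiffWithinAt_interval hI hI1 hε).eq_deriv _ h3 h2

theorem iteratedFDeriv_periodic {g : (Fin d → ℝ) → ℝ} (hg : IsPeriodic g) (i : ℕ)
    (x : Fin d → ℝ) (l : Fin d → ℤ) :
    iteratedFDeriv ℝ i g (x + intVec l) = iteratedFDeriv ℝ i g x := by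
  rw [← iteratedFDeriv_comp_add_right]
  congr 1
  exact funext fun y => hg y l

/-- The members of a smooth family and their derivatives with respect to the parameter are bounded
in `C^p`, locally uniformly in the parameter. -/
theorem exists_ckClass_of_family {p k : ℕ} {G : ℕ → ℝ → (Fin d → ℝ) → ℝ}
    (hper : ∀ j ≤ k, ∀ ε ∈ I, IsPeriodic (G j ε))
    (hG : ∀ j ≤ k, ∀ ε ∈ I, ContDiff ℝ p (G j ε))
    (hc : ∀ j ≤ k, ∀ i ≤ p, ContinuousOn
      (fun z : ℝ × (Fin d → ℝ) => iteratedFDeriv ℝ i (G j z.1) z.2) (I ×ˢ Set.univ))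
    {J : Set ℝ} (hJ : IsCompact J) (hJI : J ⊆ I) :
    ∃ C : ℝ, ∀ j ≤ k, ∀ ε ∈ J, ckClass p d C (G j ε) := by
  have h1 : ∀ j ≤ k, ∀ i ≤ p, ∃ C : ℝ, 0 ≤ C ∧ ∀ ε ∈ J, ∀ x,
      ‖iteratedFDeriv ℝ i (G j ε) x‖ ≤ C := by
    intro j hj i hi
    obtain ⟨C, hC⟩ := (hJ.prod (isCompact_Icc (a := (0 : Fin d → ℝ)) (b := 1))).exists_bound_of_continuousOn
      ((hc j hj i hi).mono (Set.prod_mono hJI (Set.subset_univ _)))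
    refine ⟨|C|, abs_nonneg C, fun ε hε x => ?_⟩
    obtain ⟨l, hl⟩ := exists_intVec_add_mem_Icc x
    rw [← iteratedFDeriv_periodic (hper j hj ε (hJI hε)) i x l]
    exact (hC (ε, x + intVec l) ⟨hε, hl⟩).trans (le_abs_self C)
  choose! C hC0 hC using h1
  refine ⟨∑ j ∈ Finset.range (k + 1), ∑ i ∈ Finset.range (p + 1), |C j i|,
    fun j hj ε hε => ⟨hper j hj ε (hJI hε), hG j hj ε (hJI hε), fun i hi x => ?_⟩⟩
  refine (hC j hj i hi ε hε x).trans ((le_abs_self _).trans ?_)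
  refine (Finset.single_le_sum (f := fun i => |C j i|) (fun i _ => abs_nonneg _)
    (Finset.mem_range.2 (Nat.lt_succ_of_le hi))).trans ?_
  exact Finset.single_le_sum (f := fun j => ∑ i ∈ Finset.range (p + 1), |C j i|)
    (fun j _ => Finset.sum_nonneg fun i _ => abs_nonneg _)
    (Finset.mem_range.2 (Nat.lt_succ_of_le hj))

theorem remainder_weight_le {s : ℝ} (hs : s ∈ Set.Icc (0 : ℝ) 1) (N : ℕ) :
    |(1 - s) ^ N * ((N.factorial : ℝ))⁻¹| ≤ 1 := by
  rw [abs_of_nonneg (mul_nonneg (pow_nonneg (by linarith [hs.2]) _) (by positivity))]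
  refine mul_le_one₀ (pow_le_one₀ (by linarith [hs.2]) (by linarith [hs.1])) (by positivity) ?_
  exact inv_le_one_of_one_le₀ (by exact_mod_cast Nat.one_le_iff_ne_zero.2 (Nat.factorial_ne_zero N))

/-- The remainder in the Taylor expansion of a smooth family. -/
theorem ckClass_integral_family {p N : ℕ} {g : ℝ → (Fin d → ℝ) → ℝ} {a b C : ℝ} (ha : a ≤ 0)
    (hb : 0 ≤ b) (hg : ∀ ε ∈ Set.Icc a b, ckClass p d C (g ε))
    (hc : ∀ i ≤ p, ContinuousOn
      (fun z : ℝ × (Fin d → ℝ) => iteratedFDeriv ℝ i (g z.1) z.2) (Set.Icc a b ×ˢ Set.univ))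
    {ε : ℝ} (hε : ε ∈ Set.Icc a b) :
    ckClass p d C fun x => ∫ s in Set.Icc (0 : ℝ) 1,
      ((1 - s) ^ N * ((N.factorial : ℝ))⁻¹) * g (s * ε) x := by
  have hmaps : Set.MapsTo (fun s : ℝ => s * ε) (Set.Icc 0 1) (Set.Icc a b) := fun s hs =>
    mul_mem_Icc ha hb hs hε
  set F : ℝ → (Fin d → ℝ) → ℝ := fun s x =>
    ((1 - s) ^ N * ((N.factorial : ℝ))⁻¹) * g (s * ε) x with hF
  have hprob : IsProbabilityMeasure (volume.restrict (Set.Icc (0 : ℝ) 1)) := ⟨by simp⟩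
  have hae : ∀ᵐ s ∂(volume.restrict (Set.Icc (0 : ℝ) 1)), s ∈ Set.Icc (0 : ℝ) 1 :=
    ae_restrict_mem measurableSet_Icc
  have hiter : ∀ s ∈ Set.Icc (0 : ℝ) 1, ∀ i ≤ p, ∀ x, iteratedFDeriv ℝ i (F s) x =
      ((1 - s) ^ N * ((N.factorial : ℝ))⁻¹) • iteratedFDeriv ℝ i (g (s * ε)) x := by
    intro s hs i hi x
    exact iteratedFDeriv_const_smul_apply (a := (1 - s) ^ N * ((N.factorial : ℝ))⁻¹)
      (f := g (s * ε)) ((hg _ (hmaps hs)).2.1.of_le (by exact_mod_cast hi)).contDiffAt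
  have hbound : ∀ s ∈ Set.Icc (0 : ℝ) 1, ∀ i ≤ p, ∀ x, ‖iteratedFDeriv ℝ i (F s) x‖ ≤ C := by
    intro s hs i hi x
    rw [hiter s hs i hi, norm_smul, Real.norm_eq_abs]
    exact (mul_le_of_le_one_left (norm_nonneg _) (remainder_weight_le hs N)).trans
      ((hg _ (hmaps hs)).2.2 i hi x)
  have key := contDiff_integral (μ := volume.restrict (Set.Icc (0 : ℝ) 1)) (F := F) (n := p)
    (C := C) (hae.mono fun s hs => contDiff_const.mul (hg _ (hmaps hs)).2.1)
    (fun i hi x => ?_) (hae.mono fun s hs => hbound s hs)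
  · refine ⟨fun x l => ?_, key.1, fun i hi x => ?_⟩
    · refine setIntegral_congr_fun measurableSet_Icc fun s hs => ?_
      simp only [(hg _ (hmaps hs)).1 x l]
    · rw [key.2 i hi]
      refine (norm_integral_le_of_norm_le_const (hae.mono fun s hs => hbound s hs i hi x)).trans ?_
      simp
  · refine ContinuousOn.aestronglyMeasurable ?_ measurableSet_Icc
    refine ContinuousOn.congr ?_ fun s hs => hiter s hs i hi x
    refine ContinuousOn.smul (f := fun s : ℝ => (1 - s) ^ N * ((N.factorial : ℝ))⁻¹) (by fun_prop) ?_
    exact (hc i hi).comp (f := fun s : ℝ => (s * ε, x)) (by fun_prop)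
      fun s hs => ⟨hmaps hs, Set.mem_univ _⟩

end Families

section SmoothCase

variable {e : ℕ} {A : Matrix.SpecialLinearGroup (Fin (e + 1)) ℤ} {ω : Fin e → ℝ}
  {Ω : Fin (e + 1) → ℝ} {α₀ : ℝ} {L : Fin (e + 1) → ℤ} {I : Set ℝ}
  {f : ℝ → (Fin (e + 1) → ℝ) → ℝ} {n m : ℕ}

theorem IsIrrational.ne_zero (hΩ : IsIrrational Ω) : Ω ≠ 0 := by
  intro h
  refine hΩ (fun _ => 1) (fun h0 => one_ne_zero (congrFun h0 0)) ?_
  rw [h, zero_dotProduct]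

/-- The normal form for families of finite smoothness. The numbers `s t` are the orders of
differentiability in the scale of spaces. -/
theorem hasResonantNormalForm_ck (hΩ : IsIrrational Ω) (hα₀ : α₀ ≠ 0)
    (hint : IsIntrinsicFrequency (α₀ • Ω) A ω L) (hI : I.OrdConnected) (hI0 : (0 : ℝ) ∈ I)
    (hI1 : I.Nontrivial) (hm : 1 ≤ m) (hn : IsResonanceOrder A ω I Ω f α₀ n)
    {s : ℕ → ℕ} {c k p : ℕ} (hs : Monotone s) (hs1 : 1 ≤ s 0)
    (hsc : ∀ t, s t + c ≤ s (t + c)) (hsL : e ≠ 0 → ∀ t l, s t + l ≤ s (t + l)) (hk : k ≤ s 0)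
    (hsp : s ((n + m - 1) * (c + 1)) ≤ p) (hω : TameDivisors ω c)
    (hf : IsCkFamily p (n + m) I fun ε x => ε * f ε x) :
    HasResonantNormalForm A ω I Ω f α₀ L (ckClass k) n m := by
  have hX := regularityScale_ck (Ω := Ω) (α₀ := α₀) hs hs1 hsc hsL hk hω hint.1
  have := neBot_nhdsWithin_diff hI hI0 hI1
  obtain ⟨hper, G, hG0, hGc, hGcont, hGd⟩ := hf
  obtain ⟨a, b, ha, hb, hab, hev⟩ := exists_Icc_nhdsWithin hI hI0
  have hGper : ∀ j ≤ n + m, ∀ ε ∈ I, IsPeriodic (G j ε) := by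
    intro j hj ε hε x l
    exact periodic_of_hasDerivWithinAt hI hI1 (D := Set.univ) (S := fun x => x + intVec l)
      (fun j hj ε hε z _ => hGd j hj ε hε z) (Set.mapsTo_univ _ _)
      (fun ε hε z _ => by rw [hG0 ε hε]; exact hper ε hε z l) j hj ε hε x (Set.mem_univ x)
  obtain ⟨C, hC⟩ := exists_ckClass_of_family hGper hGc hGcont isCompact_Icc hab
  obtain ⟨N, hN⟩ : ∃ N, N = n + m - 1 := ⟨_, rfl⟩
  have hN1 : n + m = N + 1 := by omega
  have h00 : (0 : ℝ) ∈ Set.Icc a b := ⟨ha, hb⟩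
  have hrot : ∀ {C : ℝ} {g : (Fin (e + 1) → ℝ) → ℝ}, ckClass p (e + 1) C g →
      ckScale A s (N * (c + 1)) (max 1 ‖actCLM A⁻¹‖ ^ p * C) g := fun hg =>
    ckClass_mono (ckClass_comp_linear (actCLM A⁻¹) (fun l => ⟨_, act_intVec A⁻¹ l⟩) hg)
      (hN ▸ hsp) le_rfl
  refine hX.hasResonantNormalForm hΩ.ne_zero hα₀ hint hm hn
    (γ₀ := fun i x => ((i + 1).factorial : ℝ)⁻¹ * G (i + 1) 0 x)
    (ψ := fun ε x => ∫ s in Set.Icc (0 : ℝ) 1,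
      ((1 - s) ^ N * ((N.factorial : ℝ))⁻¹) * G (N + 1) (s * ε) x)
    (γ := fun ε x => ∑ i ∈ Finset.range N, ε ^ i * (((i + 1).factorial : ℝ)⁻¹ * G (i + 1) 0 x) +
      ε ^ N * ∫ s in Set.Icc (0 : ℝ) 1,
        ((1 - s) ^ N * ((N.factorial : ℝ))⁻¹) * G (N + 1) (s * ε) x) ?_ ?_ ?_ ?_
  · intro i hi
    rw [← hN]
    exact ⟨_, hrot (ckClass_mul (ckClass_const p _) (hC (i + 1) (by omega) 0 h00))⟩
  · rw [← hN]
    refine ⟨_, hev.mono fun ε hε => hrot (ckClass_integral_family ha hb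
      (fun ε hε => hC (N + 1) hN1.ge ε hε) (fun i hi => ?_) hε)⟩
    exact (hGcont (N + 1) hN1.ge i hi).mono (Set.prod_mono hab le_rfl)
  · rw [← hN]
    exact Eventually.of_forall fun ε x => rfl
  · filter_upwards [hev] with ε hε x
    have hG0x : ∀ ε ∈ I, G 0 ε x = ε * f ε x := fun ε hε => by rw [hG0 ε hε]
    rw [← hG0x ε (hab hε)]
    refine eq_mul_taylor (G := fun j ε => G j ε x) ha hb (fun j hj ε hε =>
      (hGd j (by omega) ε (hab hε) x).mono hab) ?_ ?_ hε
    · have h1 := (hGcont (N + 1) hN1.ge 0 (Nat.zero_le _)).mono (Set.prod_mono hab le_rfl)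
      have h2 : ContinuousOn (fun ε => iteratedFDeriv ℝ 0 (G (N + 1) ε) x) (Set.Icc a b) :=
        h1.comp (f := fun ε : ℝ => (ε, x)) (by fun_prop) fun ε hε => ⟨hε, Set.mem_univ _⟩
      have h3 := (continuousMultilinearCurryFin0 ℝ (Fin (e + 1) → ℝ) ℝ).continuous.comp_continuousOn h2
      exact h3
    · simp [hG0x 0 hI0]

/-- The normal form for families that are `C^p` in `x`. The cohomology equation is solved with a loss
of `c = ⌊τ⌋ + 1 > τ` derivatives, so that each of the `n + m - 1` steps of the averaging procedure,
with one more derivative for the displacement, costs at most `τ + 2 ≤ d + τ` derivatives if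
`d ≥ 2`, and none if `d = 1`. -/
theorem hasResonantNormalForm_of_isCkFamily (hΩ : IsIrrational Ω) (hα₀ : α₀ ≠ 0)
    (hint : IsIntrinsicFrequency (α₀ • Ω) A ω L) {ν τ : ℝ} (hν : 0 < ν) (hdio : IsDiophantine ν τ ω)
    (hI : I.OrdConnected) (hI0 : (0 : ℝ) ∈ I)
    (hI1 : I.Nontrivial) (hm : 1 ≤ m) (hn : IsResonanceOrder A ω I Ω f α₀ n) {p q : ℕ} (hqp : q < p)
    (hq : ((n + m - 1 : ℕ) : ℝ) * (((e + 1 : ℕ) : ℝ) + τ) ≤ q)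
    (hf : IsCkFamily p (n + m) I fun ε x => ε * f ε x) :
    HasResonantNormalForm A ω I Ω f α₀ L (ckClass (p - q)) n m := by
  rcases Nat.eq_zero_or_pos e with rfl | he
  · exact hasResonantNormalForm_ck hΩ hα₀ hint hI hI0 hI1 hm hn (s := fun _ => p) (c := 0)
      monotone_const (by omega) (fun _ => le_rfl) (fun h => absurd rfl h) (Nat.sub_le _ _) le_rfl
      (tameDivisors_of_isEmpty ω 0) hf
  · have hτ := hdio.exponent_nonneg hν he.ne'
    have h1 : (n + m - 1) * (⌊τ⌋₊ + 1 + 1) ≤ q := by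
      have h2 : ((⌊τ⌋₊ + 1 + 1 : ℕ) : ℝ) ≤ ((e + 1 : ℕ) : ℝ) + τ := by
        push_cast
        have h3 := Nat.floor_le hτ
        have h4 : (1 : ℝ) ≤ e := by exact_mod_cast he
        linarith
      have h5 := (mul_le_mul_of_nonneg_left h2 (Nat.cast_nonneg (n + m - 1))).trans hq
      exact_mod_cast h5
    exact hasResonantNormalForm_ck hΩ hα₀ hint hI hI0 hI1 hm hn
      (s := fun t => p - (n + m - 1) * (⌊τ⌋₊ + 1 + 1) + t) (c := ⌊τ⌋₊ + 1)
      (fun t t' h => Nat.add_le_add_left h _) (by omega) (fun t => by omega)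
      (fun _ t l => by omega) (by omega) (by omega)
      (hdio.tameDivisors hν (by push_cast; exact Nat.lt_floor_add_one τ)) hf

end SmoothCase

/-! ### Bounded holomorphic functions on complex strips -/

section Strips

variable {d : ℕ} {ρ ρ₁ ρ₂ δ C C' : ℝ} {G G' : (Fin d → ℂ) → ℂ}

/-- `G` is holomorphic on the strip of width `ρ` and bounded there by `C`. -/
def stripClass (ρ C : ℝ) (G : (Fin d → ℂ) → ℂ) : Prop :=
  DifferentiableOn ℂ G (strip d ρ) ∧ ∀ z ∈ strip d ρ, ‖G z‖ ≤ C

theorem isOpen_strip (d : ℕ) (ρ : ℝ) : IsOpen (strip d ρ) := by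
  have : strip d ρ = ⋂ i, {z : Fin d → ℂ | |(z i).im| < ρ} := by ext; simp [strip]
  rw [this]
  exact isOpen_iInter_of_finite fun i => isOpen_lt (by fun_prop) continuous_const

theorem convex_strip (d : ℕ) (ρ : ℝ) : Convex ℝ (strip d ρ) := by
  intro z hz w hw a b ha hb hab i
  have h : ((a • z + b • w) i).im = a * (z i).im + b * (w i).im := by simp
  rw [h, abs_lt]
  have h1 := abs_lt.1 (hz i)
  have h2 := abs_lt.1 (hw i)
  rcases ha.eq_or_lt with rfl | ha
  · simp only [zero_add] at hab
    subst hab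
    simpa using h2
  · constructor <;> nlinarith

theorem strip_mono (h : ρ₁ ≤ ρ₂) : strip d ρ₁ ⊆ strip d ρ₂ := fun _ hz i => (hz i).trans_le h

theorem complexify_mem_strip (hρ : 0 < ρ) (x : Fin d → ℝ) : complexify x ∈ strip d ρ := by
  intro i
  simpa [complexify] using hρ

theorem add_mem_strip {z w : Fin d → ℂ} (hz : z ∈ strip d ρ₁) (hw : ‖w‖ ≤ δ) (h : ρ₁ + δ ≤ ρ₂) :
    z + w ∈ strip d ρ₂ := by
  intro i
  have h1 : |(w i).im| ≤ δ := (Complex.abs_im_le_norm _).trans ((norm_le_pi_norm w i).trans hw)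
  have h2 := hz i
  rw [Pi.add_apply, Complex.add_im]
  exact (abs_add_le _ _).trans_lt (by linarith)

theorem norm_complexify (u : Fin d → ℝ) : ‖complexify u‖ = ‖u‖ := by
  simp only [Pi.norm_def]
  congr 2
  funext i
  simp [complexify]

theorem complexify_add (x y : Fin d → ℝ) : complexify (x + y) = complexify x + complexify y := by
  funext i; simp [complexify]

theorem complexify_smul (t : ℝ) (x : Fin d → ℝ) :
    complexify (t • x) = (t : ℂ) • complexify x := by
  funext i; simp [complexify]

theorem add_complexify_mem_strip {z : Fin d → ℂ} (hz : z ∈ strip d ρ) (x : Fin d → ℝ) :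
    z + complexify x ∈ strip d ρ := by
  intro i
  simpa [complexify] using hz i

theorem continuous_complexify : Continuous (complexify (d := d)) := by
  unfold complexify
  fun_prop

theorem add_smul_mem_strip {z : Fin d → ℂ} (hz : z ∈ strip d ρ₁) {ζ : ℂ} {u : Fin d → ℝ}
    (hζ : ‖ζ‖ ≤ δ) (h : ρ₁ + δ * ‖u‖ ≤ ρ₂) : z + ζ • complexify u ∈ strip d ρ₂ := by
  refine add_mem_strip hz (δ := δ * ‖u‖) ?_ h
  rw [norm_smul, norm_complexify]
  gcongr

namespace stripClass

theorem mono (hG : stripClass ρ₁ C G) (hρ : ρ₂ ≤ ρ₁) (hC : C ≤ C') : stripClass ρ₂ C' G :=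
  ⟨hG.1.mono (strip_mono hρ), fun z hz => (hG.2 z (strip_mono hρ hz)).trans hC⟩

theorem nonneg (hG : stripClass ρ C G) (hρ : 0 < ρ) : 0 ≤ C :=
  (norm_nonneg _).trans (hG.2 _ (complexify_mem_strip hρ 0))

theorem const (d : ℕ) (ρ : ℝ) (a : ℂ) : stripClass (d := d) ρ ‖a‖ fun _ => a :=
  ⟨differentiableOn_const a, fun _ _ => le_rfl⟩

theorem add (hG : stripClass ρ C G) (hG' : stripClass ρ C' G') :
    stripClass ρ (C + C') fun z => G z + G' z :=
  ⟨hG.1.add hG'.1, fun z hz => (norm_add_le _ _).trans (add_le_add (hG.2 z hz) (hG'.2 z hz))⟩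

theorem mul (hG : stripClass ρ C G) (hG' : stripClass ρ C' G') :
    stripClass ρ (C * C') fun z => G z * G' z := by
  refine ⟨hG.1.mul hG'.1, fun z hz => ?_⟩
  rw [norm_mul]
  exact mul_le_mul (hG.2 z hz) (hG'.2 z hz) (norm_nonneg _) ((norm_nonneg _).trans (hG.2 z hz))

theorem differentiableAt (hG : stripClass ρ C G) {z : Fin d → ℂ} (hz : z ∈ strip d ρ) :
    DifferentiableAt ℂ G z :=
  (hG.1 z hz).differentiableAt ((isOpen_strip d ρ).mem_nhds hz)

/-- Cauchy's estimate for the first derivative. -/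
theorem norm_fderiv_le (hG : stripClass ρ₁ C G) (hδ : 0 < δ) (h : ρ₂ + δ ≤ ρ₁) {z : Fin d → ℂ}
    (hz : z ∈ strip d ρ₂) : ‖fderiv ℂ G z‖ ≤ 2 * C / δ := by
  have hb : Metric.ball z δ ⊆ strip d ρ₁ := fun w hw => by
    rw [← add_sub_cancel z w]
    exact add_mem_strip hz (by rw [← dist_eq_norm]; exact (Metric.mem_ball.1 hw).le) h
  exact norm_fderiv_le_of_ball hδ (hG.1.mono hb) fun y hy => hG.2 y (hb hy)

/-- The complex conjugate of `G` reflected in the real subspace is holomorphic, so the real part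
of `G` on the real subspace has a holomorphic extension. -/
theorem exists_re (hG : stripClass ρ C G) : ∃ G', stripClass ρ C G' ∧
    ∀ x : Fin d → ℝ, G' (complexify x) = ((G (complexify x)).re : ℂ) := by
  have hstar : ∀ z ∈ strip d ρ, star z ∈ strip d ρ := fun _ hz i => by
    simpa using hz i
  have h1 : stripClass ρ C (star ∘ G ∘ star) := by
    refine ⟨fun z hz => ?_, fun z hz => ?_⟩
    · have := (hG.differentiableAt (hstar z hz)).star_star
      rw [star_star] at this
      exact this.differentiableWithinAt
    · simpa using hG.2 _ (hstar z hz)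
  refine ⟨fun z => (2⁻¹ : ℂ) * (G z + (star ∘ G ∘ star) z), ?_, fun x => ?_⟩
  · refine ((const d ρ (2⁻¹ : ℂ)).mul (hG.add h1)).mono le_rfl (le_of_eq ?_)
    norm_num
    ring
  · have h2 : star (complexify x) = complexify x := by
      funext i
      simp [complexify]
    simp only [Function.comp_apply, h2]
    rw [Complex.star_def, Complex.add_conj]
    push_cast
    ring

/-- Precomposition with a map that is holomorphic between the strips. -/
theorem comp {d' : ℕ} {T : (Fin d' → ℂ) → Fin d → ℂ} (hG : stripClass ρ₁ C G)
    (hT : DifferentiableOn ℂ T (strip d' ρ₂)) (hmaps : Set.MapsTo T (strip d' ρ₂) (strip d ρ₁)) :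
    stripClass ρ₂ C fun z => G (T z) :=
  ⟨hG.1.comp hT hmaps, fun _ hz => hG.2 _ (hmaps hz)⟩

theorem translate (hG : stripClass ρ C G) (a : Fin d → ℝ) :
    stripClass ρ C fun z => G (z + complexify a) :=
  hG.comp (differentiableOn_id.add_const _) fun _ hz => add_complexify_mem_strip hz a

/-- Displacement in a real direction. -/
theorem displace (hG : stripClass ρ₁ C G) {V : (Fin d → ℂ) → ℂ} {u : Fin d → ℝ}
    (hV : stripClass ρ₂ δ V) (h : ρ₂ + δ * ‖u‖ ≤ ρ₁) :
    stripClass ρ₂ C fun z => G (z + V z • complexify u) :=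
  hG.comp (differentiableOn_id.add (hV.1.smul_const _)) fun z hz =>
    add_smul_mem_strip hz (hV.2 z hz) h

/-- A function holomorphic on a strip that vanishes on the real subspace vanishes. -/
theorem eq_zero_of_real (hG : DifferentiableOn ℂ G (strip d ρ))
    (h0 : ∀ x : Fin d → ℝ, G (complexify x) = 0) {z : Fin d → ℂ} (hz : z ∈ strip d ρ) :
    G z = 0 := by
  set x : Fin d → ℝ := fun i => (z i).re with hx
  set y : Fin d → ℝ := fun i => (z i).im with hy
  -- the complex line through `x` in direction `y`
  set T : ℂ → Fin d → ℂ := fun ζ => complexify x + ζ • complexify y with hT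
  have hTd : Differentiable ℂ T := by
    simp only [hT]
    fun_prop
  set U : Set ℂ := T ⁻¹' strip d ρ with hU
  have hUo : IsOpen U := (isOpen_strip d ρ).preimage hTd.continuous
  have hUc : Convex ℝ U := by
    intro a ha b hb s t hs ht hst
    have h1 : T (s • a + t • b) = s • T a + t • T b := by
      simp only [hT]
      rw [smul_add, smul_add, add_add_add_comm, ← add_smul, hst, one_smul, add_smul,
        smul_assoc, smul_assoc]
    have := convex_strip d ρ ha hb hs ht hst
    rw [← h1] at this
    exact this
  have hreal : ∀ t : ℝ, T t = complexify (x + t • y) := fun t => by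
    rw [complexify_add, complexify_smul]
  have hTI : T Complex.I = z := by
    funext i
    simp only [hT, hx, hy, complexify, Pi.add_apply, Pi.smul_apply, smul_eq_mul]
    rw [mul_comm]
    exact Complex.re_add_im (z i)
  have hI : Complex.I ∈ U := by
    change T Complex.I ∈ strip d ρ
    rwa [hTI]
  have hg : AnalyticOnNhd ℂ (G ∘ T) U :=
    (hG.comp hTd.differentiableOn fun _ h => h).analyticOnNhd hUo
  have hU0 : (0 : ℂ) ∈ U := by
    intro i
    have h1 := hz i
    have h2 : ((T 0) i).im = 0 := by simp [hT, complexify]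
    rw [h2, abs_zero]
    exact (abs_nonneg _).trans_lt h1
  have hfreq : ∃ᶠ ζ in 𝓝[≠] (0 : ℂ), (G ∘ T) ζ = 0 := by
    have hlim : Tendsto (fun n : ℕ => ((1 / ((n : ℝ) + 1) : ℝ) : ℂ)) atTop (𝓝[≠] 0) := by
      refine tendsto_nhdsWithin_iff.2 ⟨?_, Eventually.of_forall fun n => ?_⟩
      · have := (Complex.continuous_ofReal.tendsto 0).comp
          (tendsto_one_div_add_atTop_nhds_zero_nat (𝕜 := ℝ))
        rwa [Complex.ofReal_zero] at this
      · have : (1 / ((n : ℝ) + 1)) ≠ 0 := by positivity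
        exact Complex.ofReal_ne_zero.2 this
    refine hlim.frequently (Frequently.of_forall fun n => ?_)
    simp only [Function.comp_apply, hreal, h0]
  have := hg.eqOn_zero_of_preconnected_of_frequently_eq_zero hUc.isPreconnected hU0 hfreq hI
  simpa [hTI] using this

/-- The extension of a periodic function is periodic. -/
theorem periodic (hG : DifferentiableOn ℂ G (strip d ρ)) {g : (Fin d → ℝ) → ℝ}
    (hg : IsPeriodic g) (h : ∀ x : Fin d → ℝ, G (complexify x) = (g x : ℂ)) (l : Fin d → ℤ)
    {z : Fin d → ℂ} (hz : z ∈ strip d ρ) : G (z + complexify (intVec l)) = G z := by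
  have h1 : DifferentiableOn ℂ (fun z => G (z + complexify (intVec l)) - G z) (strip d ρ) :=
    (hG.comp (differentiableOn_id.add_const _) fun _ hz => add_complexify_mem_strip hz _).sub hG
  have := eq_zero_of_real h1 (fun x => by rw [← complexify_add, h, h, hg, sub_self]) hz
  exact sub_eq_zero.1 this

end stripClass

/-- A series of holomorphic functions with a summable sequence of bounds is holomorphic. -/
theorem stripClass_tsum {ι : Type*} {F : ι → (Fin d → ℂ) → ℂ} {B : ι → ℝ} (hB : Summable B)
    (hF : ∀ k, stripClass ρ (B k) (F k)) : stripClass ρ (∑' k, B k) fun z => ∑' k, F k z := by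
  refine ⟨fun z hz => ?_, fun z hz => tsum_of_norm_bounded hB.hasSum fun k => (hF k).2 z hz⟩
  obtain ⟨R, hR, hball⟩ := Metric.isOpen_iff.1 (isOpen_strip d ρ) z hz
  have hhalf : ∀ y ∈ Metric.ball z (R / 2), Metric.ball y (R / 2) ⊆ strip d ρ := fun y hy =>
    (Metric.ball_subset_ball' (by linarith [Metric.mem_ball.1 hy])).trans hball
  have hz' : z ∈ Metric.ball z (R / 2) := Metric.mem_ball_self (by positivity)
  exact (hasFDerivAt_tsum_of_isPreconnected (u := fun k => 2 * B k / (R / 2))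
    ((hB.mul_left 2).div_const _) Metric.isOpen_ball (convex_ball z (R / 2)).isPreconnected
    (fun k y hy => ((hF k).differentiableAt
      (hhalf y hy (Metric.mem_ball_self (by positivity)))).hasFDerivAt)
    (fun k y hy => norm_fderiv_le_of_ball (by positivity) ((hF k).1.mono (hhalf y hy))
      fun x hx => (hF k).2 x (hhalf y hy hx))
    hz' (Summable.of_norm_bounded hB fun k => (hF k).2 z hz) hz').differentiableAt.differentiableWithinAt

/-- An integral of holomorphic functions over a finite measure space. -/
theorem stripClass_integral {S : Type*} [MeasurableSpace S] {μ : Measure S} [IsFiniteMeasure μ]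
    {F : S → (Fin d → ℂ) → ℂ} (hF : ∀ᵐ s ∂μ, stripClass ρ C (F s))
    (hmeas : ∀ z ∈ strip d ρ, AEStronglyMeasurable (fun s => F s z) μ) :
    stripClass ρ (C * μ.real Set.univ) fun z => ∫ s, F s z ∂μ :=
  ⟨differentiableOn_integral (isOpen_strip d ρ) (hF.mono fun _ h => h.1) hmeas
      (hF.mono fun _ h => h.2),
    fun z hz => norm_integral_le_of_norm_le_const (hF.mono fun _ h => h.2 z hz)⟩

/-- A periodic function that is the real part of a bounded holomorphic function. -/
theorem analyticClass_of_re {g : (Fin d → ℝ) → ℝ} (hg : IsPeriodic g) (hG : stripClass ρ C G)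
    (h : ∀ x, (G (complexify x)).re = g x) : analyticClass ρ d C g := by
  obtain ⟨G', h1, h2⟩ := hG.exists_re
  exact ⟨hg, G', h1.1, fun x => by rw [h2, h], h1.2⟩

end Strips

/-! ### Cauchy integrals along a direction -/

section CauchyIntegrals

variable {d : ℕ} {ρ₁ ρ₂ δ C B : ℝ} {G : (Fin d → ℂ) → ℂ} {u : Fin d → ℝ}

/-- `(2 π i)⁻¹ ∮ G (z + ξ u) k(ξ, z) dξ` over the circle of radius `δ`. -/
noncomputable def cauchyAlong (u : Fin d → ℝ) (δ : ℝ) (G : (Fin d → ℂ) → ℂ)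
    (k : ℂ → (Fin d → ℂ) → ℂ) (z : Fin d → ℂ) : ℂ :=
  (2 * Real.pi * Complex.I : ℂ)⁻¹ •
    circleIntegral (fun ξ => k ξ z * G (z + ξ • complexify u)) 0 δ

theorem norm_eq_of_mem_sphere {ξ : ℂ} (h : ξ ∈ Metric.sphere (0 : ℂ) δ) : ‖ξ‖ = δ := by
  simpa using h

namespace stripClass

theorem differentiableOn_line (hG : stripClass ρ₁ C G) (h : ρ₂ + δ * ‖u‖ ≤ ρ₁) {z : Fin d → ℂ}
    (hz : z ∈ strip d ρ₂) :
    DifferentiableOn ℂ (fun ξ : ℂ => G (z + ξ • complexify u)) (Metric.closedBall 0 δ) := by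
  refine hG.1.comp (f := fun ξ : ℂ => z + ξ • complexify u) (Differentiable.differentiableOn
    (by fun_prop)) fun ξ hξ => add_smul_mem_strip hz ?_ h
  simpa using hξ

/-- A Cauchy integral along `u` is holomorphic on the strip narrower by `δ ‖u‖`. -/
theorem cauchyAlong (hG : stripClass ρ₁ C G) (hδ : 0 < δ) (h : ρ₂ + δ * ‖u‖ ≤ ρ₁)
    {k : ℂ → (Fin d → ℂ) → ℂ}
    (hk : ∀ ξ ∈ Metric.sphere (0 : ℂ) δ, stripClass ρ₂ B (k ξ))
    (hc : ∀ z ∈ strip d ρ₂, ContinuousOn (fun ξ => k ξ z) (Metric.sphere (0 : ℂ) δ)) :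
    stripClass ρ₂ (δ * (B * C)) (cauchyAlong u δ G k) := by
  have hmem : ∀ θ, circleMap 0 δ θ ∈ Metric.sphere (0 : ℂ) δ := circleMap_mem_sphere 0 hδ.le
  have hb : ∀ ξ ∈ Metric.sphere (0 : ℂ) δ,
      stripClass ρ₂ (B * C) fun z => k ξ z * G (z + ξ • complexify u) := fun ξ hξ =>
    (hk ξ hξ).mul (hG.displace (((const d ρ₂ ξ).mono le_rfl (norm_eq_of_mem_sphere hξ).le)) h)
  refine ⟨?_, fun z hz =>
    circleIntegral.norm_two_pi_i_inv_smul_integral_le_of_norm_le_const hδ.le fun ξ hξ =>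
      (hb ξ hξ).2 z hz⟩
  have hint : DifferentiableOn ℂ (fun z => ∫ θ in Set.Icc (0 : ℝ) (2 * Real.pi),
      deriv (circleMap 0 δ) θ • (k (circleMap 0 δ θ) z *
        G (z + circleMap 0 δ θ • complexify u))) (strip d ρ₂) := by
    refine (stripClass_integral (C := δ * (B * C)) (Eventually.of_forall fun θ => ?_)
      fun z hz => ?_).1
    · refine ((const d ρ₂ (deriv (circleMap 0 δ) θ)).mul (hb _ (hmem θ))).mono le_rfl (le_of_eq ?_)
      simp [abs_of_pos hδ]
    · refine Continuous.aestronglyMeasurable (Continuous.fun_smul ?_ (Continuous.fun_mul ?_ ?_))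
      · refine Continuous.congr ?_ fun θ => (deriv_circleMap 0 δ θ).symm
        exact (continuous_circleMap 0 δ).mul continuous_const
      · exact (hc z hz).comp_continuous (continuous_circleMap 0 δ) hmem
      · exact (hG.differentiableOn_line h hz).continuousOn.comp_continuous (continuous_circleMap 0 δ)
          fun θ => Metric.sphere_subset_closedBall (hmem θ)
  refine (hint.const_smul ((2 * Real.pi * Complex.I : ℂ)⁻¹)).congr fun z hz => ?_
  simp only [FPTM.cauchyAlong, circleIntegral_def_Icc, Pi.smul_apply]

end stripClass

/-- The Taylor coefficients of `G` along `u`. -/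
noncomputable def taylorCoeff (u : Fin d → ℝ) (δ : ℝ) (G : (Fin d → ℂ) → ℂ) (l : ℕ) :
    (Fin d → ℂ) → ℂ :=
  cauchyAlong u δ G fun ξ _ => (ξ ^ (l + 1))⁻¹

/-- The remainder of the Taylor expansion of order `L` along `u`, for a displacement `V`. -/
noncomputable def taylorRemainder (u : Fin d → ℝ) (δ : ℝ) (G : (Fin d → ℂ) → ℂ) (L : ℕ)
    (V : (Fin d → ℂ) → ℂ) : (Fin d → ℂ) → ℂ :=
  cauchyAlong u δ G fun ξ z => (ξ ^ L * (ξ - V z))⁻¹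

theorem stripClass_taylorCoeff (hG : stripClass ρ₁ C G) (hδ : 0 < δ) (h : ρ₂ + δ * ‖u‖ ≤ ρ₁)
    (l : ℕ) : stripClass ρ₂ (δ * ((δ ^ (l + 1))⁻¹ * C)) (taylorCoeff u δ G l) := by
  refine hG.cauchyAlong hδ h (fun ξ hξ => ?_) fun z _ => ?_
  · refine (stripClass.const d ρ₂ _).mono le_rfl (le_of_eq ?_)
    rw [norm_inv, norm_pow, norm_eq_of_mem_sphere hξ]
  · refine ContinuousOn.inv₀ (by fun_prop) fun ξ hξ => pow_ne_zero _ ?_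
    exact norm_pos_iff.1 (by rwa [norm_eq_of_mem_sphere hξ])

theorem half_le_norm_sub {ξ v : ℂ} (hξ : ξ ∈ Metric.sphere (0 : ℂ) δ) (hv : ‖v‖ ≤ δ / 2) :
    δ / 2 ≤ ‖ξ - v‖ := by
  have h1 := norm_sub_norm_le ξ v
  rw [norm_eq_of_mem_sphere hξ] at h1
  linarith

theorem stripClass_taylorRemainder (hG : stripClass ρ₁ C G) (hδ : 0 < δ)
    (h : ρ₂ + δ * ‖u‖ ≤ ρ₁) (L : ℕ) {V : (Fin d → ℂ) → ℂ} (hV : stripClass ρ₂ (δ / 2) V) :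
    stripClass ρ₂ (δ * ((δ ^ L * (δ / 2))⁻¹ * C)) (taylorRemainder u δ G L V) := by
  have hne : ∀ ξ ∈ Metric.sphere (0 : ℂ) δ, ∀ z ∈ strip d ρ₂, ξ ^ L * (ξ - V z) ≠ 0 := by
    intro ξ hξ z hz
    refine mul_ne_zero (pow_ne_zero _ (norm_pos_iff.1 (by rwa [norm_eq_of_mem_sphere hξ]))) ?_
    exact norm_pos_iff.1 ((half_pos hδ).trans_le (half_le_norm_sub hξ (hV.2 z hz)))
  refine hG.cauchyAlong hδ h (fun ξ hξ => ⟨?_, fun z hz => ?_⟩) fun z hz => ?_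
  · exact DifferentiableOn.inv (((differentiableOn_const ξ).sub hV.1).const_mul _) (hne ξ hξ)
  · rw [norm_inv, norm_mul, norm_pow, norm_eq_of_mem_sphere hξ]
    have := half_le_norm_sub hξ (hV.2 z hz)
    gcongr
  · exact ContinuousOn.inv₀ (by fun_prop) fun ξ hξ => hne ξ hξ z hz

/-- Taylor's formula along `u`, from the expansion of the Cauchy kernel. -/
theorem taylor_along (hG : stripClass ρ₁ C G) (hδ : 0 < δ) (h : ρ₂ + δ * ‖u‖ ≤ ρ₁) (L : ℕ)
    {V : (Fin d → ℂ) → ℂ} {z : Fin d → ℂ} (hz : z ∈ strip d ρ₂) (hV : ‖V z‖ ≤ δ / 2) :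
    G (z + V z • complexify u) = ∑ l ∈ Finset.range L, V z ^ l * taylorCoeff u δ G l z +
      V z ^ L * taylorRemainder u δ G L V z := by
  set φ : ℂ → ℂ := fun ξ => G (z + ξ • complexify u) with hφ
  set v := V z with hv
  have hφc : ContinuousOn φ (Metric.sphere 0 δ) :=
    (hG.differentiableOn_line h hz).continuousOn.mono Metric.sphere_subset_closedBall
  have hξ0 : ∀ ξ ∈ Metric.sphere (0 : ℂ) δ, ξ ≠ 0 := fun ξ hξ =>
    norm_pos_iff.1 (by rwa [norm_eq_of_mem_sphere hξ])
  have hξv : ∀ ξ ∈ Metric.sphere (0 : ℂ) δ, ξ - v ≠ 0 := fun ξ hξ =>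
    norm_pos_iff.1 ((half_pos hδ).trans_le (half_le_norm_sub hξ hV))
  have hcauchy := (hG.differentiableOn_line h hz).circleIntegral_sub_inv_smul
    (w := v) (by rw [mem_ball_zero_iff]; linarith)
  have hkernel : ∀ ξ ∈ Metric.sphere (0 : ℂ) δ, (ξ - v)⁻¹ • φ ξ =
      (∑ l ∈ Finset.range L, v ^ l • ((ξ ^ (l + 1))⁻¹ * φ ξ)) +
        v ^ L • ((ξ ^ L * (ξ - v))⁻¹ * φ ξ) := by
    intro ξ hξ
    have h0 := hξ0 ξ hξ
    have h1 := hξv ξ hξ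
    have h2 : ∀ L : ℕ, (ξ - v)⁻¹ = ∑ l ∈ Finset.range L, v ^ l * (ξ ^ (l + 1))⁻¹ +
        v ^ L * (ξ ^ L * (ξ - v))⁻¹ := by
      intro L
      induction L with
      | zero => simp
      | succ L ih =>
        rw [ih, Finset.sum_range_succ, add_assoc]
        congr 1
        field_simp
        ring
    simp only [smul_eq_mul]
    rw [h2 L, add_mul, Finset.sum_mul]
    simp only [mul_assoc]
  have hI1 : ∀ l, CircleIntegrable (fun ξ => (ξ ^ (l + 1))⁻¹ * φ ξ) 0 δ := fun l =>
    (ContinuousOn.mul (ContinuousOn.inv₀ (by fun_prop) fun ξ hξ => pow_ne_zero _ (hξ0 ξ hξ))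
      hφc).circleIntegrable hδ.le
  have hI2 : CircleIntegrable (fun ξ => (ξ ^ L * (ξ - v))⁻¹ * φ ξ) 0 δ :=
    (ContinuousOn.mul (ContinuousOn.inv₀ (by fun_prop) fun ξ hξ =>
      mul_ne_zero (pow_ne_zero _ (hξ0 ξ hξ)) (hξv ξ hξ)) hφc).circleIntegrable hδ.le
  have hsum : ∀ L : ℕ, circleIntegral
      (fun ξ => ∑ l ∈ Finset.range L, v ^ l • ((ξ ^ (l + 1))⁻¹ * φ ξ)) 0 δ =
      ∑ l ∈ Finset.range L, v ^ l • circleIntegral (fun ξ => (ξ ^ (l + 1))⁻¹ * φ ξ) 0 δ ∧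
      CircleIntegrable (fun ξ => ∑ l ∈ Finset.range L, v ^ l • ((ξ ^ (l + 1))⁻¹ * φ ξ)) 0 δ := by
    intro L
    induction L with
    | zero => simp [circleIntegral]
    | succ L ih =>
      have h3 : CircleIntegrable (fun ξ => v ^ L • ((ξ ^ (L + 1))⁻¹ * φ ξ)) 0 δ :=
        (hI1 L).const_smul
      simp only [Finset.sum_range_succ]
      refine ⟨?_, ih.2.add h3⟩
      rw [circleIntegral.integral_add ih.2 h3, ih.1, circleIntegral.integral_smul]
  have h3 : CircleIntegrable (fun ξ => v ^ L • ((ξ ^ L * (ξ - v))⁻¹ * φ ξ)) 0 δ := hI2.const_smul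
  rw [circleIntegral.integral_congr hδ.le hkernel, circleIntegral.integral_add (hsum L).2 h3,
    (hsum L).1, circleIntegral.integral_smul] at hcauchy
  have hpi : (2 * Real.pi * Complex.I : ℂ) ≠ 0 := Complex.two_pi_I_ne_zero
  have h4 : φ v = (2 * Real.pi * Complex.I : ℂ)⁻¹ • ((2 * Real.pi * Complex.I : ℂ) • φ v) := by
    rw [inv_smul_smul₀ hpi]
  change φ v = _
  rw [h4]
  change _ • (_ • G (z + v • complexify u)) = _
  rw [← hcauchy, smul_add, Finset.smul_sum]
  simp only [taylorCoeff, taylorRemainder, FPTM.cauchyAlong, smul_eq_mul]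
  congr 1
  · exact Finset.sum_congr rfl fun l _ => by ring
  · ring

/-- The first Taylor coefficient is the derivative. -/
theorem taylorCoeff_one (hG : stripClass ρ₁ C G) (hδ : 0 < δ) (h : ρ₂ + δ * ‖u‖ ≤ ρ₁)
    {z : Fin d → ℂ} (hz : z ∈ strip d ρ₂) :
    taylorCoeff u δ G 1 z = fderiv ℂ G z (complexify u) := by
  have h0 := (hG.differentiableOn_line h hz).deriv_eq_smul_circleIntegral hδ
  have hz' : z ∈ strip d ρ₁ := by
    simpa using add_smul_mem_strip (ζ := 0) hz (by simpa using hδ.le) h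
  have h1 : HasDerivAt (fun ξ : ℂ => G (z + ξ • complexify u)) (fderiv ℂ G z (complexify u)) 0 := by
    have h2 : HasDerivAt (fun ξ : ℂ => z + ξ • complexify u) (complexify u) 0 := by
      simpa using ((hasDerivAt_id (0 : ℂ)).smul_const (complexify u)).const_add z
    have h3 : HasFDerivAt G (fderiv ℂ G z) (z + (0 : ℂ) • complexify u) := by
      simpa using (hG.differentiableAt hz').hasFDerivAt
    exact h3.comp_hasDerivAt 0 h2
  rw [h1.deriv] at h0
  rw [taylorCoeff, FPTM.cauchyAlong, ← inv_smul_smul₀ Complex.two_pi_I_ne_zero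
    (fderiv ℂ G z (complexify u)), ← h0]
  simp

end CauchyIntegrals

/-! ### Smoothness of holomorphic functions on strips -/

section HolomorphicSmooth

variable {d : ℕ} {ρ ρ₁ ρ₂ C : ℝ} {G : (Fin d → ℂ) → ℂ}

/-- Partial derivatives are holomorphic, since they are Cauchy integrals. -/
theorem stripClass.partialDeriv (hG : stripClass ρ₁ C G) (h : ρ₂ < ρ₁) (i : Fin d) :
    stripClass ρ₂ ((ρ₁ - ρ₂)⁻¹ * C) fun z => fderiv ℂ G z (Pi.single i 1) := by
  have hδ : 0 < ρ₁ - ρ₂ := sub_pos.2 h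
  have hu : complexify (Pi.single i (1 : ℝ)) = (Pi.single i 1 : Fin d → ℂ) := by
    funext j
    by_cases hj : j = i
    · subst hj; simp [complexify]
    · simp [complexify, hj]
  have hn : ‖(Pi.single i (1 : ℝ) : Fin d → ℝ)‖ = 1 := by
    rw [Pi.norm_single, norm_one]
  have hle : ρ₂ + (ρ₁ - ρ₂) * ‖(Pi.single i (1 : ℝ) : Fin d → ℝ)‖ ≤ ρ₁ := by
    rw [hn]; linarith
  have h1 := stripClass_taylorCoeff hG hδ hle 1
  have heq : ∀ z ∈ strip d ρ₂, fderiv ℂ G z (Pi.single i 1) =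
      taylorCoeff (Pi.single i (1 : ℝ)) (ρ₁ - ρ₂) G 1 z := fun z hz => by
    rw [taylorCoeff_one hG hδ hle hz, hu]
  refine ⟨h1.1.congr heq, fun z hz => ?_⟩
  refine (congrArg norm (heq z hz)).trans_le ((h1.2 z hz).trans (le_of_eq ?_))
  field_simp

/-- The inclusion of `ℝ^d` into `ℂ^d` as a continuous linear map. -/
noncomputable def complexifyCLM : (Fin d → ℝ) →L[ℝ] (Fin d → ℂ) :=
  LinearMap.toContinuousLinearMap
    { toFun := complexify
      map_add' := complexify_add
      map_smul' := fun t x => by rw [complexify_smul]; rfl }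

/-- The linear map `c ↦ (x ↦ x i * c)`. -/
noncomputable def coordSMul (𝕜 : Type*) [RCLike 𝕜] [NormedAlgebra 𝕜 ℂ] (i : Fin d) :
    ℂ →L[𝕜] (Fin d → 𝕜) →L[𝕜] ℂ :=
  ContinuousLinearMap.smulRightL 𝕜 (Fin d → 𝕜) ℂ
    (ContinuousLinearMap.proj (R := 𝕜) (φ := fun _ : Fin d => 𝕜) i)

theorem coordSMul_apply (𝕜 : Type*) [RCLike 𝕜] [NormedAlgebra 𝕜 ℂ] (i : Fin d) (c : ℂ)
    (x : Fin d → 𝕜) : coordSMul 𝕜 i c x = x i • c := rfl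

theorem fderiv_eq_sum_coordSMul (z : Fin d → ℂ) :
    fderiv ℂ G z = ∑ i : Fin d, coordSMul ℂ i (fderiv ℂ G z (Pi.single i 1)) := by
  refine ContinuousLinearMap.ext fun v => ?_
  conv_lhs => rw [pi_eq_sum_univ' v]
  simp [coordSMul_apply]

/-- The restriction of a holomorphic function to a translate of the real subspace is smooth, with
bounds depending only on the supremum norm. -/
theorem stripClass.exists_bound (r : ℕ) (h : ρ₂ < ρ₁) (C : ℝ) :
    ∃ B : ℝ, ∀ G : (Fin d → ℂ) → ℂ, stripClass ρ₁ C G → ∀ z ∈ strip d ρ₂,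
      ContDiff ℝ r (fun x : Fin d → ℝ => G (z + complexify x)) ∧
      ∀ i ≤ r, ∀ x, ‖iteratedFDeriv ℝ i (fun x : Fin d → ℝ => G (z + complexify x)) x‖ ≤ B := by
  induction r generalizing ρ₁ C with
  | zero =>
    refine ⟨C, fun G hG z hz => ⟨?_, fun i hi x => ?_⟩⟩
    · rw [Nat.cast_zero, contDiff_zero]
      exact hG.1.continuousOn.comp_continuous (continuous_const.add continuous_complexify)
        fun x => strip_mono h.le (add_complexify_mem_strip hz x)
    · rw [Nat.le_zero.1 hi, norm_iteratedFDeriv_zero]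
      exact hG.2 _ (strip_mono h.le (add_complexify_mem_strip hz x))
  | succ r ih =>
    obtain ⟨ρ₃, h32, h31⟩ := exists_between h
    obtain ⟨B, hB⟩ := ih h32 ((ρ₁ - ρ₃)⁻¹ * C)
    refine ⟨max C (∑ i : Fin d, ‖coordSMul ℝ i‖ * B), fun G hG z hz => ?_⟩
    set g : (Fin d → ℝ) → ℂ := fun x => G (z + complexify x) with hg
    have hmem : ∀ x, z + complexify x ∈ strip d ρ₁ := fun x =>
      strip_mono h.le (add_complexify_mem_strip hz x)
    set D : Fin d → (Fin d → ℝ) → ℂ := fun i x =>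
      fderiv ℂ G (z + complexify x) (Pi.single i 1) with hD
    have hDB : ∀ i, ContDiff ℝ r (D i) ∧ ∀ j ≤ r, ∀ x, ‖iteratedFDeriv ℝ j (D i) x‖ ≤ B :=
      fun i => hB _ (hG.partialDeriv h31 i) z hz
    have hfd : ∀ x, HasFDerivAt g (∑ i : Fin d, coordSMul ℝ i (D i x)) x := by
      intro x
      have h1 := ((hG.differentiableAt (hmem x)).hasFDerivAt).restrictScalars ℝ
      have h2 : HasFDerivAt (fun x : Fin d → ℝ => z + complexify x)
          complexifyCLM x := (complexifyCLM.hasFDerivAt (x := x)).const_add z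
      refine (h1.comp x h2).congr_fderiv ?_
      refine ContinuousLinearMap.ext fun v => ?_
      change fderiv ℂ G (z + complexify x) (complexify v) = _
      rw [fderiv_eq_sum_coordSMul]
      simp [coordSMul_apply, hD, complexify]
    have hfd' : fderiv ℝ g = fun x => ∑ i : Fin d, coordSMul ℝ i (D i x) :=
      funext fun x => (hfd x).fderiv
    have hterm : ∀ i, ContDiff ℝ r fun x => coordSMul ℝ i (D i x) := fun i =>
      (coordSMul ℝ i).contDiff.comp (hDB i).1
    refine ⟨?_, fun j hj x => ?_⟩
    · push_cast
      rw [contDiff_succ_iff_fderiv]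
      refine ⟨fun x => (hfd x).differentiableAt, by simp, ?_⟩
      rw [hfd']
      exact ContDiff.sum fun i _ => hterm i
    · rcases j with _ | j
      · rw [norm_iteratedFDeriv_zero]
        exact (hG.2 _ (hmem x)).trans (le_max_left _ _)
      · refine le_trans ?_ (le_max_right _ _)
        have hj' : (j : WithTop ℕ∞) ≤ r := by exact_mod_cast (by omega : j ≤ r)
        rw [← norm_iteratedFDeriv_fderiv, hfd',
          iteratedFDeriv_fun_sum_apply fun i _ => ((hterm i).of_le hj').contDiffAt]
        refine (norm_sum_le _ _).trans (Finset.sum_le_sum fun i _ => ?_)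
        refine ((coordSMul ℝ i).norm_iteratedFDeriv_comp_left ((hDB i).1.contDiffAt) hj').trans ?_
        exact mul_le_mul_of_nonneg_left ((hDB i).2 j (by omega) x) (norm_nonneg _)

/-- On a smaller strip, the restrictions of the extension to translates of the real subspace are
smooth functions on the torus. -/
theorem exists_ckClass_of_analyticClass (r : ℕ) (h : ρ₂ < ρ₁) (C : ℝ) :
    ∃ B : ℝ, ∀ (g : (Fin d → ℝ) → ℝ) (G : (Fin d → ℂ) → ℂ), IsPeriodic g → stripClass ρ₁ C G →
      (∀ x, G (complexify x) = (g x : ℂ)) → ∀ z ∈ strip d ρ₂,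
        ckClass r d B (fun x => (G (z + complexify x)).re) ∧
        ckClass r d B (fun x => (G (z + complexify x)).im) := by
  obtain ⟨B, hB⟩ := stripClass.exists_bound (d := d) r h C
  refine ⟨B, fun g G hg hG hGg z hz => ?_⟩
  obtain ⟨h1, h2⟩ := hB G hG z hz
  have hper : ∀ (x : Fin d → ℝ) (l : Fin d → ℤ),
      G (z + complexify (x + intVec l)) = G (z + complexify x) := by
    intro x l
    rw [complexify_add, ← add_assoc]
    exact stripClass.periodic hG.1 hg hGg l (strip_mono h.le (add_complexify_mem_strip hz x))
  have key : ∀ T : ℂ →L[ℝ] ℝ, ‖T‖ ≤ 1 → ckClass r d B (fun x => T (G (z + complexify x))) := by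
    intro T hT
    refine ⟨fun x l => by simp only [hper], T.contDiff.comp h1, fun i hi x => ?_⟩
    refine (T.norm_iteratedFDeriv_comp_left h1.contDiffAt (by exact_mod_cast hi)).trans ?_
    exact (mul_le_of_le_one_left (norm_nonneg _) hT).trans (h2 i hi x)
  exact ⟨key Complex.reCLM Complex.reCLM_norm.le, key Complex.imCLM Complex.imCLM_norm.le⟩

end HolomorphicSmooth

/-! ### The cohomology equation for analytic functions -/

section AnalyticCohomology

variable {d e : ℕ} {ρ ρ₁ ρ₂ C C' : ℝ} {G : (Fin d → ℂ) → ℂ} {g : (Fin d → ℝ) → ℝ}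

theorem analyticClass.exists_extension (hg : analyticClass ρ d C g) :
    ∃ G, stripClass ρ C G ∧ ∀ x, G (complexify x) = (g x : ℂ) := by
  obtain ⟨_, G, h1, h2, h3⟩ := hg
  exact ⟨G, ⟨h1, h3⟩, h2⟩

theorem analyticClass.exists_ckClass (r : ℕ) (hρ : 0 < ρ) (hg : analyticClass ρ d C g) :
    ∃ B, ckClass r d B g := by
  obtain ⟨G, hG, hGg⟩ := hg.exists_extension
  obtain ⟨B, hB⟩ := exists_ckClass_of_analyticClass (d := d) r (half_lt_self hρ) C
  have h := (hB g G hg.1 hG hGg _ (complexify_mem_strip (half_pos hρ) 0)).1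
  simp only [← complexify_add, zero_add, hGg, Complex.ofReal_re] at h
  exact ⟨B, h⟩

/-- The holomorphic extension of `fastMode g k`, for `G` an extension of `g`. -/
noncomputable def fastModeExt (G : (Fin (e + 1) → ℂ) → ℂ) (k : Fin e → ℤ) (z : Fin (e + 1) → ℂ) :
    ℂ :=
  ∫ s in Set.Icc (0 : Fin e → ℝ) 1, G (z + complexify (fastVec s)) * expi (-(intVec k ⬝ᵥ s))

section

variable {G : (Fin (e + 1) → ℂ) → ℂ} {g : (Fin (e + 1) → ℝ) → ℝ}

theorem fastModeExt_complexify (hGg : ∀ x, G (complexify x) = (g x : ℂ)) (k : Fin e → ℤ)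
    (y : Fin (e + 1) → ℝ) : fastModeExt G k (complexify y) = fastMode g k y := by
  simp only [fastModeExt, fastMode, ← complexify_add, hGg]

theorem stripClass.continuous_fast (hG : stripClass ρ C G) {z : Fin (e + 1) → ℂ}
    (hz : z ∈ strip (e + 1) ρ) : Continuous fun s : Fin e → ℝ => G (z + complexify (fastVec s)) :=
  hG.1.continuousOn.comp_continuous
    (continuous_const.add (continuous_complexify.comp continuous_fastVec))
    fun _ => add_complexify_mem_strip hz _

theorem continuous_expi_neg_dotProduct (k : Fin e → ℤ) :
    Continuous fun s : Fin e → ℝ => expi (-(intVec k ⬝ᵥ s)) :=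
  continuous_expi.comp (continuous_dotProduct_right _).neg

theorem stripClass_fastModeExt (hG : stripClass ρ C G) (k : Fin e → ℤ) :
    stripClass ρ C (fastModeExt G k) := by
  have : IsProbabilityMeasure (volume.restrict (Set.Icc (0 : Fin e → ℝ) 1)) :=
    ⟨by simp [Real.volume_Icc_pi]⟩
  refine (stripClass_integral (μ := volume.restrict (Set.Icc (0 : Fin e → ℝ) 1)) (C := C)
    (F := fun s z => G (z + complexify (fastVec s)) * expi (-(intVec k ⬝ᵥ s)))
    (Eventually.of_forall fun s => ?_) fun z hz => ?_).mono le_rfl (le_of_eq ?_)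
  · refine ((hG.translate (fastVec s)).mul (stripClass.const _ ρ _)).mono le_rfl (le_of_eq ?_)
    rw [norm_expi, mul_one]
  · exact ((hG.continuous_fast hz).mul (continuous_expi_neg_dotProduct k)).aestronglyMeasurable
  · simp

theorem fastModeExt_eq (hG : stripClass ρ C G) (k : Fin e → ℤ) {z : Fin (e + 1) → ℂ}
    (hz : z ∈ strip (e + 1) ρ) : fastModeExt G k z =
      fastMode (fun x => (G (z + complexify x)).re) k 0 +
        fastMode (fun x => (G (z + complexify x)).im) k 0 * Complex.I := by
  have hc := hG.continuous_fast hz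
  have hk := continuous_expi_neg_dotProduct k
  simp only [fastMode, zero_add]
  rw [← integral_mul_const, ← integral_add]
  · refine integral_congr_ae (Eventually.of_forall fun s => ?_)
    simp only
    nth_rewrite 1 [← Complex.re_add_im (G (z + complexify (fastVec s)))]
    ring
  · exact ((Complex.continuous_ofReal.comp (Complex.continuous_re.comp hc)).mul
      hk).continuousOn.integrableOn_compact isCompact_Icc
  · exact (((Complex.continuous_ofReal.comp (Complex.continuous_im.comp hc)).mul hk).mul
      continuous_const).continuousOn.integrableOn_compact isCompact_Icc

/-- The decay of the modes on a smaller strip. -/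
theorem exists_norm_fastModeExt_le (c : ℕ) (h : ρ₂ < ρ₁) (C : ℝ) :
    ∃ B : ℝ, ∀ (g : (Fin (e + 1) → ℝ) → ℝ) (G : (Fin (e + 1) → ℂ) → ℂ), IsPeriodic g →
      stripClass ρ₁ C G → (∀ x, G (complexify x) = (g x : ℂ)) → ∀ k : Fin e → ℤ, k ≠ 0 →
        ∀ z ∈ strip (e + 1) ρ₂, ‖fastModeExt G k z‖ ≤ B * (‖k‖ ^ c)⁻¹ := by
  obtain ⟨B, hB⟩ := exists_ckClass_of_analyticClass (d := e + 1) c h C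
  refine ⟨B + B, fun g G hg hG hGg k hk z hz => ?_⟩
  obtain ⟨h1, h2⟩ := hB g G hg hG hGg z hz
  have h3 := norm_iteratedFDeriv_fastMode_le h1 hk (i := 0) (j := c) (by omega) 0
  have h4 := norm_iteratedFDeriv_fastMode_le h2 hk (i := 0) (j := c) (by omega) 0
  rw [norm_iteratedFDeriv_zero] at h3 h4
  rw [fastModeExt_eq hG k (strip_mono h.le hz), add_mul]
  refine (norm_add_le _ _).trans (add_le_add h3 ?_)
  rwa [norm_mul, Complex.norm_I, mul_one]

end

variable {A : Matrix.SpecialLinearGroup (Fin (e + 1)) ℤ} {ω : Fin e → ℝ}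
  {P : (Fin (e + 1) → ℝ) → ℝ}

theorem analyticClass_resonantPart (hρ : 0 < ρ)
    (hP : analyticClass ρ (e + 1) C fun x => P (act A⁻¹ x)) :
    analyticClass ρ (e + 1) C fun y => resonantPart A P (y (Fin.last e)) := by
  obtain ⟨B, hB⟩ := hP.exists_ckClass 1 hρ
  obtain ⟨G, hG, hGg⟩ := hP.exists_extension
  refine analyticClass_of_re (ckClass_resonantPart le_rfl hB).1 (stripClass_fastModeExt hG 0)
    fun x => ?_
  rw [fastModeExt_complexify hGg, resonantPart_eq hB]

/-- The solution of the cohomology equation is analytic on any smaller strip. -/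
theorem analyticClass_cohomologySolution {c : ℕ} (hω : TameDivisors ω c) (hρ : 0 < ρ₁)
    (h : ρ₂ < ρ₁) (hP : analyticClass ρ₁ (e + 1) C fun x => P (act A⁻¹ x)) :
    ∃ C', analyticClass ρ₂ (e + 1) C' fun y => cohomologySolution A ω P (act A⁻¹ y) := by
  obtain ⟨B, hB⟩ := hP.exists_ckClass (1 + c) hρ
  obtain ⟨G, hG, hGg⟩ := hP.exists_extension
  obtain ⟨B', hB'⟩ := exists_norm_fastModeExt_le (e := e) c h C
  refine ⟨_, analyticClass_of_re (ckClass_cohomologySolution hω le_rfl hB).1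
    (stripClass_tsum (hω.summable.mul_left B') (F := fun k z => divisorInv ω k * fastModeExt G k z)
      fun k => ⟨?_, fun z hz => ?_⟩) fun x => ?_⟩
  · exact (((stripClass_fastModeExt hG k).mono h.le le_rfl).1).const_mul _
  · by_cases hk : k = 0
    · simp [hk]
    · rw [norm_mul]
      calc _ ≤ ‖divisorInv ω k‖ * (B' * (‖k‖ ^ c)⁻¹) :=
            mul_le_mul_of_nonneg_left (hB' _ G hP.1 hG hGg k hk z hz) (norm_nonneg _)
        _ = _ := by ring
  · rw [cohomologySolution_eq hω le_rfl hB, act_act_inv]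
    simp only [fastModeExt_complexify hGg]

end AnalyticCohomology

/-! ### Calculus in the classes of analytic functions -/

section AnalyticCalculus

variable {d d' : ℕ} {ρ ρ₁ ρ₂ ρ₃ δ C C' : ℝ} {g f v : (Fin d → ℝ) → ℝ}

theorem analyticClass_mono (hg : analyticClass ρ₁ d C g) (hρ : ρ₂ ≤ ρ₁) (hC : C ≤ C') :
    analyticClass ρ₂ d C' g := by
  obtain ⟨G, hG, hGg⟩ := hg.exists_extension
  have := hG.mono hρ hC
  exact ⟨hg.1, G, this.1, hGg, this.2⟩

theorem analyticClass_const (ρ a : ℝ) : analyticClass ρ d |a| fun _ => a :=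
  ⟨fun _ _ => rfl, fun _ => (a : ℂ), differentiableOn_const _, fun _ => rfl, fun _ _ => by simp⟩

theorem analyticClass_add (hf : analyticClass ρ d C f) (hg : analyticClass ρ d C' g) :
    analyticClass ρ d (C + C') fun x => f x + g x := by
  obtain ⟨F, hF, hFf⟩ := hf.exists_extension
  obtain ⟨G, hG, hGg⟩ := hg.exists_extension
  refine analyticClass_of_re (fun x l => by rw [hf.1, hg.1]) (hF.add hG) fun x => ?_
  simp [hFf, hGg]

theorem analyticClass_mul (hf : analyticClass ρ d C f) (hg : analyticClass ρ d C' g) :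
    analyticClass ρ d (C * C') fun x => f x * g x := by
  obtain ⟨F, hF, hFf⟩ := hf.exists_extension
  obtain ⟨G, hG, hGg⟩ := hg.exists_extension
  refine analyticClass_of_re (fun x l => by rw [hf.1, hg.1]) (hF.mul hG) fun x => ?_
  simp [hFf, hGg]

theorem analyticClass_translate (a : Fin d → ℝ) (hg : analyticClass ρ d C g) :
    analyticClass ρ d C fun x => g (x + a) := by
  obtain ⟨G, hG, hGg⟩ := hg.exists_extension
  refine analyticClass_of_re (fun x l => by rw [add_right_comm, hg.1]) (hG.translate a)
    fun x => ?_
  rw [← complexify_add, hGg, Complex.ofReal_re]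

theorem analyticClass_abs_le (hρ : 0 < ρ) (hg : analyticClass ρ d C g) (x : Fin d → ℝ) :
    |g x| ≤ C := by
  obtain ⟨G, hG, hGg⟩ := hg.exists_extension
  have := hG.2 _ (complexify_mem_strip hρ x)
  rwa [hGg, Complex.norm_real] at this

theorem analyticClass_fderiv (hρ : 0 < ρ) (hg : analyticClass ρ d C g) : Differentiable ℝ g ∧
    ∀ x, ‖fderiv ℝ g x‖ ≤ 4 / ρ * ‖complexifyCLM (d := d)‖ * C := by
  obtain ⟨G, hG, hGg⟩ := hg.exists_extension
  have h1 : ∀ x, HasFDerivAt g (Complex.reCLM.comp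
      (((fderiv ℂ G (complexify x)).restrictScalars ℝ).comp complexifyCLM)) x := by
    intro x
    have h2 := ((hG.differentiableAt (complexify_mem_strip hρ x)).hasFDerivAt).restrictScalars ℝ
    have h3 : HasFDerivAt complexify (complexifyCLM (d := d)) x := complexifyCLM.hasFDerivAt
    have h4 := Complex.reCLM.hasFDerivAt.comp x (h2.comp x h3)
    refine h4.congr_of_eventuallyEq (Eventually.of_forall fun y => ?_)
    simp [hGg]
  refine ⟨fun x => (h1 x).differentiableAt, fun x => ?_⟩
  rw [(h1 x).fderiv]
  have h5 := hG.norm_fderiv_le (half_pos hρ) (ρ₂ := ρ / 2) (by linarith)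
    (complexify_mem_strip (half_pos hρ) x)
  refine (ContinuousLinearMap.opNorm_comp_le _ _).trans ?_
  rw [Complex.reCLM_norm, one_mul]
  refine (ContinuousLinearMap.opNorm_comp_le _ _).trans ?_
  rw [ContinuousLinearMap.norm_restrictScalars]
  calc _ ≤ 2 * C / (ρ / 2) * ‖complexifyCLM (d := d)‖ := by gcongr
    _ = _ := by field_simp; ring

/-- Linear maps between tori. -/
theorem analyticClass_comp_linear (T : (Fin d' → ℝ) →L[ℝ] (Fin d → ℝ))
    (hT : ∀ l : Fin d' → ℤ, ∃ l' : Fin d → ℤ, T (intVec l) = intVec l') (hρ₂ : 0 < ρ₂)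
    (h : ‖T‖ * ρ₂ < ρ₁) (hg : analyticClass ρ₁ d C g) :
    analyticClass ρ₂ d' C fun x => g (T x) := by
  obtain ⟨G, hG, hGg⟩ := hg.exists_extension
  set Tc : (Fin d' → ℂ) → Fin d → ℂ := fun z => ∑ j, z j • complexify (T (Pi.single j 1)) with hTc
  have hTx : ∀ x : Fin d' → ℝ, T x = ∑ j, x j • T (Pi.single j 1) := by
    intro x
    conv_lhs => rw [pi_eq_sum_univ' x]
    simp
  have hTr : ∀ x, Tc (complexify x) = complexify (T x) := by
    intro x
    rw [hTx x]
    funext i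
    simp [hTc, complexify]
  have hmaps : Set.MapsTo Tc (strip d' ρ₂) (strip d ρ₁) := by
    intro z hz i
    have h1 : (Tc z i).im = T (fun j => (z j).im) i := by
      rw [hTx]
      simp [hTc, complexify]
    have h2 : ‖fun j => (z j).im‖ ≤ ρ₂ := (pi_norm_le_iff_of_nonneg hρ₂.le).2 fun j => (hz j).le
    rw [h1, ← Real.norm_eq_abs]
    refine (norm_le_pi_norm _ i).trans_lt ((T.le_opNorm _).trans_lt ?_)
    exact (mul_le_mul_of_nonneg_left h2 (norm_nonneg _)).trans_lt h
  refine analyticClass_of_re (fun x l => ?_)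
    (hG.comp (Differentiable.differentiableOn (by simp only [hTc]; fun_prop)) hmaps) fun x => ?_
  · obtain ⟨l', hl'⟩ := hT l
    rw [map_add, hl', hg.1]
  · rw [hTr, hGg, Complex.ofReal_re]

theorem complexify_add_smul (x u : Fin d → ℝ) (t : ℝ) :
    complexify x + (t : ℂ) • complexify u = complexify (x + t • u) := by
  rw [complexify_add, complexify_smul]

theorem stripClass.const_mul_ofReal {V : (Fin d → ℂ) → ℂ} (hV : stripClass ρ C V) (ε : ℝ) :
    stripClass ρ (|ε| * C) fun z => (ε : ℂ) * V z := by
  refine ((stripClass.const d ρ (ε : ℂ)).mul hV).mono le_rfl (le_of_eq ?_)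
  rw [Complex.norm_real, Real.norm_eq_abs]

theorem analyticClass_comp_displacement (u : Fin d → ℝ) {ε : ℝ}
    (h : ρ₂ + |ε| * C' * ‖u‖ ≤ ρ₁) (hf : analyticClass ρ₁ d C f) (hv : analyticClass ρ₂ d C' v) :
    analyticClass ρ₂ d C fun x => f (x + (ε * v x) • u) := by
  obtain ⟨F, hF, hFf⟩ := hf.exists_extension
  obtain ⟨V, hV, hVv⟩ := hv.exists_extension
  refine analyticClass_of_re (fun x l => by rw [hv.1, add_right_comm, hf.1])
    (hF.displace (hV.const_mul_ofReal ε) h) fun x => ?_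
  rw [hVv, ← Complex.ofReal_mul, complexify_add_smul, hFf, Complex.ofReal_re]

theorem cauchyAlong_periodic {G : (Fin d → ℂ) → ℂ} {u : Fin d → ℝ} (hδ : 0 ≤ δ)
    (h : ρ₂ + δ * ‖u‖ ≤ ρ₁) {z : Fin d → ℂ} (hz : z ∈ strip d ρ₂) {a : Fin d → ℝ}
    (hG : ∀ z ∈ strip d ρ₁, G (z + complexify a) = G z) {k : ℂ → (Fin d → ℂ) → ℂ}
    (hk : ∀ ξ, k ξ (z + complexify a) = k ξ z) :
    cauchyAlong u δ G k (z + complexify a) = cauchyAlong u δ G k z := by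
  unfold cauchyAlong
  congr 1
  refine circleIntegral.integral_congr hδ fun ξ hξ => ?_
  simp only [hk]
  rw [add_right_comm, hG _ (add_smul_mem_strip hz (norm_eq_of_mem_sphere hξ).le h)]

/-- Taylor's formula for displacements along `u`, in the classes of analytic functions. -/
theorem analyticClass_taylor (u : Fin d → ℝ) (hδ : 0 < δ) (h : ρ₂ + δ * ‖u‖ ≤ ρ₁) (hρ₂ : 0 < ρ₂)
    (hg : analyticClass ρ₁ d C g) :
    ∃ D : ℕ → (Fin d → ℝ) → ℝ, D 0 = g ∧ (∀ l, ∃ C', analyticClass ρ₂ d C' (D l)) ∧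
      ∀ L ρ₃ ε C₂ v, 0 < ρ₃ → ρ₃ ≤ ρ₂ → analyticClass ρ₃ d C₂ v → |ε| * C₂ ≤ δ / 2 →
        ∃ w, analyticClass ρ₃ d (δ * ((δ ^ L * (δ / 2))⁻¹ * C)) w ∧
          ∀ x, g (x + (ε * v x) • u) =
            ∑ l ∈ Finset.range L, (ε * v x) ^ l * D l x + (ε * v x) ^ L * w x := by
  obtain ⟨G, hG, hGg⟩ := hg.exists_extension
  have hper : ∀ (l : Fin d → ℤ), ∀ z ∈ strip d ρ₁, G (z + complexify (intVec l)) = G z :=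
    fun l z hz => stripClass.periodic hG.1 hg.1 hGg l hz
  refine ⟨fun l x => (taylorCoeff u δ G l (complexify x)).re, ?_,
    fun l => ⟨δ * ((δ ^ (l + 1))⁻¹ * C), ?_⟩, ?_⟩
  · funext x
    have h1 := taylor_along hG hδ h 1 (V := fun _ => 0) (complexify_mem_strip hρ₂ x)
      (by simpa using (half_pos hδ).le)
    simp only [zero_smul, add_zero, Finset.sum_range_one, pow_zero, one_mul, pow_one,
      zero_mul] at h1
    change (taylorCoeff u δ G 0 (complexify x)).re = g x
    rw [← h1, hGg, Complex.ofReal_re]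
  · refine analyticClass_of_re (fun x l' => ?_) (stripClass_taylorCoeff hG hδ h l) fun x => rfl
    simp only [complexify_add, taylorCoeff]
    rw [cauchyAlong_periodic hδ.le h (complexify_mem_strip hρ₂ x) (hper l') fun ξ => rfl]
  · intro L ρ₃ ε C₂ v hρ₃ h32 hv hε
    obtain ⟨V, hV, hVv⟩ := hv.exists_extension
    have hV' := (hV.const_mul_ofReal ε).mono le_rfl hε
    have h' : ρ₃ + δ * ‖u‖ ≤ ρ₁ := by linarith
    refine ⟨fun x => (taylorRemainder u δ G L (fun z => (ε : ℂ) * V z) (complexify x)).re,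
      analyticClass_of_re (fun x l' => ?_) (stripClass_taylorRemainder hG hδ h' L hV')
        fun x => rfl, fun x => ?_⟩
    · simp only [complexify_add, taylorRemainder]
      rw [cauchyAlong_periodic hδ.le h' (complexify_mem_strip hρ₃ x) (hper l') fun ξ => ?_]
      rw [stripClass.periodic hV.1 hv.1 hVv l' (complexify_mem_strip hρ₃ x)]
    · have hx := complexify_mem_strip hρ₃ x
      have h1 := congrArg Complex.re
        (taylor_along hG hδ h' L (V := fun z => (ε : ℂ) * V z) hx (hV'.2 _ hx))
      simp only [hVv, ← Complex.ofReal_mul, complexify_add_smul, hGg, Complex.ofReal_re,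
        Complex.add_re, ← Complex.ofReal_pow, Complex.re_ofReal_mul, Complex.re_sum] at h1
      exact h1

/-- The implicit function theorem in the classes of analytic functions, along `u`, by iteration. -/
theorem analyticClass_implicit (u : Fin d → ℝ) (hρ₂ : 0 < ρ₂) (h : ρ₂ < ρ₁) (C C' : ℝ) :
    ∃ C'' : ℝ, ∀ᶠ ε in 𝓝 (0 : ℝ), ∀ a b, analyticClass ρ₂ d C a → analyticClass ρ₁ d C' b →
      ∃ w, analyticClass ρ₂ d C'' w ∧ ∀ x, w x = a x + b (x + (ε * w x) • u) := by
  set M : ℝ := C + C' with hM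
  set η : ℝ := (ρ₁ - ρ₂) / 2 with hη
  have hη0 : 0 < η := by simp only [hη]; linarith
  refine ⟨2 * M, ?_⟩
  filter_upwards [eventually_nhds_abs_mul_le (2 * M * ‖u‖) hη0,
    eventually_nhds_abs_mul_le (‖u‖ * (2 * C' / η)) (by norm_num : (0 : ℝ) < 1 / 2)]
    with ε hε1 hε2 a b ha hb
  obtain ⟨Ga, hGa, hGaa⟩ := ha.exists_extension
  obtain ⟨Gb, hGb, hGbb⟩ := hb.exists_extension
  have hM0 : 0 ≤ M := add_nonneg (hGa.nonneg hρ₂) (hGb.nonneg (hρ₂.trans h))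
  have hmem : ∀ z ∈ strip d ρ₂, ∀ p : ℂ, ‖p‖ ≤ 2 * M →
      z + ((ε : ℂ) * p) • complexify u ∈ strip d (ρ₂ + η) := by
    intro z hz p hp
    refine add_smul_mem_strip hz (δ := |ε| * (2 * M)) ?_ ?_
    · rw [norm_mul, Complex.norm_real, Real.norm_eq_abs]
      gcongr
    · linarith [mul_assoc |ε| (2 * M) ‖u‖]
  have hsub : strip d (ρ₂ + η) ⊆ strip d ρ₁ := strip_mono (by simp only [hη]; linarith)
  have hlip : ∀ z ∈ strip d ρ₂, ∀ p q : ℂ, ‖p‖ ≤ 2 * M → ‖q‖ ≤ 2 * M →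
      ‖Gb (z + ((ε : ℂ) * p) • complexify u) - Gb (z + ((ε : ℂ) * q) • complexify u)‖ ≤
        1 / 2 * ‖p - q‖ := by
    intro z hz p q hp hq
    have h3 := Convex.norm_image_sub_le_of_norm_fderiv_le (𝕜 := ℂ) (f := Gb)
      (fun y hy => hGb.differentiableAt (hsub hy))
      (fun y hy => hGb.norm_fderiv_le hη0 (by simp only [hη]; linarith) hy)
      (convex_strip d (ρ₂ + η)) (hmem z hz q hq) (hmem z hz p hp)
    rw [add_sub_add_left_eq_sub, ← sub_smul, ← mul_sub, norm_smul, norm_mul, Complex.norm_real,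
      Real.norm_eq_abs, norm_complexify] at h3
    calc _ ≤ _ := h3
      _ = |ε| * (‖u‖ * (2 * C' / η)) * ‖p - q‖ := by ring
      _ ≤ _ := by gcongr
  -- the iterates on the strip and on the real subspace
  obtain ⟨W, hW0, hW1⟩ : ∃ W : ℕ → (Fin d → ℂ) → ℂ, (∀ z, W 0 z = 0) ∧
      ∀ k z, W (k + 1) z = Ga z + Gb (z + ((ε : ℂ) * W k z) • complexify u) :=
    ⟨fun k => Nat.rec (fun _ => 0)
      (fun _ V z => Ga z + Gb (z + ((ε : ℂ) * V z) • complexify u)) k, fun _ => rfl, fun _ _ => rfl⟩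
  obtain ⟨w, hw0, hw1⟩ : ∃ w : ℕ → (Fin d → ℝ) → ℝ, (∀ x, w 0 x = 0) ∧
      ∀ k x, w (k + 1) x = a x + b (x + (ε * w k x) • u) :=
    ⟨fun k => Nat.rec (fun _ => 0) (fun _ v x => a x + b (x + (ε * v x) • u)) k,
      fun _ => rfl, fun _ _ => rfl⟩
  have hWw : ∀ k x, W k (complexify x) = (w k x : ℂ) := by
    intro k
    induction k with
    | zero => exact fun x => by rw [hW0, hw0, Complex.ofReal_zero]
    | succ k ih =>
      intro x
      rw [hW1, hw1, ih, ← Complex.ofReal_mul, complexify_add_smul, hGaa, hGbb, Complex.ofReal_add]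
  have hwper : ∀ k, IsPeriodic (w k) := by
    intro k
    induction k with
    | zero => exact fun _ _ => by rw [hw0, hw0]
    | succ k ih =>
      intro x l
      rw [hw1, hw1, ih, add_right_comm, ha.1, hb.1]
  have hWc : ∀ k, stripClass ρ₂ M (W k) := by
    intro k
    induction k with
    | zero => exact ⟨(differentiableOn_const 0).congr fun z _ => hW0 z, fun z _ => by simpa [hW0]⟩
    | succ k ih =>
      rw [funext (hW1 k)]
      refine hGa.add (hGb.displace (ih.const_mul_ofReal ε) ?_)
      have : |ε| * M * ‖u‖ ≤ |ε| * (2 * M * ‖u‖) := by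
        rw [mul_assoc]
        gcongr
        linarith
      simp only [hη] at hε1
      linarith
  have h2M : ∀ k, ∀ z ∈ strip d ρ₂, ‖W k z‖ ≤ 2 * M := fun k z hz =>
    ((hWc k).2 z hz).trans (by linarith)
  have hdiff : ∀ k, stripClass ρ₂ ((1 / 2) ^ k * M) fun z => W (k + 1) z - W k z := by
    intro k
    refine ⟨(hWc (k + 1)).1.sub (hWc k).1, ?_⟩
    beta_reduce
    induction k with
    | zero =>
      intro z hz
      rw [hW0, sub_zero, pow_zero, one_mul]
      exact (hWc 1).2 z hz
    | succ k ih =>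
      intro z hz
      have h3 := hlip z hz (W (k + 1) z) (W k z) (h2M _ z hz) (h2M _ z hz)
      have h4 := ih z hz
      have h5 : W (k + 1 + 1) z - W (k + 1) z = Gb (z + ((ε : ℂ) * W (k + 1) z) • complexify u) -
          Gb (z + ((ε : ℂ) * W k z) • complexify u) := by
        rw [hW1 (k + 1)]
        nth_rewrite 2 [hW1 k]
        rw [add_sub_add_left_eq_sub]
      rw [h5, pow_succ]
      linarith
  have hgeo : Summable fun k : ℕ => (1 / 2 : ℝ) ^ k * M := summable_geometric_two.mul_right M
  have hS := stripClass_tsum hgeo hdiff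
  rw [tsum_mul_right, tsum_geometric_two] at hS
  set S : (Fin d → ℂ) → ℂ := fun z => ∑' k, (W (k + 1) z - W k z) with hSdef
  have hlim : ∀ z ∈ strip d ρ₂, Tendsto (fun k => W k z) atTop (𝓝 (S z)) := by
    intro z hz
    have h1 := (Summable.of_norm_bounded hgeo fun k => (hdiff k).2 z hz).hasSum.tendsto_sum_nat
    refine h1.congr fun k => ?_
    rw [Finset.sum_range_sub fun k => W k z, hW0, sub_zero]
  have hSeq : ∀ z ∈ strip d ρ₂, S z = Ga z + Gb (z + ((ε : ℂ) * S z) • complexify u) := by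
    intro z hz
    refine tendsto_nhds_unique ((hlim z hz).comp (tendsto_add_atTop_nat 1)) ?_
    refine Tendsto.congr (fun k => (hW1 k z).symm) ?_
    have h1 : Tendsto (fun k => z + ((ε : ℂ) * W k z) • complexify u) atTop
        (𝓝 (z + ((ε : ℂ) * S z) • complexify u)) :=
      (((hlim z hz).const_mul _).smul_const _).const_add _
    exact (((hGb.differentiableAt (hsub (hmem z hz _ (hS.2 z hz)))).continuousAt.tendsto.comp
      h1).const_add (Ga z))
  have hSr : ∀ x, S (complexify x) = ((∑' k, (w (k + 1) x - w k x) : ℝ) : ℂ) := by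
    intro x
    simp only [hSdef, hWw, ← Complex.ofReal_sub, Complex.ofReal_tsum]
  refine ⟨fun x => ∑' k, (w (k + 1) x - w k x), analyticClass_of_re (fun x l => ?_) hS
    fun x => ?_, fun x => ?_⟩
  · refine tsum_congr fun k => ?_
    rw [hwper, hwper]
  · rw [hSr, Complex.ofReal_re]
  · have h1 := hSeq _ (complexify_mem_strip hρ₂ x)
    rw [hSr, ← Complex.ofReal_mul, complexify_add_smul, hGaa, hGbb, ← Complex.ofReal_add] at h1
    exact Complex.ofReal_injective h1

end AnalyticCalculus

/-! ### The scale of the classes of analytic functions -/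

section AnalyticScale

variable {e : ℕ} {A : Matrix.SpecialLinearGroup (Fin (e + 1)) ℤ} {ω : Fin e → ℝ}
  {Ω : Fin (e + 1) → ℝ} {α₀ : ℝ} {L : Fin (e + 1) → ℤ}

/-- Functions `f` such that `f ∘ A⁻¹` is analytic, with an extension to the strip of width
`ρ (t + 1)`. -/
def analyticScale (A : Matrix.SpecialLinearGroup (Fin (e + 1)) ℤ) (ρ : ℝ) (t : ℕ) (C : ℝ)
    (f : (Fin (e + 1) → ℝ) → ℝ) : Prop :=
  analyticClass (ρ * (t + 1)) (e + 1) C fun y => f (act A⁻¹ y)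

/-- The analytic functions on the strips of width `ρ (t + 1)`: by Cauchy's integral formula, every
loss of regularity in the scale is at the price of a strip narrower by `ρ`. The width `ρ'` in the
original coordinates allows for the distortion of the strip by `A`. -/
theorem regularityScale_analytic {ρ ρ' : ℝ} (hρ : 0 < ρ) (hρ' : 0 < ρ') (h : ρ' ≤ ρ)
    (hA : ‖actCLM A‖ * ρ' < ρ) (hS : ‖slowCLM e‖ * ρ' < ρ) {c : ℕ} (hc : 1 ≤ c)
    (hω : TameDivisors ω c)
    (hθ : act A (α₀ • Ω) = (Fin.snoc ω 0 : Fin (e + 1) → ℝ) + intVec L) :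
    RegularityScale A ω Ω α₀ c (analyticClass ρ') (analyticScale A ρ) := by
  have hmono : ∀ {t t' : ℕ}, t' ≤ t → ρ * ((t' : ℝ) + 1) ≤ ρ * (t + 1) := fun h => by
    have : ((_ : ℕ) : ℝ) ≤ _ := Nat.cast_le.2 h
    gcongr
  have hpos : ∀ t : ℕ, 0 < ρ * ((t : ℝ) + 1) := fun t => by positivity
  have h0 : ρ * (((0 : ℕ) : ℝ) + 1) = ρ := by simp
  have h1 : ρ * (((1 : ℕ) : ℝ) + 1) = ρ + ρ := by push_cast; ring
  refine
    { mono := fun h ht hC => analyticClass_mono h (hmono ht) hC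
      const := fun t a => analyticClass_const _ a
      add := fun hf hg => analyticClass_add hf hg
      mul := fun t => ⟨1, fun hf hg => by
        simpa only [analyticScale, one_mul] using analyticClass_mul hf hg⟩
      translate := ?_
      fderiv_le := ?_
      bound := ?_
      comp := ?_
      taylor := ?_
      implicit := ?_
      cohomology := ?_
      cohomology_eq := ?_
      resonant := ?_
      class_mono := fun h hC => analyticClass_mono h le_rfl hC
      toClass := ?_
      toClass_act := ⟨1, fun {C f} hf =>
        analyticClass_mono hf (by rw [h0]; exact h) (one_mul C).ge⟩
      toClass_circle := ?_ }
  · intro t C f a hf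
    have := analyticClass_translate (act A a) hf
    simpa only [analyticScale, act_add, act_inv_act] using this
  · refine ⟨4 / ρ * ‖complexifyCLM (d := e + 1)‖ * ‖actCLM A‖, fun {C f} hf => ?_⟩
    obtain ⟨hd, hb⟩ := analyticClass_fderiv (hpos 0) hf
    have h1 : ∀ x, HasFDerivAt f ((fderiv ℝ (fun y => f (act A⁻¹ y)) (act A x)).comp (actCLM A)) x := by
      intro x
      have h2 := (hd (act A x)).hasFDerivAt.comp x (actCLM A).hasFDerivAt
      refine h2.congr_of_eventuallyEq (Eventually.of_forall fun y => ?_)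
      simp
    refine ⟨fun x => (h1 x).differentiableAt, fun x => ?_⟩
    rw [(h1 x).fderiv]
    refine (ContinuousLinearMap.opNorm_comp_le _ _).trans ?_
    refine (mul_le_mul_of_nonneg_right (hb _) (norm_nonneg _)).trans (le_of_eq ?_)
    rw [h0]
    ring
  · intro C f hf x
    simpa using analyticClass_abs_le (hpos 0) hf (act A x)
  · intro C C'
    refine ⟨C, ?_⟩
    filter_upwards [eventually_nhds_abs_mul_le (C' * ‖act A Ω‖) hρ] with ε hε f v hf hv _
    have := analyticClass_comp_displacement (act A Ω) (ε := ε) (by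
      rw [h0, h1, mul_assoc]; linarith) hf hv
    simpa only [analyticScale, act_inv_add_smul] using this
  · intro r l C f hf hl hlr
    obtain ⟨r, rfl⟩ := Nat.exists_eq_add_of_le' (hl.trans hlr)
    set u := act A Ω with hu
    set δ : ℝ := ρ / (‖u‖ + 1) with hδ
    have hδ0 : 0 < δ := by positivity
    have hδu : δ * ‖u‖ ≤ ρ := by
      rw [hδ, div_mul_eq_mul_div, div_le_iff₀ (by positivity)]
      nlinarith [norm_nonneg u]
    obtain ⟨D, hD0, hD, hrem⟩ := analyticClass_taylor (ρ₂ := ρ * ((r : ℝ) + 1)) u hδ0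
      (by push_cast; linarith) (hpos r) hf
    refine ⟨fun i x => D i (act A x), ?_, fun i hi => ?_,
      fun C₂ => ⟨δ * ((δ ^ l * (δ / 2))⁻¹ * C), ?_⟩⟩
    · funext x
      simp [hD0]
    · rcases Nat.eq_zero_or_pos i with rfl | hi0
      · exact ⟨C, by simpa only [analyticScale, act_act_inv, hD0, Nat.sub_zero] using hf⟩
      · obtain ⟨C', hC'⟩ := hD i
        refine ⟨C', analyticClass_mono (C := C') ?_ (hmono (by omega : r + 1 - i ≤ r)) le_rfl⟩
        simpa only [act_act_inv] using hC'
    · filter_upwards [eventually_nhds_abs_mul_le C₂ (half_pos hδ0)] with ε hε v hv _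
      obtain ⟨w, hw, heq⟩ := hrem l _ ε C₂ _ (hpos 0) (hmono (Nat.zero_le r)) hv hε
      refine ⟨fun x => w (act A x), by simpa only [analyticScale, act_act_inv] using hw, fun x => ?_⟩
      have h2 := heq (act A x)
      simp only [act_inv_act] at h2
      rw [← h2, hu, ← act_inv_add_smul, act_inv_act]
  · intro C C'
    obtain ⟨C'', h⟩ := analyticClass_implicit (ρ₁ := ρ * (((1 : ℕ) : ℝ) + 1)) (act A Ω) (hpos 0)
      (by rw [h0, h1]; linarith) C C'
    refine ⟨C'', ?_⟩
    filter_upwards [h] with ε hε a b ha hb _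
    obtain ⟨w, hw, heq⟩ := hε _ _ ha hb
    refine ⟨fun x => w (act A x), by simpa only [analyticScale, act_act_inv] using hw, fun x => ?_⟩
    have h2 := heq (act A x)
    rwa [act_inv_act, ← act_inv_add_smul, act_inv_act] at h2
  · intro t C P hP
    refine analyticClass_cohomologySolution hω (hpos _) ?_ hP
    have : (1 : ℝ) ≤ c := by exact_mod_cast hc
    push_cast
    refine mul_lt_mul_of_pos_left ?_ hρ
    linarith
  · intro C P hP x
    obtain ⟨B, hB⟩ := analyticClass.exists_ckClass (1 + c) (hpos _) hP
    exact cohomologySolution_sub hω le_rfl hB hθ x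
  · intro t C P hP
    refine ⟨C, ?_⟩
    have := analyticClass_resonantPart (hpos t) hP
    simpa only [analyticScale, act_act_inv] using this
  · refine ⟨1, fun {C f} hf => ?_⟩
    have h := analyticClass_comp_linear (actCLM A) (fun l => ⟨_, act_intVec A l⟩) hρ'
      (by rwa [h0]) hf
    simp only [actCLM_apply, act_inv_act] at h
    rwa [one_mul]
  · refine ⟨1, fun {C f} hf => ?_⟩
    have h := analyticClass_comp_linear (slowCLM e) (fun l => ⟨_, slowCLM_intVec l⟩) hρ'
      (by rwa [h0]) hf
    simp only [slowCLM_apply] at h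
    rwa [one_mul]

end AnalyticScale

/-! ### Analytic families -/

section AnalyticFamilies

variable {d : ℕ} {I : Set ℝ} {ρ ρ₁ ρ₂ : ℝ}

/-- A point of a strip and an integer translate of it in a compact set. -/
theorem exists_intVec_add_mem_box {z : Fin d → ℂ} (hz : z ∈ strip d ρ) :
    ∃ l : Fin d → ℤ, z + complexify (intVec l) ∈
      Set.univ.pi fun _ : Fin d => Set.Icc (0 : ℝ) 1 ×ℂ Set.Icc (-ρ) ρ := by
  obtain ⟨l, hl⟩ := exists_intVec_add_mem_Icc fun i => (z i).re
  refine ⟨l, fun i _ => ⟨?_, ?_⟩⟩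
  · have h1 := hl.1 i
    have h2 := hl.2 i
    simpa [complexify, intVec] using And.intro h1 h2
  · have h1 := abs_le.1 (hz i).le
    simpa [complexify, intVec] using h1

/-- The members of an analytic family and their derivatives with respect to the parameter are
bounded on smaller strips, locally uniformly in the parameter. -/
theorem exists_stripClass_of_family {k : ℕ} {G : ℕ → ℝ → (Fin d → ℂ) → ℂ} (h : ρ₂ < ρ₁)
    (hper : ∀ j ≤ k, ∀ ε ∈ I, ∀ (l : Fin d → ℤ), ∀ z ∈ strip d ρ₁,
      G j ε (z + complexify (intVec l)) = G j ε z)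
    (hG : ∀ j ≤ k, ∀ ε ∈ I, DifferentiableOn ℂ (G j ε) (strip d ρ₁))
    (hc : ∀ j ≤ k, ContinuousOn (fun z : ℝ × (Fin d → ℂ) => G j z.1 z.2) (I ×ˢ strip d ρ₁))
    {J : Set ℝ} (hJ : IsCompact J) (hJI : J ⊆ I) :
    ∃ C : ℝ, ∀ j ≤ k, ∀ ε ∈ J, stripClass ρ₂ C (G j ε) := by
  set box : Set (Fin d → ℂ) := Set.univ.pi fun _ => Set.Icc (0 : ℝ) 1 ×ℂ Set.Icc (-ρ₂) ρ₂ with hbox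
  have hboxc : IsCompact box := isCompact_univ_pi fun _ => isCompact_Icc.reProdIm isCompact_Icc
  have hboxs : box ⊆ strip d ρ₁ := fun z hz i =>
    (abs_le.2 (hz i (Set.mem_univ i)).2).trans_lt h
  have h1 : ∀ j ≤ k, ∃ C : ℝ, ∀ ε ∈ J, ∀ z ∈ strip d ρ₂, ‖G j ε z‖ ≤ C := by
    intro j hj
    obtain ⟨C, hC⟩ := (hJ.prod hboxc).exists_bound_of_continuousOn
      ((hc j hj).mono (Set.prod_mono hJI hboxs))
    refine ⟨C, fun ε hε z hz => ?_⟩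
    obtain ⟨l, hl⟩ := exists_intVec_add_mem_box hz
    rw [← hper j hj ε (hJI hε) l z (strip_mono h.le hz)]
    exact hC (ε, z + complexify (intVec l)) ⟨hε, hl⟩
  choose! C hC using h1
  refine ⟨∑ j ∈ Finset.range (k + 1), |C j|, fun j hj ε hε =>
    ⟨(hG j hj ε (hJI hε)).mono (strip_mono h.le), fun z hz => ?_⟩⟩
  refine (hC j hj ε hε z hz).trans ((le_abs_self _).trans ?_)
  exact Finset.single_le_sum (f := fun j => |C j|) (fun i _ => abs_nonneg _)
    (Finset.mem_range.2 (Nat.lt_succ_of_le hj))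

/-- The remainder in the Taylor expansion of an analytic family. -/
theorem analyticClass_integral_family {N : ℕ} {g : ℝ → (Fin d → ℂ) → ℂ} {a b C : ℝ} (hρ : 0 < ρ)
    (ha : a ≤ 0) (hb : 0 ≤ b) (hg : ∀ ε ∈ Set.Icc a b, stripClass ρ C (g ε))
    (hper : ∀ ε ∈ Set.Icc a b, IsPeriodic fun x => (g ε (complexify x)).re)
    (hc : ContinuousOn (fun z : ℝ × (Fin d → ℂ) => g z.1 z.2) (Set.Icc a b ×ˢ strip d ρ))
    {ε : ℝ} (hε : ε ∈ Set.Icc a b) :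
    analyticClass ρ d C fun x => ∫ s in Set.Icc (0 : ℝ) 1,
      ((1 - s) ^ N * ((N.factorial : ℝ))⁻¹) * (g (s * ε) (complexify x)).re := by
  have hmaps : Set.MapsTo (fun s : ℝ => s * ε) (Set.Icc 0 1) (Set.Icc a b) := fun s hs =>
    mul_mem_Icc ha hb hs hε
  set F : ℝ → (Fin d → ℂ) → ℂ := fun s z =>
    (((1 - s) ^ N * ((N.factorial : ℝ))⁻¹ : ℝ) : ℂ) * g (s * ε) z with hF
  have hprob : IsProbabilityMeasure (volume.restrict (Set.Icc (0 : ℝ) 1)) := ⟨by simp⟩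
  have hcont : ∀ z ∈ strip d ρ, ContinuousOn (fun s => F s z) (Set.Icc (0 : ℝ) 1) := by
    intro z hz
    refine ContinuousOn.mul (Continuous.continuousOn (by fun_prop)) ?_
    exact hc.comp (f := fun s : ℝ => (s * ε, z)) (by fun_prop) fun s hs => ⟨hmaps hs, hz⟩
  refine analyticClass_of_re (fun x l => ?_) ((stripClass_integral (C := C) (F := F)
    (μ := volume.restrict (Set.Icc (0 : ℝ) 1))
    ((ae_restrict_mem measurableSet_Icc).mono fun s hs => ?_) fun z hz => ?_).mono le_rfl
      (le_of_eq (by simp))) fun x => ?_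
  · refine setIntegral_congr_fun measurableSet_Icc fun s hs => ?_
    have := hper _ (hmaps hs) x l
    simp only at this ⊢
    rw [this]
  · refine ((stripClass.const d ρ _).mul (hg _ (hmaps hs))).mono le_rfl ?_
    have hC := (hg _ (hmaps hs)).nonneg hρ
    rw [Complex.norm_real, Real.norm_eq_abs]
    exact mul_le_of_le_one_left hC (remainder_weight_le hs N)
  · exact (hcont z hz).aestronglyMeasurable measurableSet_Icc
  · have h1 := Complex.reCLM.integral_comp_comm (μ := volume.restrict (Set.Icc (0 : ℝ) 1))
      ((hcont _ (complexify_mem_strip hρ x)).integrableOn_compact isCompact_Icc)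
    simp only [Complex.reCLM_apply, hF, Complex.re_ofReal_mul] at h1
    exact h1.symm

end AnalyticFamilies

section AnalyticCase

variable {e : ℕ} {A : Matrix.SpecialLinearGroup (Fin (e + 1)) ℤ} {ω : Fin e → ℝ}
  {Ω : Fin (e + 1) → ℝ} {α₀ : ℝ} {L : Fin (e + 1) → ℤ} {I : Set ℝ}
  {f : ℝ → (Fin (e + 1) → ℝ) → ℝ} {n m : ℕ}

/-- The normal form for analytic families. -/
theorem hasResonantNormalForm_of_isAnalyticFamily (hΩ : IsIrrational Ω) (hα₀ : α₀ ≠ 0)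
    (hint : IsIntrinsicFrequency (α₀ • Ω) A ω L) {ν τ : ℝ} (hν : 0 < ν) (hdio : IsDiophantine ν τ ω)
    (hI : I.OrdConnected) (hI0 : (0 : ℝ) ∈ I) (hI1 : I.Nontrivial) (hm : 1 ≤ m)
    (hn : IsResonanceOrder A ω I Ω f α₀ n)
    (hf : IsAnalyticFamily (n + m) I fun ε x => ε * f ε x) :
    ∃ ρ : ℝ, 0 < ρ ∧ HasResonantNormalForm A ω I Ω f α₀ L (analyticClass ρ) n m := by
  obtain ⟨c₀, hc₀⟩ := exists_nat_gt τ
  obtain ⟨c, hc, hc1⟩ : ∃ c : ℕ, τ < c ∧ 1 ≤ c := ⟨c₀ + 1, by push_cast; linarith, by omega⟩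
  have hω := hdio.tameDivisors hν hc
  have := neBot_nhdsWithin_diff hI hI0 hI1
  obtain ⟨hper, ρ₀, hρ₀, G, hG0, hGd, hGc, hGε⟩ := hf
  obtain ⟨a, b, ha, hb, hab, hev⟩ := exists_Icc_nhdsWithin hI hI0
  have hGper : ∀ j ≤ n + m, ∀ ε ∈ I, ∀ (l : Fin (e + 1) → ℤ), ∀ z ∈ strip (e + 1) ρ₀,
      G j ε (z + complexify (intVec l)) = G j ε z := by
    intro j hj ε hε l z hz
    exact periodic_of_hasDerivWithinAt hI hI1 (D := strip (e + 1) ρ₀)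
      (S := fun z => z + complexify (intVec l)) hGε
      (fun z hz => add_complexify_mem_strip hz _)
      (fun ε hε z hz => stripClass.periodic (hGd 0 (Nat.zero_le _) ε hε) (hper ε hε)
        (fun x => hG0 ε hε x) l hz) j hj ε hε z hz
  obtain ⟨C, hC⟩ := exists_stripClass_of_family (half_lt_self hρ₀) hGper hGd hGc isCompact_Icc hab
  have hre : ∀ j ≤ n + m, ∀ ε ∈ I, IsPeriodic fun x => (G j ε (complexify x)).re := by
    intro j hj ε hε x l
    simp only
    rw [complexify_add, hGper j hj ε hε l _ (complexify_mem_strip hρ₀ x)]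
  obtain ⟨N, hN⟩ : ∃ N, N = n + m - 1 := ⟨_, rfl⟩
  have hN1 : n + m = N + 1 := by omega
  have h00 : (0 : ℝ) ∈ Set.Icc a b := ⟨ha, hb⟩
  -- the widths of the strips in the coordinates given by `A`
  set T : ℕ := N * (c + 1) with hT
  set ρ : ℝ := ρ₀ / 2 / ((‖actCLM A⁻¹‖ + 1) * (T + 1)) with hρ
  have hρ0 : 0 < ρ := by positivity
  set ρ' : ℝ := ρ / (‖actCLM A‖ + ‖slowCLM e‖ + 1) with hρ'
  have hρ'0 : 0 < ρ' := by positivity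
  have hρ'eq : ρ' * (‖actCLM A‖ + ‖slowCLM e‖ + 1) = ρ := div_mul_cancel₀ _ (by positivity)
  have hρeq : ρ * ((‖actCLM A⁻¹‖ + 1) * (T + 1)) = ρ₀ / 2 := div_mul_cancel₀ _ (by positivity)
  have hA0 : 0 ≤ ρ' * ‖actCLM A‖ := by positivity
  have hS0 : 0 ≤ ρ' * ‖slowCLM e‖ := by positivity
  have hX := regularityScale_analytic (A := A) (Ω := Ω) (α₀ := α₀) hρ0 hρ'0 (by linarith)
    (by linarith) (by linarith) hc1 hω hint.1
  have hrot : ∀ {C : ℝ} {g : (Fin (e + 1) → ℝ) → ℝ}, analyticClass (ρ₀ / 2) (e + 1) C g →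
      analyticScale A ρ T C g := fun hg =>
    analyticClass_comp_linear (actCLM A⁻¹) (fun l => ⟨_, act_intVec A⁻¹ l⟩) (by positivity)
      (by
        have : 0 < ρ * ((T : ℝ) + 1) := by positivity
        linarith) hg
  refine ⟨ρ', hρ'0, hX.hasResonantNormalForm hΩ.ne_zero hα₀ hint hm hn
    (γ₀ := fun i x => ((i + 1).factorial : ℝ)⁻¹ * (G (i + 1) 0 (complexify x)).re)
    (ψ := fun ε x => ∫ s in Set.Icc (0 : ℝ) 1,
      ((1 - s) ^ N * ((N.factorial : ℝ))⁻¹) * (G (N + 1) (s * ε) (complexify x)).re)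
    (γ := fun ε x => ∑ i ∈ Finset.range N,
        ε ^ i * (((i + 1).factorial : ℝ)⁻¹ * (G (i + 1) 0 (complexify x)).re) +
      ε ^ N * ∫ s in Set.Icc (0 : ℝ) 1,
        ((1 - s) ^ N * ((N.factorial : ℝ))⁻¹) * (G (N + 1) (s * ε) (complexify x)).re)
    ?_ ?_ ?_ ?_⟩
  · intro i hi
    rw [← hN]
    exact ⟨_, hrot (analyticClass_mul (analyticClass_const _ _)
      (analyticClass_of_re (hre (i + 1) (by omega) 0 hI0) (hC (i + 1) (by omega) 0 h00)
        fun x => rfl))⟩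
  · rw [← hN]
    refine ⟨_, hev.mono fun ε hε => hrot (analyticClass_integral_family (half_pos hρ₀) ha hb
      (fun ε hε => hC (N + 1) hN1.ge ε hε) (fun ε hε => hre (N + 1) hN1.ge ε (hab hε)) ?_ hε)⟩
    exact (hGc (N + 1) hN1.ge).mono (Set.prod_mono hab (strip_mono (half_le_self hρ₀.le)))
  · rw [← hN]
    exact Eventually.of_forall fun ε x => rfl
  · filter_upwards [hev] with ε hε x
    have hx := complexify_mem_strip hρ₀ x
    have hG0x : ∀ ε ∈ I, (G 0 ε (complexify x)).re = ε * f ε x := fun ε hε => by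
      rw [hG0 ε hε, Complex.ofReal_re]
    rw [← hG0x ε (hab hε)]
    refine eq_mul_taylor (G := fun j ε => (G j ε (complexify x)).re) ha hb (fun j hj ε hε => ?_)
      ?_ ?_ hε
    · have h1 := (hGε j (by omega) ε (hab hε) _ hx).mono hab
      exact Complex.reCLM.hasFDerivAt.comp_hasDerivWithinAt ε h1
    · have h2 : ContinuousOn (fun ε => G (N + 1) ε (complexify x)) (Set.Icc a b) :=
        (hGc (N + 1) hN1.ge).comp (f := fun ε : ℝ => (ε, complexify x)) (by fun_prop)
          fun ε hε => ⟨hab hε, hx⟩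
      exact Complex.continuous_re.comp_continuousOn h2
    · simp [hG0x 0 hI0]

end AnalyticCase

end FPTM

theorem theorem2p1 {e : ℕ} (Ω : Fin (e + 1) → ℝ) (hΩ : FPTM.IsIrrational Ω)
    (α₀ : ℝ) (hα₀ : α₀ ≠ 0) (hres : FPTM.IsResonant (α₀ • Ω))
    (A : Matrix.SpecialLinearGroup (Fin (e + 1)) ℤ) (ω : Fin e → ℝ) (L : Fin (e + 1) → ℤ)
    (hω : FPTM.IsIntrinsicFrequency (α₀ • Ω) A ω L)
    (ν τ : ℝ) (hν : 0 < ν) (hdio : FPTM.IsDiophantine ν τ ω)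
    (I : Set ℝ) (hI : I.OrdConnected) (hI0 : (0 : ℝ) ∈ I) (hI1 : I.Nontrivial)
    (f : ℝ → (Fin (e + 1) → ℝ) → ℝ)
    (n m : ℕ) (hm : 1 ≤ m) (hn : FPTM.IsResonanceOrder A ω I Ω f α₀ n) :
    (FPTM.IsAnalyticFamily (n + m) I (fun ε x => ε * f ε x) →
      ∃ ρ : ℝ, 0 < ρ ∧
        FPTM.HasResonantNormalForm A ω I Ω f α₀ L (FPTM.analyticClass ρ) n m) ∧
    (∀ p q : ℕ, q < p → ((n + m - 1 : ℕ) : ℝ) * (((e + 1 : ℕ) : ℝ) + τ) ≤ (q : ℝ) →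
      FPTM.IsCkFamily p (n + m) I (fun ε x => ε * f ε x) →
        FPTM.HasResonantNormalForm A ω I Ω f α₀ L (FPTM.ckClass (p - q)) n m) :=
  ⟨fun hf => FPTM.hasResonantNormalForm_of_isAnalyticFamily hΩ hα₀ hω hν hdio hI hI0 hI1 hm hn hf,
    fun _ _ hqp hq hf =>
      FPTM.hasResonantNormalForm_of_isCkFamily hΩ hα₀ hω hν hdio hI hI0 hI1 hm hn hqp hq hf⟩
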